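/- Let $K$ be a field of characteristic $0$ and let $D\ge 1$. Let $J(D)$ be the free (non-unital) Jordan $K$-algebra on $x_1,\dots,x_D$, with the action of $GL(D)=GL_D(K)$ by linear substitutions, and let $\mathrm{Inner}\,J(D)$ be the span in $\mathrm{End}_K J(D)$ of the inner derivations $\partial_{x,y}: z\mapsto x(zy)-(xz)y$, with $GL(D)$ acting by conjugation. For a Jordan algebra $J$ let $\mathcal{B}J=\Lambda^2J/\langle a\wedge a^2 : a\in J\rangle$, let $\{a\wedge b\}$ be the class of $a\wedge b$, and for $\omega=\sum_i\{a_i\wedge b_i\}$ put $\partial_\omega=\sum_i\partial_{a_i,b_i}$. Let $\mathfrak{sl}_2J=\mathcal{B}J\oplus(\mathfrak{sl}_2\otimes J)$ be the Tits–Allison–Gao Lie algebra, with bracket $$[x\otimes a,y\otimes b]=[x,y]\otimes ab+\kappa(x,y)\{a\wedge b\},\qquad [\omega,x\otimes a]=x\otimes\partial_\omega a,\qquad [\omega,\{a\wedge b\}]=\{\partial_\omega a\wedge b\}+\{a\wedge\partial_\omega b\},$$ where $\kappa(x,y)=\tfrac12\mathrm{Tr}(\mathrm{ad}\,x\,\mathrm{ad}\,y)$.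 The Lie algebra $\mathfrak{sl}_2$ acts on it by derivations, trivially on $\mathcal{B}J$ and through $\mathrm{ad}\otimes 1$ on $\mathfrak{sl}_2\otimes J$, hence it acts on the Lie algebra homology $H_k(\mathfrak{sl}_2J)$ with trivial coefficients. Identify the completed representation ring $\mathcal{R}_{an}(GL(D))=\prod_{n\ge0}K_0(\mathrm{Pol}_n(GL(D)))$ of polynomial representations with $\mathbb{Z}[[z_1,\dots,z_D]]^{\mathfrak{S}_D}$, the class of an analytic $GL(D)$-module $V$ (a direct sum of finite-dimensional polynomial representations $V_n$ of degree $n$, $n\ge 0$) being its character $[V]=\sum_{\mathbf m}\dim V_{\mathbf m}\,z_1^{m_1}\cdots z_D^{m_D}$, where $V_{\mathbf m}$ is the weight space of weight $\mathbf m$. Likewise view $\mathcal{R}_{an}(GL(D)\times PSL(2))$ inside $\mathbb{Z}[t,t^{-1}][[z_1,\dots,z_D]]$, with $[L(2k)]=\sum_{i=-k}^{k}t^i$ for the irreducible $PSL(2)$-module $L(2k)$ of dimension $2k+1$, and let $[a:L(2k)]\in\mathcal{R}_{an}(GL(D))$ be the multiplicities in $a=\sum_{k\ge0}[a:L(2k)]\,[L(2k)]$.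 Let $\lambda$ be the operation on classes without term of degree $0$ given by $\lambda[V]=\sum_{k\ge 0}(-1)^k[\Lambda^kV]$ and $\lambda(a'-a'')=\lambda(a')\lambda(a'')^{-1}$. Suppose that $H_k(\mathfrak{sl}_2J(1+D))^{\mathfrak{sl}_2}=0$ for all $k\ge1$. Then $J(D)$ and $\mathrm{Inner}\,J(D)$ are analytic $GL(D)$-modules and $$[J(D)]=A(D)\quad\text{and}\quad[\mathrm{Inner}\,J(D)]=B(D)\qquad\text{in }\mathcal{R}_{an}(GL(D)),$$ where $(A(D),B(D))$ is the unique pair of elements $A,B$ of $\mathcal{R}_{an}(GL(D))$ without term of degree $0$ such that $$[\lambda(A[L(2)]+B):L(0)]=1\qquad\text{and}\qquad[\lambda(A[L(2)]+B):L(2)]=-[K^D].$$ That is, the pair $([J(D)],[\mathrm{Inner}\,J(D)])$ solves these two equations, and it is the only solution. -/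

import Mathlib

open scoped TensorProduct

set_option linter.unusedSectionVars false

namespace FreeJordanChar

noncomputable section

section ChevalleyEilenberg

variable {K : Type*} [Field K] {g : Type*} [LieRing g] [LieAlgebra K g]

/-- The derivation of the exterior algebra that extends a linear endomorphism `φ` of `g`:
`x₁ ∧ ⋯ ∧ xₖ ↦ ∑ᵢ x₁ ∧ ⋯ ∧ φ xᵢ ∧ ⋯ ∧ xₖ`. -/
def exteriorDerivation (φ : g →ₗ[K] g) : ExteriorAlgebra K g →ₗ[K] ExteriorAlgebra K g :=
  CliffordAlgebra.foldr' (0 : QuadraticForm K g)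
    (LinearMap.mk₂ K
      (fun (y : g) (p : ExteriorAlgebra K g × ExteriorAlgebra K g) =>
        ExteriorAlgebra.ι K (φ y) * p.1 + ExteriorAlgebra.ι K y * p.2)
      (fun a b p => by simp only [map_add, add_mul]; abel)
      (fun c a p => by simp only [map_smul, smul_mul_assoc, smul_add])
      (fun a p q => by simp only [Prod.fst_add, Prod.snd_add, mul_add]; abel)
      (fun c a p => by simp only [Prod.smul_fst, Prod.smul_snd, mul_smul_comm, smul_add]))
    (fun m x fx => by
      have h1 := ExteriorAlgebra.ι_add_mul_swap (R := K) (φ m) m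
      have h2 := ExteriorAlgebra.ι_sq_zero (R := K) m
      change ExteriorAlgebra.ι K (φ m) * (ExteriorAlgebra.ι K m * x) + ExteriorAlgebra.ι K m *
        (ExteriorAlgebra.ι K (φ m) * x + ExteriorAlgebra.ι K m * fx) = (0 : K) • fx
      rw [zero_smul, mul_add, ← mul_assoc, ← mul_assoc, ← mul_assoc, h2, zero_mul, add_zero,
        ← add_mul, h1, zero_mul])
    0

theorem exteriorDerivation_algebraMap (φ : g →ₗ[K] g) (r : K) :
    exteriorDerivation φ (algebraMap K _ r) = 0 :=
  (CliffordAlgebra.foldr'_algebraMap _ _ _ _ _).trans (smul_zero r)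

theorem exteriorDerivation_ι_mul (φ : g →ₗ[K] g) (y : g) (w : ExteriorAlgebra K g) :
    exteriorDerivation φ (ExteriorAlgebra.ι K y * w) =
      ExteriorAlgebra.ι K (φ y) * w + ExteriorAlgebra.ι K y * exteriorDerivation φ w :=
  CliffordAlgebra.foldr'_ι_mul _ _ _ _ _ _

theorem exteriorAlgebra_induction {P : ExteriorAlgebra K g → Prop}
    (h0 : ∀ r : K, P (algebraMap K _ r)) (hadd : ∀ x y, P x → P y → P (x + y))
    (hι : ∀ x y, P x → P (ExteriorAlgebra.ι K y * x)) (x : ExteriorAlgebra K g) : P x :=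
  CliffordAlgebra.left_induction (Q := (0 : QuadraticForm K g)) h0 hadd hι x

theorem exteriorDerivation_add (φ ψ : g →ₗ[K] g) :
    exteriorDerivation (φ + ψ) = exteriorDerivation φ + exteriorDerivation ψ := by
  refine LinearMap.ext fun w => ?_
  induction w using exteriorAlgebra_induction with
  | h0 r => simp [exteriorDerivation_algebraMap]
  | hadd x y hx hy => rw [map_add, map_add, hx, hy]
  | hι x y hx =>
    rw [LinearMap.add_apply, exteriorDerivation_ι_mul, exteriorDerivation_ι_mul,
      exteriorDerivation_ι_mul, hx, LinearMap.add_apply, LinearMap.add_apply, map_add]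
    noncomm_ring

theorem exteriorDerivation_smul (c : K) (φ : g →ₗ[K] g) :
    exteriorDerivation (c • φ) = c • exteriorDerivation φ := by
  refine LinearMap.ext fun w => ?_
  induction w using exteriorAlgebra_induction with
  | h0 r => simp [exteriorDerivation_algebraMap]
  | hadd x y hx hy => rw [map_add, map_add, hx, hy]
  | hι x y hx =>
    rw [LinearMap.smul_apply, exteriorDerivation_ι_mul, exteriorDerivation_ι_mul, hx,
      LinearMap.smul_apply, LinearMap.smul_apply, map_smul, smul_mul_assoc, mul_smul_comm, smul_add]

variable (K g) in
/-- The Chevalley–Eilenberg differential on `Λ g`, given by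
`d 1 = 0` and `d (x ∧ w) = ad x · w - x ∧ d w`; explicitly,
`d (x₁ ∧ ⋯ ∧ xₖ) = ∑_{i < j} (-1) ^ (i + j + 1) [xᵢ, xⱼ] ∧ x₁ ∧ ⋯ x̂ᵢ ⋯ x̂ⱼ ⋯ ∧ xₖ`. -/
def ceDifferential : ExteriorAlgebra K g →ₗ[K] ExteriorAlgebra K g :=
  CliffordAlgebra.foldr' (0 : QuadraticForm K g)
    (LinearMap.mk₂ K
      (fun (x : g) (p : ExteriorAlgebra K g × ExteriorAlgebra K g) =>
        exteriorDerivation (LieAlgebra.ad K g x : g →ₗ[K] g) p.1 - ExteriorAlgebra.ι K x * p.2)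
      (fun a b p => by
        simp only [map_add, exteriorDerivation_add, LinearMap.add_apply, add_mul]; abel)
      (fun c a p => by
        simp only [map_smul, exteriorDerivation_smul, LinearMap.smul_apply, smul_mul_assoc,
          smul_sub])
      (fun a p q => by simp only [Prod.fst_add, Prod.snd_add, map_add, mul_add]; abel)
      (fun c a p => by
        simp only [Prod.smul_fst, Prod.smul_snd, map_smul, mul_smul_comm, smul_sub]))
    (fun m x fx => by
      have h2 := ExteriorAlgebra.ι_sq_zero (R := K) m
      change exteriorDerivation (LieAlgebra.ad K g m : g →ₗ[K] g) (ExteriorAlgebra.ι K m * x) -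
        ExteriorAlgebra.ι K m * (exteriorDerivation (LieAlgebra.ad K g m : g →ₗ[K] g) x -
          ExteriorAlgebra.ι K m * fx) = (0 : K) • fx
      rw [zero_smul, exteriorDerivation_ι_mul, mul_sub, ← mul_assoc, h2, LieAlgebra.ad_apply,
        lie_self, map_zero, zero_mul, zero_mul, zero_add, sub_zero, sub_self])
    0

theorem ceDifferential_algebraMap (r : K) : ceDifferential K g (algebraMap K _ r) = 0 :=
  (CliffordAlgebra.foldr'_algebraMap _ _ _ _ _).trans (smul_zero r)

theorem ceDifferential_ι_mul (x : g) (w : ExteriorAlgebra K g) :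
    ceDifferential K g (ExteriorAlgebra.ι K x * w) =
      exteriorDerivation (LieAlgebra.ad K g x : g →ₗ[K] g) w -
        ExteriorAlgebra.ι K x * ceDifferential K g w :=
  CliffordAlgebra.foldr'_ι_mul _ _ _ _ _ _

theorem exteriorDerivation_comm_ad (f : LieDerivation K g g) (x : g) (w : ExteriorAlgebra K g) :
    exteriorDerivation (f : g →ₗ[K] g)
        (exteriorDerivation (LieAlgebra.ad K g x : g →ₗ[K] g) w) =
      exteriorDerivation (LieAlgebra.ad K g (f x) : g →ₗ[K] g) w +
        exteriorDerivation (LieAlgebra.ad K g x : g →ₗ[K] g)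
          (exteriorDerivation (f : g →ₗ[K] g) w) := by
  induction w using exteriorAlgebra_induction with
  | h0 r => simp [exteriorDerivation_algebraMap]
  | hadd x y hx hy => simp only [map_add, hx, hy]; abel
  | hι w y hw =>
    simp only [exteriorDerivation_ι_mul, map_add, hw, LieAlgebra.ad_apply,
      LieDerivation.coeFn_coe, LieDerivation.apply_lie_eq_add]
    noncomm_ring

theorem ceDifferential_comm (f : LieDerivation K g g) (w : ExteriorAlgebra K g) :
    ceDifferential K g (exteriorDerivation (f : g →ₗ[K] g) w) =
      exteriorDerivation (f : g →ₗ[K] g) (ceDifferential K g w) := by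
  induction w using exteriorAlgebra_induction with
  | h0 r => simp [exteriorDerivation_algebraMap, ceDifferential_algebraMap]
  | hadd x y hx hy => simp only [map_add, hx, hy]
  | hι w y hw =>
    simp only [exteriorDerivation_ι_mul, ceDifferential_ι_mul, map_add, map_sub, hw,
      exteriorDerivation_comm_ad, LieDerivation.coeFn_coe]
    noncomm_ring

theorem exteriorDerivation_mem (φ : g →ₗ[K] g) (k : ℕ) {w : ExteriorAlgebra K g}
    (hw : w ∈ ⋀[K]^k g) : exteriorDerivation φ w ∈ ⋀[K]^k g := by
  induction k generalizing w with
  | zero =>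
    change w ∈ LinearMap.range (ExteriorAlgebra.ι K) ^ 0 at hw
    rw [pow_zero, Submodule.mem_one] at hw
    obtain ⟨r, rfl⟩ := hw
    rw [exteriorDerivation_algebraMap]
    exact zero_mem _
  | succ k ih =>
    change _ ∈ LinearMap.range (ExteriorAlgebra.ι K) ^ (k + 1)
    change w ∈ LinearMap.range (ExteriorAlgebra.ι K) ^ (k + 1) at hw
    rw [pow_succ'] at hw ⊢
    induction hw using Submodule.mul_induction_on' with
    | mem_mul_mem a ha b hb =>
      obtain ⟨y, rfl⟩ := ha
      rw [exteriorDerivation_ι_mul]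
      exact add_mem (Submodule.mul_mem_mul ⟨_, rfl⟩ hb) (Submodule.mul_mem_mul ⟨_, rfl⟩ (ih hb))
    | add a _ b _ ha hb => rw [map_add]; exact add_mem ha hb

variable (K g) in
/-- The cycles of degree `k` of the Chevalley–Eilenberg complex `(Λ g, d)`. -/
def ceCycles (k : ℕ) : Submodule K (ExteriorAlgebra K g) :=
  LinearMap.ker (ceDifferential K g) ⊓ ⋀[K]^k g

variable (K g) in
/-- The boundaries of degree `k` of the Chevalley–Eilenberg complex `(Λ g, d)`. -/
def ceBoundaries (k : ℕ) : Submodule K (ExteriorAlgebra K g) :=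
  (⋀[K]^(k + 1) g).map (ceDifferential K g)

variable (K g) in
/-- The homology `H_k(g)` of the Lie algebra `g` with trivial coefficients. -/
abbrev LieHomology (k : ℕ) : Type _ :=
  ↥(ceCycles K g k) ⧸ (ceBoundaries K g k).submoduleOf (ceCycles K g k)

/-- The action of a derivation of `g` on the cycles. -/
def ceCyclesMap (f : LieDerivation K g g) (k : ℕ) : ceCycles K g k →ₗ[K] ceCycles K g k :=
  (exteriorDerivation (f : g →ₗ[K] g)).restrict (fun w hw => by
    refine ⟨?_, exteriorDerivation_mem _ k hw.2⟩
    have h : ceDifferential K g w = 0 := hw.1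
    change ceDifferential K g _ = 0
    rw [ceDifferential_comm, h, map_zero])

/-- The action of a derivation of `g` on `H_k(g)`. -/
def lieHomologyMap (f : LieDerivation K g g) (k : ℕ) :
    LieHomology K g k →ₗ[K] LieHomology K g k :=
  Submodule.mapQ _ _ (ceCyclesMap f k) (by
    rintro ⟨w, hw⟩ ⟨v, hv, hvw⟩
    exact ⟨exteriorDerivation (f : g →ₗ[K] g) v, exteriorDerivation_mem _ _ hv, by
      rw [ceDifferential_comm, hvw]; rfl⟩)

/-- When a Lie algebra `s` acts on `g` by derivations, the invariants `H_k(g)^s`. -/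
def lieHomologyInvariants {s : Type*} [LieRing s] [LieAlgebra K s]
    (θ : s →ₗ⁅K⁆ LieDerivation K g g) (k : ℕ) : Submodule K (LieHomology K g k) :=
  ⨅ x : s, LinearMap.ker (lieHomologyMap (θ x) k)

end ChevalleyEilenberg

section FreeJordan

variable (K : Type*) [Field K] (X : Type*)

/-- The Jordan ideal of the free non-unital non-associative algebra: the smallest two-sided ideal
whose quotient is commutative and satisfies the Jordan identity `x² (y x) = (x² y) x`. -/
def jordanIdeal : Submodule K (FreeNonUnitalNonAssocAlgebra K X) :=
  sInf {N | (∀ a b, a * b - b * a ∈ N) ∧ (∀ x y, (x * x) * (y * x) - ((x * x) * y) * x ∈ N) ∧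
    ∀ a ∈ N, ∀ b, a * b ∈ N ∧ b * a ∈ N}

/-- The free (non-unital) Jordan algebra over `K` generated by the set `X`. -/
def FreeJordan : Type _ := FreeNonUnitalNonAssocAlgebra K X ⧸ jordanIdeal K X

namespace FreeJordan

instance : AddCommGroup (FreeJordan K X) := Submodule.Quotient.addCommGroup _

instance : Module K (FreeJordan K X) := Submodule.Quotient.module _

variable {K X}

theorem mul_comm_mem (a b : FreeNonUnitalNonAssocAlgebra K X) :
    a * b - b * a ∈ jordanIdeal K X :=
  Submodule.mem_sInf.2 fun _ hN => hN.1 a b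

theorem jordan_mem (x y : FreeNonUnitalNonAssocAlgebra K X) :
    (x * x) * (y * x) - ((x * x) * y) * x ∈ jordanIdeal K X :=
  Submodule.mem_sInf.2 fun _ hN => hN.2.1 x y

theorem mul_mem_right {a : FreeNonUnitalNonAssocAlgebra K X} (ha : a ∈ jordanIdeal K X)
    (b : FreeNonUnitalNonAssocAlgebra K X) : a * b ∈ jordanIdeal K X :=
  Submodule.mem_sInf.2 fun N hN => (hN.2.2 a (Submodule.mem_sInf.1 ha N hN) b).1

theorem mul_mem_left {a : FreeNonUnitalNonAssocAlgebra K X} (ha : a ∈ jordanIdeal K X)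
    (b : FreeNonUnitalNonAssocAlgebra K X) : b * a ∈ jordanIdeal K X :=
  Submodule.mem_sInf.2 fun N hN => (hN.2.2 a (Submodule.mem_sInf.1 ha N hN) b).2

/-- The quotient map. -/
def mk : FreeNonUnitalNonAssocAlgebra K X →ₗ[K] FreeJordan K X := (jordanIdeal K X).mkQ

theorem mk_surjective : Function.Surjective (mk : _ → FreeJordan K X) :=
  Submodule.mkQ_surjective _

theorem mk_eq_mk {a b : FreeNonUnitalNonAssocAlgebra K X} :
    (mk a : FreeJordan K X) = mk b ↔ a - b ∈ jordanIdeal K X :=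
  Submodule.Quotient.eq _

instance : Mul (FreeJordan K X) :=
  ⟨fun a b => Quotient.map₂ (· * ·) (fun a a' ha b b' hb => by
    rw [← Quotient.eq_iff_equiv] at *
    have ha' := (Submodule.Quotient.eq (jordanIdeal K X)).1 ha
    have hb' := (Submodule.Quotient.eq (jordanIdeal K X)).1 hb
    refine (Submodule.Quotient.eq (jordanIdeal K X)).2 ?_
    have h : a * b - a' * b' = (a - a') * b + a' * (b - b') := by
      rw [sub_mul, mul_sub]; abel
    rw [h]
    exact add_mem (mul_mem_right ha' _) (mul_mem_left hb' _)) a b⟩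

theorem mk_mul (a b : FreeNonUnitalNonAssocAlgebra K X) :
    (mk (a * b) : FreeJordan K X) = mk a * mk b := rfl

instance : NonUnitalNonAssocCommRing (FreeJordan K X) where
  left_distrib a b c := by
    obtain ⟨a, rfl⟩ := mk_surjective a
    obtain ⟨b, rfl⟩ := mk_surjective b
    obtain ⟨c, rfl⟩ := mk_surjective c
    simp only [← mk_mul, ← map_add, mul_add]
  right_distrib a b c := by
    obtain ⟨a, rfl⟩ := mk_surjective a
    obtain ⟨b, rfl⟩ := mk_surjective b
    obtain ⟨c, rfl⟩ := mk_surjective c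
    simp only [← mk_mul, ← map_add, add_mul]
  zero_mul a := by
    obtain ⟨a, rfl⟩ := mk_surjective a
    rw [← map_zero mk, ← mk_mul, zero_mul]
  mul_zero a := by
    obtain ⟨a, rfl⟩ := mk_surjective a
    rw [← map_zero mk, ← mk_mul, mul_zero]
  mul_comm a b := by
    obtain ⟨a, rfl⟩ := mk_surjective a
    obtain ⟨b, rfl⟩ := mk_surjective b
    rw [← mk_mul, ← mk_mul, mk_eq_mk]
    exact mul_comm_mem a b

instance : IsScalarTower K (FreeJordan K X) (FreeJordan K X) where
  smul_assoc c a b := by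
    obtain ⟨a, rfl⟩ := mk_surjective a
    obtain ⟨b, rfl⟩ := mk_surjective b
    simp only [smul_eq_mul, ← map_smul, ← mk_mul, smul_mul_assoc]

instance : SMulCommClass K (FreeJordan K X) (FreeJordan K X) where
  smul_comm c a b := by
    obtain ⟨a, rfl⟩ := mk_surjective a
    obtain ⟨b, rfl⟩ := mk_surjective b
    simp only [smul_eq_mul, ← map_smul, ← mk_mul, mul_smul_comm]

instance : IsCommJordan (FreeJordan K X) where
  lmul_comm_rmul_rmul a b := by
    have h : (a * a) * (b * a) = ((a * a) * b) * a := by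
      obtain ⟨a, rfl⟩ := mk_surjective a
      obtain ⟨b, rfl⟩ := mk_surjective b
      simp only [← mk_mul]
      rw [mk_eq_mk]
      exact jordan_mem a b
    rw [mul_comm (a * b), mul_comm a b, h, mul_comm (a * a * b), mul_comm (a * a)]

/-- The generators of the free Jordan algebra. -/
def of (x : X) : FreeJordan K X := mk (FreeNonUnitalNonAssocAlgebra.of K x)

section lift

variable {A : Type*} [NonUnitalNonAssocCommRing A] [Module K A] [IsScalarTower K A A]
  [SMulCommClass K A A] [IsCommJordan A]

/-- The universal property of the free Jordan algebra. -/
def lift (f : X → A) : FreeJordan K X →ₙₐ[K] A :=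
  let F : FreeNonUnitalNonAssocAlgebra K X →ₙₐ[K] A := FreeNonUnitalNonAssocAlgebra.lift K f
  let L : FreeJordan K X →ₗ[K] A := (jordanIdeal K X).liftQ (F : _ →ₗ[K] A) (by
    refine sInf_le ⟨fun a b => ?_, fun x y => ?_, fun a ha b => ?_⟩
    · change F (a * b - b * a) = 0
      rw [map_sub, map_mul, map_mul, mul_comm, sub_self]
    · change F (x * x * (y * x) - x * x * y * x) = 0
      simp only [map_sub, map_mul]
      have h := IsCommJordan.lmul_comm_rmul_rmul (F x) (F y)
      rw [mul_comm (F y), mul_comm (F x * F x) (F x * F y), h, mul_comm (F x),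
        mul_comm (F y), sub_self]
    · change F a = 0 at ha
      change F (a * b) = 0 ∧ F (b * a) = 0
      rw [map_mul, map_mul, ha, zero_mul, mul_zero]
      exact ⟨rfl, rfl⟩)
  { L with
    map_zero' := map_zero L
    map_mul' := fun a b => by
      obtain ⟨a, rfl⟩ := mk_surjective a
      obtain ⟨b, rfl⟩ := mk_surjective b
      exact map_mul F a b }

@[simp]
theorem lift_of (f : X → A) (x : X) : lift (K := K) f (of x) = f x :=
  FreeNonUnitalNonAssocAlgebra.lift_of_apply K f x

theorem hom_ext {F G : FreeJordan K X →ₙₐ[K] A} (h : ∀ x, F (of x) = G (of x)) : F = G := by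
  let M : FreeNonUnitalNonAssocAlgebra K X →ₙₐ[K] FreeJordan K X :=
    { (mk : _ →ₗ[K] FreeJordan K X) with
      map_zero' := map_zero mk
      map_mul' := mk_mul }
  have h1 : F.comp M = G.comp M := FreeNonUnitalNonAssocAlgebra.hom_ext K h
  ext a
  obtain ⟨a, rfl⟩ := mk_surjective a
  exact DFunLike.congr_fun h1 a

end lift

end FreeJordan

end FreeJordan

section Jordan

variable (K : Type*) [Field K] {J : Type*} [NonUnitalNonAssocCommRing J] [Module K J]
  [IsScalarTower K J J] [SMulCommClass K J J]

/-- The endomorphism `∂_{x,y} : z ↦ x (z y) - (x z) y`. -/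
def jordanPartial (x y : J) : Module.End K J :=
  LinearMap.mul K J x ∘ₗ (LinearMap.mul K J).flip y -
    (LinearMap.mul K J).flip y ∘ₗ LinearMap.mul K J x

theorem jordanPartial_apply (x y z : J) : jordanPartial K x y z = x * (z * y) - (x * z) * y := rfl

variable (J) in
/-- The space of inner derivations of `J`. -/
def innerDer : Submodule K (Module.End K J) :=
  Submodule.span K {φ | ∃ x y : J, φ = jordanPartial K x y}

/-- The linearised Jordan identity. -/
theorem jordan_linearized [CharZero K] [IsCommJordan J] (a b c d : J) :
    a * ((b * c) * d) - (b * c) * (a * d) + (b * ((c * a) * d) - (c * a) * (b * d)) +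
      (c * ((a * b) * d) - (a * b) * (c * d)) = 0 := by
  have h := DFunLike.congr_fun (two_nsmul_lie_lmul_lmul_add_add_eq_zero a b c) d
  have h2 : (2 : K) • (a * ((b * c) * d) - (b * c) * (a * d) +
      (b * ((c * a) * d) - (c * a) * (b * d)) +
      (c * ((a * b) * d) - (a * b) * (c * d))) = 0 := by
    rw [two_smul, ← two_nsmul]
    exact h
  exact (smul_eq_zero.1 h2).resolve_left two_ne_zero

/-- `∂_{x,y}` is a derivation. -/
theorem jordanPartial_mul [CharZero K] [IsCommJordan J] (a d b c : J) :
    jordanPartial K a d (b * c) = jordanPartial K a d b * c + b * jordanPartial K a d c := by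
  have h1 := jordan_linearized K a b c d
  have h2 := jordan_linearized K d b c a
  simp only [jordanPartial_apply, mul_sub, sub_mul]
  have e := sub_eq_zero.2 (h1.trans h2.symm)
  rw [← sub_eq_zero, ← e]
  simp only [mul_comm]
  abel

theorem jordanPartial_swap (a b : J) : jordanPartial K a b = -jordanPartial K b a := by
  ext z
  simp only [jordanPartial_apply, LinearMap.neg_apply, mul_comm, neg_sub]

theorem jordanPartial_self (a : J) : jordanPartial K a a = 0 := by
  ext z
  simp only [jordanPartial_apply, LinearMap.zero_apply, mul_comm, sub_self]

theorem jordanPartial_sq [IsCommJordan J] (a : J) : jordanPartial K a (a * a) = 0 := by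
  ext z
  have h := IsCommJordan.lmul_comm_rmul_rmul a z
  rw [jordanPartial_apply, h, sub_self]
  rfl

/-- `∂_{x,y}`, as a bilinear map. -/
def jordanPartialHom : J →ₗ[K] J →ₗ[K] Module.End K J :=
  LinearMap.mk₂ K (jordanPartial K)
    (fun a a' b => by
      ext z; simp only [jordanPartial_apply, LinearMap.add_apply, add_mul]; abel)
    (fun c a b => by
      ext z; simp only [jordanPartial_apply, LinearMap.smul_apply, smul_mul_assoc, smul_sub])
    (fun a b b' => by
      ext z; simp only [jordanPartial_apply, LinearMap.add_apply, mul_add]; abel)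
    (fun c a b => by
      ext z; simp only [jordanPartial_apply, LinearMap.smul_apply, mul_smul_comm, smul_sub])

variable (J) in
/-- The relations `a ∧ a = 0` and `a ∧ a² = 0` in `J ⊗ J`. -/
def tagRelations : Submodule K (J ⊗[K] J) :=
  Submodule.span K ({t | ∃ a : J, t = a ⊗ₜ a} ∪ {t | ∃ a : J, t = a ⊗ₜ (a * a)})

variable (J) in
/-- `ℬJ = Λ²J / R(J)`, where `R(J)` is the span of all `a ∧ a²`; here `Λ²J` is the quotient of
`J ⊗ J` by the span of all `a ⊗ a`. -/
abbrev TagB : Type _ := (J ⊗[K] J) ⧸ tagRelations K J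

/-- The class `{a ∧ b}` in `ℬJ`. -/
def tagWedge : J →ₗ[K] J →ₗ[K] TagB K J :=
  (TensorProduct.mk K J J).compr₂ (tagRelations K J).mkQ

theorem tagWedge_self (a : J) : tagWedge K a a = 0 :=
  (Submodule.Quotient.mk_eq_zero _).2 (Submodule.subset_span (Or.inl ⟨a, rfl⟩))

theorem tagWedge_sq (a : J) : tagWedge K a (a * a) = 0 :=
  (Submodule.Quotient.mk_eq_zero _).2 (Submodule.subset_span (Or.inr ⟨a, rfl⟩))

theorem tagWedge_swap (a b : J) : tagWedge K a b = -tagWedge K b a := by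
  have h := tagWedge_self K (a + b)
  simp only [map_add, LinearMap.add_apply, tagWedge_self, zero_add, add_zero] at h
  exact eq_neg_of_add_eq_zero_right h

variable {K} in
theorem tagB_induction {P : TagB K J → Prop} (h0 : P 0)
    (hw : ∀ a b : J, P (tagWedge K a b)) (hadd : ∀ x y, P x → P y → P (x + y)) (x : TagB K J) :
    P x := by
  obtain ⟨t, rfl⟩ := Submodule.mkQ_surjective _ x
  induction t using TensorProduct.induction_on with
  | zero => rw [map_zero]; exact h0
  | tmul a b => exact hw a b
  | add x y hx hy => rw [map_add]; exact hadd _ _ hx hy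

variable {K} in
theorem tagB_hom_ext {M : Type*} [AddCommGroup M] [Module K M] {f f' : TagB K J →ₗ[K] M}
    (h : ∀ a b : J, f (tagWedge K a b) = f' (tagWedge K a b)) : f = f' := by
  refine LinearMap.ext fun x => ?_
  induction x using tagB_induction with
  | h0 => rw [map_zero, map_zero]
  | hw a b => exact h a b
  | hadd x y hx hy => rw [map_add, map_add, hx, hy]

/-- The linearisation of `{a ∧ a²} = 0`. -/
theorem tagWedge_cyclic [CharZero K] (a b c : J) :
    tagWedge K (a * b) c + tagWedge K (b * c) a + tagWedge K (c * a) b = 0 := by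
  have e1 := tagWedge_sq K (a + b + c)
  have e2 := tagWedge_sq K (a + b)
  have e3 := tagWedge_sq K (a + c)
  have e4 := tagWedge_sq K (b + c)
  have h1 := tagWedge_sq K a
  have h2 := tagWedge_sq K b
  have h3 := tagWedge_sq K c
  simp only [add_mul, mul_add, map_add, LinearMap.add_apply, h1, h2, h3, mul_comm b a,
    mul_comm c a, mul_comm c b] at e1 e2 e3 e4
  have h : (2 : K) • (tagWedge K a (b * c) + tagWedge K b (a * c) + tagWedge K c (a * b)) = 0 := by
    linear_combination (norm := module) e1 - e2 - e3 - e4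
  have h' := (smul_eq_zero.1 h).resolve_left two_ne_zero
  rw [tagWedge_swap K (a * b), tagWedge_swap K (b * c), tagWedge_swap K (c * a), mul_comm c a]
  linear_combination (norm := module) -h'

variable [IsCommJordan J]

variable (J) in
/-- The natural map `ℬJ → Inner J ⊆ End J`, `{a ∧ b} ↦ ∂_{a,b}`. -/
def tagPartial : TagB K J →ₗ[K] Module.End K J :=
  (tagRelations K J).liftQ (TensorProduct.lift (jordanPartialHom K)) (by
    refine Submodule.span_le.2 ?_
    rintro _ (⟨a, rfl⟩ | ⟨a, rfl⟩)
    · exact jordanPartial_self K a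
    · exact jordanPartial_sq K a)

@[simp]
theorem tagPartial_wedge (a b : J) :
    tagPartial K J (tagWedge K a b) = jordanPartial K a b := rfl

variable [CharZero K]

theorem tagPartial_mul (w : TagB K J) (a b : J) :
    tagPartial K J w (a * b) = tagPartial K J w a * b + a * tagPartial K J w b := by
  induction w using tagB_induction with
  | h0 => simp
  | hw c d => exact jordanPartial_mul K c d a b
  | hadd x y hx hy => simp only [map_add, LinearMap.add_apply, hx, hy, add_mul, mul_add]; abel

variable (J) in
/-- The action of `ℬJ` on `ℬJ`, `ω • {a ∧ b} = {∂_ω a ∧ b} + {a ∧ ∂_ω b}`. -/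
def tagAction : TagB K J →ₗ[K] TagB K J →ₗ[K] TagB K J :=
  LinearMap.flip <| (tagRelations K J).liftQ
    (TensorProduct.lift (LinearMap.mk₂ K
      (fun a b => (tagWedge K).flip b ∘ₗ (tagPartial K J).flip a +
        tagWedge K a ∘ₗ (tagPartial K J).flip b)
      (fun a a' b => by ext w; simp; abel)
      (fun c a b => by ext w; simp)
      (fun a b b' => by ext w; simp; abel)
      (fun c a b => by ext w; simp))) (by
    refine Submodule.span_le.2 ?_
    rintro _ (⟨a, rfl⟩ | ⟨a, rfl⟩)
    · refine LinearMap.ext fun w => ?_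
      change tagWedge K (tagPartial K J w a) a + tagWedge K a (tagPartial K J w a) = 0
      rw [tagWedge_swap, neg_add_cancel]
    · refine LinearMap.ext fun w => ?_
      change tagWedge K (tagPartial K J w a) (a * a) + tagWedge K a (tagPartial K J w (a * a)) = 0
      have h := tagWedge_cyclic K (tagPartial K J w a) a a
      rw [tagPartial_mul, map_add, mul_comm a (tagPartial K J w a)]
      rw [mul_comm a (tagPartial K J w a), tagWedge_swap, tagWedge_swap K (a * a)] at h
      linear_combination (norm := module) -h)

@[simp]
theorem tagAction_wedge (w : TagB K J) (a b : J) :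
    tagAction K J w (tagWedge K a b) =
      tagWedge K (tagPartial K J w a) b + tagWedge K a (tagPartial K J w b) := rfl

theorem tagAction_swap (w w' : TagB K J) : tagAction K J w w' = -tagAction K J w' w := by
  induction w using tagB_induction with
  | h0 => simp
  | hadd x y hx hy => simp only [map_add, LinearMap.add_apply, hx, hy, neg_add]
  | hw a b =>
    induction w' using tagB_induction with
    | h0 => simp
    | hadd x y hx hy => simp only [map_add, LinearMap.add_apply, hx, hy, neg_add]
    | hw c d =>
      simp only [tagAction_wedge, tagPartial_wedge, jordanPartial_apply, map_sub,
        LinearMap.sub_apply]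
      have t1 := tagWedge_cyclic K a (c * b) d
      have t2 := tagWedge_cyclic K (a * c) b d
      have t3 := tagWedge_cyclic K c (a * d) b
      have t4 := tagWedge_cyclic K c a (b * d)
      have s1 := tagWedge_swap K (a * d) (b * c)
      have s2 := tagWedge_swap K (a * c) (b * d)
      have s3 := tagWedge_swap K a (d * (b * c))
      have s5 := tagWedge_swap K c (b * (a * d))
      have s6 := tagWedge_swap K c (a * (b * d))
      have s7 := tagWedge_swap K a (c * (b * d))
      simp only [mul_comm] at t1 t2 t3 t4 s1 s2 s3 s5 s6 s7 ⊢
      linear_combination (norm := module) t1 - t2 + t3 - t4 - s1 + s2 - s3 - s5 + s6 + s7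

theorem tagPartial_action (w w' : TagB K J) :
    tagPartial K J (tagAction K J w w') =
      tagPartial K J w * tagPartial K J w' - tagPartial K J w' * tagPartial K J w := by
  induction w' using tagB_induction with
  | h0 => simp
  | hadd x y hx hy => simp only [map_add, hx, hy, mul_add, add_mul]; abel
  | hw c d =>
    refine LinearMap.ext fun z => ?_
    simp only [tagAction_wedge, tagPartial_wedge, map_add, LinearMap.add_apply,
      LinearMap.sub_apply, Module.End.mul_apply, jordanPartial_apply, map_sub, tagPartial_mul,
      mul_add, add_mul]
    abel

theorem tagAction_action (w w' z : TagB K J) :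
    tagAction K J (tagAction K J w w') z =
      tagAction K J w (tagAction K J w' z) - tagAction K J w' (tagAction K J w z) := by
  induction z using tagB_induction with
  | h0 => simp
  | hadd x y hx hy => simp only [map_add, hx, hy]; abel
  | hw c d =>
    simp only [tagAction_wedge, tagPartial_action, map_add, map_sub,
      LinearMap.sub_apply, Module.End.mul_apply]
    abel

end Jordan

section TAG

variable (K : Type*) [Field K]

/-- The Lie algebra `sl₂`. -/
abbrev Sl2 : Type _ := LieAlgebra.SpecialLinear.sl (Fin 2) K

/-- The invariant form `κ(x, y) = ½ Tr (ad x ∘ ad y) = 2 Tr (x y)` on `sl₂`; it is normalised by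
`κ(h, h) = 4`. -/
def sl2Form : Sl2 K →ₗ[K] Sl2 K →ₗ[K] K :=
  LinearMap.mk₂ K (fun x y => 2 * Matrix.trace (x.1 * y.1))
    (fun x x' y => by simp [add_mul, mul_add])
    (fun c x y => by simp; ring)
    (fun x y y' => by simp [mul_add])
    (fun c x y => by simp; ring)

theorem sl2Form_apply (x y : Sl2 K) : sl2Form K x y = 2 * Matrix.trace (x.1 * y.1) := rfl

theorem sl2Form_symm (x y : Sl2 K) : sl2Form K x y = sl2Form K y x := by
  rw [sl2Form_apply, sl2Form_apply, Matrix.trace_mul_comm]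

theorem sl2_lie_lie (x y z : Sl2 K) :
    ⁅x, ⁅y, z⁆⁆ = sl2Form K x y • z - sl2Form K x z • y := by
  obtain ⟨x, hx⟩ := x
  obtain ⟨y, hy⟩ := y
  obtain ⟨z, hz⟩ := z
  have hx' : x 1 1 = - x 0 0 := by
    have h : Matrix.trace x = 0 := hx
    rw [Matrix.trace_fin_two] at h; linear_combination h
  have hy' : y 1 1 = - y 0 0 := by
    have h : Matrix.trace y = 0 := hy
    rw [Matrix.trace_fin_two] at h; linear_combination h
  have hz' : z 1 1 = - z 0 0 := by
    have h : Matrix.trace z = 0 := hz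
    rw [Matrix.trace_fin_two] at h; linear_combination h
  apply Subtype.ext
  change x * (y * z - z * y) - (y * z - z * y) * x =
    (2 * Matrix.trace (x * y)) • z - (2 * Matrix.trace (x * z)) • y
  ext i j
  fin_cases i <;> fin_cases j <;>
    simp [Matrix.trace_fin_two, Matrix.mul_apply, Fin.sum_univ_two, hx', hy', hz'] <;> ring

theorem sl2Form_lie (x y z : Sl2 K) : sl2Form K x ⁅y, z⁆ = sl2Form K ⁅x, y⁆ z := by
  rw [sl2Form_apply, sl2Form_apply, LieAlgebra.SpecialLinear.sl_bracket,
    LieAlgebra.SpecialLinear.sl_bracket, mul_sub, sub_mul, Matrix.trace_sub, Matrix.trace_sub,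
    ← mul_assoc, ← mul_assoc, mul_assoc y.1, Matrix.trace_mul_comm y.1, mul_assoc, mul_assoc]

theorem eq_zero_of_eq_neg [CharZero K] {M : Type*} [AddCommGroup M] [Module K M] {x : M}
    (h : x = -x) : x = 0 := by
  have h2 : (2 : K) • x = 0 := by rw [two_smul]; exact add_eq_zero_iff_eq_neg.2 h
  exact (smul_eq_zero.1 h2).resolve_left two_ne_zero

variable (J : Type*) [NonUnitalNonAssocCommRing J] [Module K J]
  [IsScalarTower K J J] [SMulCommClass K J J]

/-- The underlying space `ℬJ ⊕ sl₂ ⊗ J` of the Tits–Allison–Gao construction. -/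
def TAG : Type _ := TagB K J × (Sl2 K ⊗[K] J)

namespace TAG

instance : AddCommGroup (TAG K J) := inferInstanceAs (AddCommGroup (TagB K J × (Sl2 K ⊗[K] J)))

instance : Module K (TAG K J) := inferInstanceAs (Module K (TagB K J × (Sl2 K ⊗[K] J)))

/-- `(x ⊗ a, y ⊗ b) ↦ [x, y] ⊗ a b`. -/
def bracketSl : Sl2 K ⊗[K] J →ₗ[K] Sl2 K ⊗[K] J →ₗ[K] Sl2 K ⊗[K] J :=
  TensorProduct.map₂ (LieModule.toEnd K (Sl2 K) (Sl2 K) : Sl2 K →ₗ[K] Module.End K (Sl2 K))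
    (LinearMap.mul K J)

/-- `(x ⊗ a, y ⊗ b) ↦ κ(x, y) {a ∧ b}`. -/
def bracketB : Sl2 K ⊗[K] J →ₗ[K] Sl2 K ⊗[K] J →ₗ[K] TagB K J :=
  (TensorProduct.map₂ (sl2Form K) (tagWedge K)).compr₂ (TensorProduct.lid K (TagB K J) : _ →ₗ[K] _)

/-- `(ω, x ⊗ a) ↦ x ⊗ ∂_ω a`. -/
def actSl [IsCommJordan J] : TagB K J →ₗ[K] Sl2 K ⊗[K] J →ₗ[K] Sl2 K ⊗[K] J :=
  TensorProduct.mapBilinear (RingHom.id K) _ _ _ _ LinearMap.id ∘ₗ tagPartial K J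

variable {K J}

@[simp]
theorem bracketSl_tmul (x y : Sl2 K) (a b : J) :
    bracketSl K J (x ⊗ₜ a) (y ⊗ₜ b) = ⁅x, y⁆ ⊗ₜ (a * b) := rfl

@[simp]
theorem bracketB_tmul (x y : Sl2 K) (a b : J) :
    bracketB K J (x ⊗ₜ a) (y ⊗ₜ b) = sl2Form K x y • tagWedge K a b := rfl

@[simp]
theorem actSl_tmul [IsCommJordan J] (w : TagB K J) (x : Sl2 K) (a : J) :
    actSl K J w (x ⊗ₜ a) = x ⊗ₜ tagPartial K J w a := rfl

theorem bracketSl_swap (u v : Sl2 K ⊗[K] J) : bracketSl K J u v = -bracketSl K J v u := by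
  induction u using TensorProduct.induction_on with
  | zero => simp
  | add x y hx hy => simp only [map_add, LinearMap.add_apply, hx, hy, neg_add]
  | tmul x a =>
    induction v using TensorProduct.induction_on with
    | zero => simp
    | add x y hx hy => simp only [map_add, LinearMap.add_apply, hx, hy, neg_add]
    | tmul y b =>
      rw [bracketSl_tmul, bracketSl_tmul, ← lie_skew, TensorProduct.neg_tmul, mul_comm]

theorem bracketB_swap (u v : Sl2 K ⊗[K] J) : bracketB K J u v = -bracketB K J v u := by
  induction u using TensorProduct.induction_on with
  | zero => simp
  | add x y hx hy => simp only [map_add, LinearMap.add_apply, hx, hy, neg_add]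
  | tmul x a =>
    induction v using TensorProduct.induction_on with
    | zero => simp
    | add x y hx hy => simp only [map_add, LinearMap.add_apply, hx, hy, neg_add]
    | tmul y b =>
      rw [bracketB_tmul, bracketB_tmul, tagWedge_swap, sl2Form_symm, smul_neg]

variable [IsCommJordan J] [CharZero K]

theorem actSl_bracketSl (w : TagB K J) (u v : Sl2 K ⊗[K] J) :
    actSl K J w (bracketSl K J u v) =
      bracketSl K J (actSl K J w u) v + bracketSl K J u (actSl K J w v) := by
  induction u using TensorProduct.induction_on with
  | zero => simp
  | add x y hx hy => simp only [map_add, LinearMap.add_apply, hx, hy]; abel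
  | tmul x a =>
    induction v using TensorProduct.induction_on with
    | zero => simp
    | add x y hx hy => simp only [map_add, hx, hy]; abel
    | tmul y b =>
      simp only [bracketSl_tmul, actSl_tmul, tagPartial_mul, TensorProduct.tmul_add]

theorem tagAction_bracketB (w : TagB K J) (u v : Sl2 K ⊗[K] J) :
    tagAction K J w (bracketB K J u v) =
      bracketB K J (actSl K J w u) v + bracketB K J u (actSl K J w v) := by
  induction u using TensorProduct.induction_on with
  | zero => simp
  | add x y hx hy => simp only [map_add, LinearMap.add_apply, hx, hy]; abel
  | tmul x a =>
    induction v using TensorProduct.induction_on with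
    | zero => simp
    | add x y hx hy => simp only [map_add, hx, hy]; abel
    | tmul y b =>
      simp only [bracketB_tmul, actSl_tmul, map_smul, tagAction_wedge, smul_add]

theorem actSl_tagAction (w w' : TagB K J) (u : Sl2 K ⊗[K] J) :
    actSl K J (tagAction K J w w') u =
      actSl K J w (actSl K J w' u) - actSl K J w' (actSl K J w u) := by
  induction u using TensorProduct.induction_on with
  | zero => simp
  | add x y hx hy => simp only [map_add, hx, hy]; abel
  | tmul x a =>
    simp only [actSl_tmul, tagPartial_action, LinearMap.sub_apply, Module.End.mul_apply,
      TensorProduct.tmul_sub]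

theorem bracketB_jacobi (u v t : Sl2 K ⊗[K] J) :
    bracketB K J u (bracketSl K J v t) =
      bracketB K J (bracketSl K J u v) t + bracketB K J v (bracketSl K J u t) := by
  induction u using TensorProduct.induction_on with
  | zero => simp
  | add x y hx hy => simp only [map_add, LinearMap.add_apply, hx, hy]; abel
  | tmul x a =>
    induction v using TensorProduct.induction_on with
    | zero => simp
    | add x y hx hy => simp only [map_add, LinearMap.add_apply, hx, hy]; abel
    | tmul y b =>
      induction t using TensorProduct.induction_on with
      | zero => simp
      | add x y hx hy => simp only [map_add, hx, hy]; abel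
      | tmul z c =>
        simp only [bracketB_tmul, bracketSl_tmul]
        have h1 : sl2Form K y ⁅x, z⁆ = -sl2Form K ⁅x, y⁆ z := by
          rw [sl2Form_lie, ← lie_skew, map_neg, LinearMap.neg_apply]
        have h := tagWedge_cyclic K a b c
        rw [tagWedge_swap K (b * c), tagWedge_swap K (c * a), mul_comm c a] at h
        rw [sl2Form_lie, h1]
        linear_combination (norm := module) (-sl2Form K ⁅x, y⁆ z) • h

theorem bracketSl_jacobi (u v t : Sl2 K ⊗[K] J) :
    bracketSl K J u (bracketSl K J v t) - actSl K J (bracketB K J v t) u =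
      bracketSl K J (bracketSl K J u v) t + actSl K J (bracketB K J u v) t +
        (bracketSl K J v (bracketSl K J u t) - actSl K J (bracketB K J u t) v) := by
  induction u using TensorProduct.induction_on with
  | zero => simp
  | add x y hx hy =>
    simp only [map_add, LinearMap.add_apply]
    linear_combination (norm := module) hx + hy
  | tmul x a =>
    induction v using TensorProduct.induction_on with
    | zero => simp
    | add x y hx hy =>
      simp only [map_add, LinearMap.add_apply]
      linear_combination (norm := module) hx + hy
    | tmul y b =>
      induction t using TensorProduct.induction_on with
      | zero => simp
      | add x y hx hy =>
        simp only [map_add, LinearMap.add_apply]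
        linear_combination (norm := module) hx + hy
      | tmul z c =>
        have h : ⁅⁅x, y⁆, z⁆ = sl2Form K y z • x - sl2Form K x z • y := by
          rw [← lie_skew, sl2_lie_lie, sl2Form_symm K z x, sl2Form_symm K z y, neg_sub]
        simp only [bracketB_tmul, bracketSl_tmul, map_smul, LinearMap.smul_apply, actSl_tmul,
          tagPartial_wedge, jordanPartial_apply, sl2_lie_lie, h, TensorProduct.sub_tmul,
          ← TensorProduct.smul_tmul', TensorProduct.tmul_sub, sl2Form_symm K y x, mul_comm]
        module

/-- The bracket of the Lie algebra `TAG(J) = sl₂ J`: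
`[x(a), y(b)] = [x, y](a b) + κ(x, y) {a ∧ b}`, `[ω, x(a)] = x(∂_ω a)`, `[ω, ω'] = ∂_ω ω'`. -/
instance : Bracket (TAG K J) (TAG K J) where
  bracket X Y := (tagAction K J X.1 Y.1 + bracketB K J X.2 Y.2,
    bracketSl K J X.2 Y.2 + actSl K J X.1 Y.2 - actSl K J Y.1 X.2)

theorem fst_add (X Y : TAG K J) : (X + Y).1 = X.1 + Y.1 := rfl
theorem snd_add (X Y : TAG K J) : (X + Y).2 = X.2 + Y.2 := rfl
theorem fst_sub (X Y : TAG K J) : (X - Y).1 = X.1 - Y.1 := rfl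
theorem snd_sub (X Y : TAG K J) : (X - Y).2 = X.2 - Y.2 := rfl
theorem fst_smul (c : K) (X : TAG K J) : (c • X).1 = c • X.1 := rfl
theorem snd_smul (c : K) (X : TAG K J) : (c • X).2 = c • X.2 := rfl

theorem ext {X Y : TAG K J} (h1 : X.1 = Y.1) (h2 : X.2 = Y.2) : X = Y := Prod.ext h1 h2

theorem lie_fst (X Y : TAG K J) :
    ⁅X, Y⁆.1 = tagAction K J X.1 Y.1 + bracketB K J X.2 Y.2 := rfl

theorem lie_snd (X Y : TAG K J) :
    ⁅X, Y⁆.2 = bracketSl K J X.2 Y.2 + actSl K J X.1 Y.2 - actSl K J Y.1 X.2 := rfl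

instance : LieRing (TAG K J) where
  add_lie X Y Z := by
    refine ext ?_ ?_
    · simp only [lie_fst, fst_add, snd_add, map_add, LinearMap.add_apply]; abel
    · simp only [lie_snd, fst_add, snd_add, map_add, LinearMap.add_apply]; abel
  lie_add X Y Z := by
    refine ext ?_ ?_
    · simp only [lie_fst, fst_add, snd_add, map_add]; abel
    · simp only [lie_snd, fst_add, snd_add, map_add, LinearMap.add_apply]; abel
  lie_self X := by
    have h1 : tagAction K J X.1 X.1 = 0 := eq_zero_of_eq_neg K (tagAction_swap K X.1 X.1)
    have h2 : bracketB K J X.2 X.2 = 0 := eq_zero_of_eq_neg K (bracketB_swap X.2 X.2)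
    have h3 : bracketSl K J X.2 X.2 = 0 := eq_zero_of_eq_neg K (bracketSl_swap X.2 X.2)
    refine ext ?_ ?_
    · rw [lie_fst, h1, h2, add_zero]; rfl
    · rw [lie_snd, h3, zero_add, sub_self]; rfl
  leibniz_lie X Y Z := by
    have j1 := bracketSl_jacobi X.2 Y.2 Z.2
    have j2 := bracketB_jacobi X.2 Y.2 Z.2
    have s2 := bracketB_swap (actSl K J Z.1 X.2) Y.2
    have s3 := bracketSl_swap (actSl K J Z.1 X.2) Y.2
    have s4 := tagAction_swap K (bracketB K J X.2 Y.2) Z.1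
    refine ext ?_ ?_
    · simp only [lie_fst, lie_snd, fst_add, map_add, map_sub, LinearMap.add_apply,
        LinearMap.sub_apply, tagAction_bracketB, tagAction_action, s4]
      linear_combination (norm := module) j2 + s2
    · simp only [lie_fst, lie_snd, snd_add, map_add, map_sub, LinearMap.add_apply,
        LinearMap.sub_apply, actSl_bracketSl, actSl_tagAction]
      linear_combination (norm := module) j1 + s3

instance : LieAlgebra K (TAG K J) where
  lie_smul c X Y := by
    refine ext ?_ ?_
    · simp only [lie_fst, fst_smul, snd_smul, map_smul, smul_add]
    · simp only [lie_snd, fst_smul, snd_smul, map_smul, LinearMap.smul_apply, smul_add, smul_sub]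

/-- The linear map `(ω, y ⊗ a) ↦ (0, [x, y] ⊗ a)`. -/
def sl2Endo (x : Sl2 K) : TAG K J →ₗ[K] TAG K J :=
  LinearMap.prodMap (0 : TagB K J →ₗ[K] TagB K J)
    ((LieAlgebra.ad K (Sl2 K) x : Sl2 K →ₗ[K] Sl2 K).rTensor J)

theorem sl2Endo_fst (x : Sl2 K) (X : TAG K J) : (sl2Endo x X).1 = 0 := rfl

theorem sl2Endo_snd (x : Sl2 K) (X : TAG K J) :
    (sl2Endo x X).2 = (LieAlgebra.ad K (Sl2 K) x : Sl2 K →ₗ[K] Sl2 K).rTensor J X.2 := rfl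

theorem bracketSl_ad (x : Sl2 K) (u v : Sl2 K ⊗[K] J) :
    (LieAlgebra.ad K (Sl2 K) x : Sl2 K →ₗ[K] Sl2 K).rTensor J (bracketSl K J u v) =
      bracketSl K J ((LieAlgebra.ad K (Sl2 K) x : Sl2 K →ₗ[K] Sl2 K).rTensor J u) v +
        bracketSl K J u ((LieAlgebra.ad K (Sl2 K) x : Sl2 K →ₗ[K] Sl2 K).rTensor J v) := by
  induction u using TensorProduct.induction_on with
  | zero => simp
  | add y z hy hz => simp only [map_add, LinearMap.add_apply, hy, hz]; abel
  | tmul y a =>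
    induction v using TensorProduct.induction_on with
    | zero => simp
    | add z t hz ht => simp only [map_add, hz, ht]; abel
    | tmul z b =>
      simp only [bracketSl_tmul, LinearMap.rTensor_tmul, LieAlgebra.ad_apply]
      rw [leibniz_lie, TensorProduct.add_tmul]

theorem bracketB_ad (x : Sl2 K) (u v : Sl2 K ⊗[K] J) :
    bracketB K J ((LieAlgebra.ad K (Sl2 K) x : Sl2 K →ₗ[K] Sl2 K).rTensor J u) v +
      bracketB K J u ((LieAlgebra.ad K (Sl2 K) x : Sl2 K →ₗ[K] Sl2 K).rTensor J v) = 0 := by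
  induction u using TensorProduct.induction_on with
  | zero => simp
  | add y z hy hz =>
    simp only [map_add, LinearMap.add_apply]
    linear_combination (norm := module) hy + hz
  | tmul y a =>
    induction v using TensorProduct.induction_on with
    | zero => simp
    | add z t hz ht =>
      simp only [map_add]
      linear_combination (norm := module) hz + ht
    | tmul z b =>
      simp only [bracketB_tmul, LinearMap.rTensor_tmul, LieAlgebra.ad_apply]
      rw [sl2Form_lie, ← lie_skew x y, map_neg, LinearMap.neg_apply, neg_smul, neg_add_cancel]

theorem actSl_ad (x : Sl2 K) (w : TagB K J) (u : Sl2 K ⊗[K] J) :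
    (LieAlgebra.ad K (Sl2 K) x : Sl2 K →ₗ[K] Sl2 K).rTensor J (actSl K J w u) =
      actSl K J w ((LieAlgebra.ad K (Sl2 K) x : Sl2 K →ₗ[K] Sl2 K).rTensor J u) := by
  induction u using TensorProduct.induction_on with
  | zero => simp
  | add y z hy hz => simp only [map_add, hy, hz]
  | tmul y a => rfl

/-- `sl2Endo x` is a derivation. -/
def sl2Der (x : Sl2 K) : LieDerivation K (TAG K J) (TAG K J) where
  toLinearMap := sl2Endo x
  leibniz' X Y := by
    rw [← lie_skew Y, sub_neg_eq_add]
    refine ext ?_ ?_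
    · simp only [fst_add, lie_fst, sl2Endo_fst, sl2Endo_snd, map_zero, LinearMap.zero_apply,
        zero_add]
      rw [add_comm, bracketB_ad]
    · simp only [snd_add, lie_snd, sl2Endo_fst, sl2Endo_snd, map_zero, LinearMap.zero_apply,
        map_add, map_sub, bracketSl_ad, actSl_ad]
      module

theorem sl2Der_apply (x : Sl2 K) (X : TAG K J) : sl2Der x X = sl2Endo x X := rfl

variable (K J) in
/-- The action of `sl₂` on `TAG(J)` by derivations: trivial on `ℬJ` and `x ↦ ad x ⊗ 1` on
`sl₂ ⊗ J`. -/
def sl2Action : Sl2 K →ₗ⁅K⁆ LieDerivation K (TAG K J) (TAG K J) where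
  toFun := sl2Der
  map_add' x y := by
    refine LieDerivation.ext fun X => TAG.ext ?_ ?_
    · rw [LieDerivation.add_apply, fst_add]
      simp only [sl2Der_apply, sl2Endo_fst, add_zero]
    · rw [LieDerivation.add_apply, snd_add]
      simp only [sl2Der_apply, sl2Endo_snd, map_add, LinearMap.rTensor_add, LinearMap.add_apply]
  map_smul' c x := by
    refine LieDerivation.ext fun X => TAG.ext ?_ ?_
    · rw [LieDerivation.smul_apply, fst_smul]
      simp only [sl2Der_apply, sl2Endo_fst, smul_zero]
    · rw [LieDerivation.smul_apply, snd_smul]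
      simp only [sl2Der_apply, sl2Endo_snd, map_smul, LinearMap.rTensor_smul,
        LinearMap.smul_apply, RingHom.id_apply]
  map_lie' {x y} := by
    refine LieDerivation.ext fun X => TAG.ext ?_ ?_
    · rw [LieDerivation.commutator_apply, fst_sub]
      simp only [sl2Der_apply, sl2Endo_fst, sub_zero]
    · rw [LieDerivation.commutator_apply, snd_sub]
      simp only [sl2Der_apply, sl2Endo_snd]
      have h : (LieAlgebra.ad K (Sl2 K) ⁅x, y⁆ : Sl2 K →ₗ[K] Sl2 K) =
          (LieAlgebra.ad K (Sl2 K) x : Sl2 K →ₗ[K] Sl2 K) ∘ₗ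
              (LieAlgebra.ad K (Sl2 K) y : Sl2 K →ₗ[K] Sl2 K) -
            (LieAlgebra.ad K (Sl2 K) y : Sl2 K →ₗ[K] Sl2 K) ∘ₗ
              (LieAlgebra.ad K (Sl2 K) x : Sl2 K →ₗ[K] Sl2 K) :=
        LinearMap.ext fun z => lie_lie x y z
      rw [h, LinearMap.rTensor_sub, LinearMap.sub_apply, LinearMap.rTensor_comp,
        LinearMap.rTensor_comp, LinearMap.comp_apply, LinearMap.comp_apply]

end TAG

end TAG

section Representations

variable (K : Type*) [Field K]

section General

variable {K} {D : ℕ} {V : Type*} [AddCommGroup V] [Module K V]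
  (ρ : Representation K (Matrix.GeneralLinearGroup (Fin D) K) V)

/-- The diagonal matrix with diagonal entries `t`, as an element of `GL(D)`. -/
def diagGL (t : Fin D → Kˣ) : Matrix.GeneralLinearGroup (Fin D) K where
  val := Matrix.diagonal fun i => (t i : K)
  inv := Matrix.diagonal fun i => ((t i)⁻¹ : Kˣ)
  val_inv := by simp
  inv_val := by simp

/-- The weight space `V_m`: the vectors on which every diagonal matrix with diagonal entries
`t₁, …, t_D` acts by `t₁ ^ m₁ ⋯ t_D ^ m_D`. -/
def weightSpace (m : Fin D →₀ ℕ) : Submodule K V :=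
  ⨅ t : Fin D → Kˣ, LinearMap.ker (ρ (diagGL t) - (∏ i, (t i : K) ^ m i) • LinearMap.id)

/-- The vectors of degree `n`: those on which every scalar matrix `z` acts by `z ^ n`. -/
def degreeSpace (n : ℕ) : Submodule K V :=
  ⨅ z : Kˣ, LinearMap.ker (ρ (diagGL fun _ => z) - ((z : K) ^ n) • LinearMap.id)

/-- `V` is an analytic `GL(D)`-module: it is the direct sum of its components `V_n` of degree
`n ≥ 0`, and each `V_n` is a finite-dimensional polynomial representation of degree `n` (its matrix
coefficients are homogeneous polynomials of degree `n` in the entries of `g`). -/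
def IsAnalytic : Prop :=
  DirectSum.IsInternal (degreeSpace ρ) ∧
    ∀ n, FiniteDimensional K (degreeSpace ρ n) ∧
      ∀ v ∈ degreeSpace ρ n, ∀ f : Module.Dual K V,
        ∃ P : MvPolynomial (Fin D × Fin D) K, P.IsHomogeneous n ∧
          ∀ g : Matrix.GeneralLinearGroup (Fin D) K,
            f (ρ g v) = MvPolynomial.eval (fun p => g.1 p.1 p.2) P

/-- The class `[V] = ∑_m dim V_m z^m` of an analytic `GL(D)`-module. -/
def repClass : MvPowerSeries (Fin D) ℤ := fun m => (Module.finrank K (weightSpace ρ m) : ℤ)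

end General

variable (D : ℕ)

/-- The substitution `x_j ↦ ∑ᵢ g_{ij} xᵢ` in the free Jordan algebra `J(D)`. -/
def jordanSubst (g : Matrix (Fin D) (Fin D) K) :
    FreeJordan K (Fin D) →ₙₐ[K] FreeJordan K (Fin D) :=
  FreeJordan.lift fun j => ∑ i, g i j • FreeJordan.of i

theorem jordanSubst_one : jordanSubst K D 1 = NonUnitalAlgHom.id K (FreeJordan K (Fin D)) := by
  refine FreeJordan.hom_ext fun j => ?_
  rw [jordanSubst, FreeJordan.lift_of]
  simp [Matrix.one_apply]

theorem jordanSubst_mul (g h : Matrix (Fin D) (Fin D) K) :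
    jordanSubst K D (g * h) = (jordanSubst K D g).comp (jordanSubst K D h) := by
  refine FreeJordan.hom_ext fun j => ?_
  simp only [jordanSubst, FreeJordan.lift_of, NonUnitalAlgHom.comp_apply, map_sum, map_smul,
    Matrix.mul_apply, Finset.sum_smul, Finset.smul_sum]
  rw [Finset.sum_comm]
  simp only [smul_smul, mul_comm]

/-- The natural representation of `GL(D)` on the free Jordan algebra `J(D)`. -/
def jordanRep : Representation K (Matrix.GeneralLinearGroup (Fin D) K) (FreeJordan K (Fin D)) where
  toFun g := (jordanSubst K D g.1 : FreeJordan K (Fin D) →ₗ[K] FreeJordan K (Fin D))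
  map_one' := by
    refine LinearMap.ext fun a => ?_
    exact DFunLike.congr_fun (jordanSubst_one K D) a
  map_mul' g h := by
    refine LinearMap.ext fun a => ?_
    exact DFunLike.congr_fun (jordanSubst_mul K D g.1 h.1) a

theorem jordanRep_mul (g : Matrix.GeneralLinearGroup (Fin D) K) (a b : FreeJordan K (Fin D)) :
    jordanRep K D g (a * b) = jordanRep K D g a * jordanRep K D g b :=
  map_mul (jordanSubst K D g.1) a b

/-- The natural representation of `GL(D)` on `Inner J(D)`, by conjugation. -/
def innerRep : Representation K (Matrix.GeneralLinearGroup (Fin D) K)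
    (innerDer K (FreeJordan K (Fin D))) :=
  Representation.subrepresentation (Representation.linHom (jordanRep K D) (jordanRep K D))
    (innerDer K (FreeJordan K (Fin D))) (fun g => by
      refine Submodule.span_le.2 ?_
      rintro _ ⟨x, y, rfl⟩
      refine Submodule.subset_span ⟨jordanRep K D g x, jordanRep K D g y, ?_⟩
      refine LinearMap.ext fun z => ?_
      have h : jordanRep K D g (jordanRep K D g⁻¹ z) = z := by
        rw [← Module.End.mul_apply, ← map_mul, mul_inv_cancel, map_one, Module.End.one_apply]
      simp only [Representation.linHom_apply, LinearMap.comp_apply, jordanPartial_apply, map_sub,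
        jordanRep_mul, h])

end Representations

section LambdaRing

open scoped LaurentPolynomial

variable (D : ℕ)

/-- The ring `R_an(GL(D))`, identified through characters with the ring `ℤ[[z₁, …, z_D]]^{S_D}` of
symmetric power series. -/
def RAn : Subring (MvPowerSeries (Fin D) ℤ) where
  carrier := {f | ∀ σ : Equiv.Perm (Fin D), MvPowerSeries.renameEquiv ℤ σ f = f}
  mul_mem' hf hg σ := by rw [map_mul, hf σ, hg σ]
  one_mem' σ := map_one _
  add_mem' hf hg σ := by rw [map_add, hf σ, hg σ]
  zero_mem' σ := map_zero _
  neg_mem' hf σ := by rw [map_neg, hf σ]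

variable {D}

/-- The class of `L(2k)` in `K₀(PSL(2)) = ℤ[t, t⁻¹]^{S₂}`, namely `∑_{i = -k}^k t ^ i`, where `t` is
the exponential of the root. -/
def pslClass (k : ℕ) : ℤ[T;T⁻¹] := ∑ i ∈ Finset.Icc (-(k : ℤ)) k, LaurentPolynomial.T i

/-- The multiplicity `[a : L(2k)]` of `a ∈ R_an(GL(D) × PSL(2))`, the latter being identified
through characters with a subring of `ℤ[t, t⁻¹][[z₁, …, z_D]]`: it is the coefficient of `t ^ k`
minus the coefficient of `t ^ (k + 1)`. -/
def pslMult (a : MvPowerSeries (Fin D) ℤ[T;T⁻¹]) (k : ℕ) : MvPowerSeries (Fin D) ℤ :=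
  fun m => (MvPowerSeries.coeff m a).coeff (k : ℤ) - (MvPowerSeries.coeff m a).coeff ((k : ℤ) + 1)

/-- The weight lines of degree `≤ n` of a graded module `V` whose weight `z^m t^j` has multiplicity
the positive part of the coefficient of `z^m t^j` in `a`; the `i`-th line of weight `z^m t^j` is
labelled `(m, j, i)`. Only weights with `m ≠ 0` are taken. -/
def weightLines (a : MvPowerSeries (Fin D) ℤ[T;T⁻¹]) (n : Fin D →₀ ℕ) :
    Finset (Σ _ : Fin D →₀ ℕ, Σ _ : ℤ, ℕ) :=
  ((Finset.Iic n).erase 0).sigma fun m => (MvPowerSeries.coeff m a).coeff.support.sigma fun j =>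
    Finset.range ((MvPowerSeries.coeff m a).coeff j).toNat

/-- `∑_k (-1)^k [Λ^k V]`, where `V` is the graded module whose class is the positive part of `a`:
a set `S` of `k` weight lines of `V` spans a line of `Λ^k V`, whose weight is the product of the
weights. Lines of `V` of degree not `≤ n` do not contribute to the coefficient of `z^n`. -/
def lambdaEffective (a : MvPowerSeries (Fin D) ℤ[T;T⁻¹]) : MvPowerSeries (Fin D) ℤ[T;T⁻¹] :=
  fun n => MvPowerSeries.coeff n (∑ S ∈ (weightLines a n).powerset,
    (-1) ^ S.card * ∏ l ∈ S, MvPowerSeries.monomial l.1 (LaurentPolynomial.T l.2.1))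

/-- The operation `λ`: writing `a = a' - a''` with `a'` and `a''` the positive and the negative
part of `a`, one has `λ a = λ a' * (λ a'')⁻¹`. -/
def lambdaOp (a : MvPowerSeries (Fin D) ℤ[T;T⁻¹]) : MvPowerSeries (Fin D) ℤ[T;T⁻¹] :=
  lambdaEffective a * MvPowerSeries.invOfUnit (lambdaEffective (-a)) 1

/-- The inclusion `R_an(GL(D)) ⊆ R_an(GL(D) × PSL(2))`. -/
def toPsl (a : MvPowerSeries (Fin D) ℤ) : MvPowerSeries (Fin D) ℤ[T;T⁻¹] :=
  MvPowerSeries.map LaurentPolynomial.C a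

/-- `A` and `B` are elements of `R_an(GL(D))` without term of degree `0` such that
`λ(A [L(2)] + B) : [L(0)] = 1` and `λ(A [L(2)] + B) : [L(2)] = -[K^D]`, where
`[K^D] = z₁ + ⋯ + z_D`. -/
structure IsLambdaSolution (A B : MvPowerSeries (Fin D) ℤ) : Prop where
  memA : A ∈ RAn D
  memB : B ∈ RAn D
  zeroA : MvPowerSeries.constantCoeff A = 0
  zeroB : MvPowerSeries.constantCoeff B = 0
  trivial_mult :
    pslMult (lambdaOp (toPsl A * MvPowerSeries.C (pslClass 1) + toPsl B)) 0 = 1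
  adjoint_mult :
    pslMult (lambdaOp (toPsl A * MvPowerSeries.C (pslClass 1) + toPsl B)) 1 =
      -∑ i : Fin D, MvPowerSeries.X i

end LambdaRing

end

end FreeJordanChar

open scoped TensorProduct

set_option linter.unusedSectionVars false

namespace FreeJordanChar

noncomputable section

section ExteriorGeneralities

variable {K : Type*} [Field K] {g g' : Type*} [LieRing g] [LieAlgebra K g]
  [LieRing g'] [LieAlgebra K g']

theorem ceDifferential_exteriorDerivation_ad (x : g) (w : ExteriorAlgebra K g) :
    ceDifferential K g (exteriorDerivation (LieAlgebra.ad K g x : g →ₗ[K] g) w) =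
      exteriorDerivation (LieAlgebra.ad K g x : g →ₗ[K] g) (ceDifferential K g w) := by
  have h := ceDifferential_comm (LieDerivation.ad K g x) w
  have e : ((LieDerivation.ad K g x : LieDerivation K g g) : g →ₗ[K] g) =
      (LieAlgebra.ad K g x : g →ₗ[K] g) := by
    ext y; simp
  rwa [e] at h

theorem ceDifferential_ceDifferential (w : ExteriorAlgebra K g) :
    ceDifferential K g (ceDifferential K g w) = 0 := by
  induction w using exteriorAlgebra_induction with
  | h0 r => rw [ceDifferential_algebraMap, map_zero]
  | hadd x y hx hy => rw [map_add, map_add, hx, hy, add_zero]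
  | hι w y hw =>
    rw [ceDifferential_ι_mul, map_sub, ceDifferential_ι_mul, hw,
      ceDifferential_exteriorDerivation_ad, mul_zero, sub_zero, sub_self]

theorem map_exteriorDerivation {φ : g →ₗ[K] g} {ψ : g' →ₗ[K] g'} (f : g →ₗ[K] g')
    (h : ∀ x, f (φ x) = ψ (f x)) (w : ExteriorAlgebra K g) :
    ExteriorAlgebra.map f (exteriorDerivation φ w) =
      exteriorDerivation ψ (ExteriorAlgebra.map f w) := by
  induction w using exteriorAlgebra_induction with
  | h0 r => simp [exteriorDerivation_algebraMap]
  | hadd x y hx hy => simp only [map_add, hx, hy]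
  | hι w y hw =>
    simp only [exteriorDerivation_ι_mul, map_add, map_mul, ExteriorAlgebra.map_apply_ι, h, hw]

theorem map_ceDifferential (f : g →ₗ⁅K⁆ g') (w : ExteriorAlgebra K g) :
    ExteriorAlgebra.map (f : g →ₗ[K] g') (ceDifferential K g w) =
      ceDifferential K g' (ExteriorAlgebra.map (f : g →ₗ[K] g') w) := by
  induction w using exteriorAlgebra_induction with
  | h0 r => simp [ceDifferential_algebraMap]
  | hadd x y hx hy => simp only [map_add, hx, hy]
  | hι w y hw =>
    simp only [ceDifferential_ι_mul, map_sub, map_mul, ExteriorAlgebra.map_apply_ι, hw]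
    rw [map_exteriorDerivation (ψ := (LieAlgebra.ad K g' (f y) : g' →ₗ[K] g'))
      (f : g →ₗ[K] g') (fun x => by simp)]
    rfl

theorem exteriorDerivation_commutator (φ ψ : g →ₗ[K] g) (w : ExteriorAlgebra K g) :
    exteriorDerivation (φ ∘ₗ ψ - ψ ∘ₗ φ) w =
      exteriorDerivation φ (exteriorDerivation ψ w) -
        exteriorDerivation ψ (exteriorDerivation φ w) := by
  induction w using exteriorAlgebra_induction with
  | h0 r => simp [exteriorDerivation_algebraMap]
  | hadd x y hx hy => simp only [map_add, hx, hy]; abel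
  | hι w y hw =>
    simp only [exteriorDerivation_ι_mul, map_add, hw, LinearMap.sub_apply, LinearMap.comp_apply,
      map_sub, sub_mul, mul_sub]
    abel

theorem ceDifferential_mem (k : ℕ) {w : ExteriorAlgebra K g} (hw : w ∈ ⋀[K]^(k + 1) g) :
    ceDifferential K g w ∈ ⋀[K]^k g := by
  induction k generalizing w with
  | zero =>
    change w ∈ LinearMap.range (ExteriorAlgebra.ι K) ^ 1 at hw
    rw [pow_one] at hw
    obtain ⟨y, rfl⟩ := hw
    have h := ceDifferential_ι_mul (K := K) y (algebraMap K _ 1)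
    rw [ceDifferential_algebraMap, exteriorDerivation_algebraMap, map_one, mul_one, mul_zero,
      sub_zero] at h
    rw [h]
    exact zero_mem _
  | succ k ih =>
    change w ∈ LinearMap.range (ExteriorAlgebra.ι K) ^ (k + 1 + 1) at hw
    change _ ∈ LinearMap.range (ExteriorAlgebra.ι K) ^ (k + 1)
    rw [pow_succ'] at hw
    induction hw using Submodule.mul_induction_on' with
    | mem_mul_mem a ha b hb =>
      obtain ⟨y, rfl⟩ := ha
      rw [ceDifferential_ι_mul]
      refine sub_mem (exteriorDerivation_mem _ (k + 1) hb) ?_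
      rw [pow_succ']
      exact Submodule.mul_mem_mul ⟨_, rfl⟩ (ih hb)
    | add a _ b _ ha hb => rw [map_add]; exact add_mem ha hb

theorem ceDifferential_mem_zero {w : ExteriorAlgebra K g} (hw : w ∈ ⋀[K]^0 g) :
    ceDifferential K g w = 0 := by
  change w ∈ LinearMap.range (ExteriorAlgebra.ι K) ^ 0 at hw
  rw [pow_zero, Submodule.mem_one] at hw
  obtain ⟨r, rfl⟩ := hw
  exact ceDifferential_algebraMap r

variable (K g) in
/-- The parity operator of the exterior algebra. -/
def exteriorParity : ExteriorAlgebra K g →ₗ[K] ExteriorAlgebra K g :=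
  (ExteriorAlgebra.map (-LinearMap.id : g →ₗ[K] g)).toLinearMap

theorem exteriorParity_ι_mul (y : g) (w : ExteriorAlgebra K g) :
    exteriorParity K g (ExteriorAlgebra.ι K y * w) =
      -(ExteriorAlgebra.ι K y * exteriorParity K g w) := by
  simp [exteriorParity]

theorem exteriorParity_algebraMap (r : K) :
    exteriorParity K g (algebraMap K _ r) = algebraMap K _ r := by
  simp [exteriorParity]

theorem exteriorParity_exteriorDerivation (φ : g →ₗ[K] g) (w : ExteriorAlgebra K g) :
    exteriorParity K g (exteriorDerivation φ w) =
      exteriorDerivation φ (exteriorParity K g w) :=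
  map_exteriorDerivation _ (fun x => by simp) w

theorem exteriorParity_ceDifferential (w : ExteriorAlgebra K g) :
    exteriorParity K g (ceDifferential K g w) =
      -ceDifferential K g (exteriorParity K g w) := by
  induction w using exteriorAlgebra_induction with
  | h0 r => simp [ceDifferential_algebraMap, exteriorParity_algebraMap]
  | hadd x y hx hy => simp only [map_add, hx, hy]; abel
  | hι w y hw =>
    simp only [ceDifferential_ι_mul, map_sub, exteriorParity_ι_mul, map_neg, hw,
      exteriorParity_exteriorDerivation]
    noncomm_ring

theorem exteriorDerivation_ιMulti (φ : g →ₗ[K] g) {n : ℕ} (v : Fin n → g) (c : Fin n → K)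
    (h : ∀ i, φ (v i) = c i • v i) :
    exteriorDerivation φ (ExteriorAlgebra.ιMulti K n v) =
      (∑ i, c i) • ExteriorAlgebra.ιMulti K n v := by
  induction n with
  | zero =>
    rw [ExteriorAlgebra.ιMulti_zero_apply, ← map_one (algebraMap K _),
      exteriorDerivation_algebraMap]
    simp
  | succ n ih =>
    rw [ExteriorAlgebra.ιMulti_succ_apply, exteriorDerivation_ι_mul,
      ih (Matrix.vecTail v) (Matrix.vecTail c) (fun i => h _), h 0, Fin.sum_univ_succ]
    simp [add_smul, Matrix.vecTail]

theorem map_ιMulti_smul (φ : g →ₗ[K] g) {n : ℕ} (v : Fin n → g) (c : Fin n → K)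
    (h : ∀ i, φ (v i) = c i • v i) :
    ExteriorAlgebra.map φ (ExteriorAlgebra.ιMulti K n v) =
      (∏ i, c i) • ExteriorAlgebra.ιMulti K n v := by
  rw [ExteriorAlgebra.map_apply_ιMulti]
  have e : φ ∘ v = fun i => c i • v i := funext h
  rw [e]
  exact (ExteriorAlgebra.ιMulti K n).toMultilinearMap.map_smul_univ c v

variable {I : Type*} [LinearOrder I] (b : Module.Basis I K g)

theorem exteriorAlgebra_basis_eq (S : Finset I) :
    b.ExteriorAlgebra S = ExteriorAlgebra.ιMulti K S.card (fun i => b (S.orderEmbOfFin rfl i)) := by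
  rw [ExteriorAlgebra.basis_apply_ofCard b rfl]
  rfl

theorem exteriorDerivation_basis (φ : g →ₗ[K] g) (c : I → K) (h : ∀ i, φ (b i) = c i • b i)
    (S : Finset I) :
    exteriorDerivation φ (b.ExteriorAlgebra S) = (∑ i ∈ S, c i) • b.ExteriorAlgebra S := by
  rw [exteriorAlgebra_basis_eq, exteriorDerivation_ιMulti φ _ (fun i => c (S.orderEmbOfFin rfl i))
    (fun i => h _)]
  congr 1
  rw [← Finset.sum_coe_sort S]
  exact Fintype.sum_equiv (S.orderIsoOfFin rfl).toEquiv _ _ (fun i => rfl)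

theorem map_basis (φ : g →ₗ[K] g) (c : I → K) (h : ∀ i, φ (b i) = c i • b i) (S : Finset I) :
    ExteriorAlgebra.map φ (b.ExteriorAlgebra S) = (∏ i ∈ S, c i) • b.ExteriorAlgebra S := by
  rw [exteriorAlgebra_basis_eq, map_ιMulti_smul φ _ (fun i => c (S.orderEmbOfFin rfl i))
    (fun i => h _)]
  congr 1
  rw [← Finset.prod_coe_sort S]
  exact Fintype.prod_equiv (S.orderIsoOfFin rfl).toEquiv _ _ (fun i => rfl)

theorem exteriorParity_basis (S : Finset I) :
    exteriorParity K g (b.ExteriorAlgebra S) = ((-1 : K) ^ S.card) • b.ExteriorAlgebra S := by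
  have h := map_basis b (-LinearMap.id : g →ₗ[K] g) (fun _ => -1) (fun i => by simp) S
  rwa [Finset.prod_const] at h

end ExteriorGeneralities

section Sl2LinearAlgebra

variable {K : Type*} [Field K] {V : Type*} [AddCommGroup V] [Module K V]

/-- The commutation relations of `sl₂`. -/
structure Sl2Relations (E F H : Module.End K V) : Prop where
  lie_h_e : ∀ v, H (E v) = E (H v) + (2 : K) • E v
  lie_h_f : ∀ v, H (F v) = F (H v) - (2 : K) • F v
  lie_e_f : ∀ v, E (F v) = F (E v) + H v

namespace Sl2Relations

variable {E F H : Module.End K V}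

theorem h_pow_e (r : Sl2Relations E F H) {lam : K} {w : V} (hw : H w = lam • w) (k : ℕ) :
    H ((E ^ k) w) = (lam + 2 * k) • (E ^ k) w := by
  induction k with
  | zero => simp [hw]
  | succ k ih =>
    rw [pow_succ', Module.End.mul_apply, r.lie_h_e, ih, map_smul, Nat.cast_succ]
    module

theorem pow_e_f (r : Sl2Relations E F H) {lam : K} {w : V} (hw : H w = lam • w) (k : ℕ) :
    (E ^ (k + 1)) (F w) = F ((E ^ (k + 1)) w) + ((k + 1) * (lam + k) : K) • (E ^ k) w := by
  induction k with
  | zero => simp [r.lie_e_f, hw]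
  | succ k ih =>
    have h := r.h_pow_e hw (k + 1)
    have e1 : (E ^ (k + 1 + 1)) (F w) = E ((E ^ (k + 1)) (F w)) := by
      rw [pow_succ', Module.End.mul_apply]
    have e2 : (E ^ (k + 1 + 1)) w = E ((E ^ (k + 1)) w) := by
      rw [pow_succ', Module.End.mul_apply]
    have e3 : E ((E ^ k) w) = (E ^ (k + 1)) w := by
      rw [pow_succ', Module.End.mul_apply]
    rw [e1, ih, map_add, r.lie_e_f, h, map_smul, e2, e3]
    push_cast
    module

theorem h_pow_f (r : Sl2Relations E F H) {w : V} (hw : H w = 0) (k : ℕ) :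
    H ((F ^ k) w) = (-(2 * k) : K) • (F ^ k) w := by
  induction k with
  | zero => simp [hw]
  | succ k ih =>
    rw [pow_succ', Module.End.mul_apply, r.lie_h_f, ih, map_smul, Nat.cast_succ]
    module

theorem e_pow_f (r : Sl2Relations E F H) {w : V} (hw : H w = 0) (he : E w = 0) (k : ℕ) :
    E ((F ^ (k + 1)) w) = (-((k + 1) * k) : K) • (F ^ k) w := by
  induction k with
  | zero => simp [r.lie_e_f, hw, he]
  | succ k ih =>
    have h := r.h_pow_f hw (k + 1)
    have e1 : (F ^ (k + 1 + 1)) w = F ((F ^ (k + 1)) w) := by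
      rw [pow_succ', Module.End.mul_apply]
    have e3 : F ((F ^ k) w) = (F ^ (k + 1)) w := by
      rw [pow_succ', Module.End.mul_apply]
    rw [e1, r.lie_e_f, ih, map_smul, h, e3]
    push_cast
    module

theorem exists_ef_eq (r : Sl2Relations E F H) {lam : K}
    (hlam : ∀ k : ℕ, ((k + 1) * (lam + k) : K) ≠ 0) {S : Submodule K V}
    (hH : ∀ w ∈ S, H w = lam • w) (hS : ∀ w ∈ S, E (F w) ∈ S) (k : ℕ) :
    ∀ w ∈ S, (E ^ k) w = 0 → ∃ u ∈ S, E (F u) = w := by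
  induction k with
  | zero =>
    intro w _ h0
    exact ⟨0, zero_mem _, by simpa using h0.symm⟩
  | succ k ih =>
    intro w hw h0
    have h1 := r.pow_e_f (hH w hw) k
    rw [h0, map_zero, zero_add] at h1
    obtain ⟨u, hu, hu2⟩ := ih (E (F w) - ((k + 1) * (lam + k) : K) • w)
      (sub_mem (hS w hw) (S.smul_mem _ hw)) (by
        rw [map_sub, map_smul, ← Module.End.mul_apply, ← pow_succ, h1, sub_self])
    refine ⟨((k + 1) * (lam + k) : K)⁻¹ • (w - u), S.smul_mem _ (sub_mem hw hu), ?_⟩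
    rw [map_smul, map_smul, map_sub, map_sub, hu2, sub_sub_cancel, inv_smul_smul₀ (hlam k)]

theorem eq_zero_of_ef_eq_zero (r : Sl2Relations E F H) {lam : K}
    (hlam : ∀ k : ℕ, ((k + 1) * (lam + k) : K) ≠ 0)
    {w : V} (hw : H w = lam • w) (hef : E (F w) = 0) (k : ℕ) (hk : (E ^ k) w = 0) : w = 0 := by
  induction k with
  | zero => simpa using hk
  | succ k ih =>
    have h1 := r.pow_e_f hw k
    rw [hk, map_zero, zero_add, pow_succ, Module.End.mul_apply, hef, map_zero] at h1
    exact ih ((smul_eq_zero.1 h1.symm).resolve_left (hlam k))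

variable [CharZero K]

theorem f_eq_zero (r : Sl2Relations E F H) {w : V} (hw : H w = 0) (he : E w = 0)
    (k : ℕ) (hk : (F ^ k) w = 0) :
    F w = 0 := by
  have key : ∀ k, (F ^ (k + 1)) w = 0 → F w = 0 := by
    intro k
    induction k with
    | zero => intro h; simpa using h
    | succ k ih =>
      intro h
      refine ih ?_
      have h1 := r.e_pow_f hw he (k + 1)
      rw [h, map_zero] at h1
      refine (smul_eq_zero.1 h1.symm).resolve_left ?_
      rw [neg_eq_zero]
      have : ((k : K) + 1 + 1) ≠ 0 := by exact_mod_cast Nat.succ_ne_zero (k + 1)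
      have h2 : ((k : K) + 1) ≠ 0 := by exact_mod_cast Nat.succ_ne_zero k
      push_cast
      exact mul_ne_zero this h2
  rcases k with _ | k
  · rw [pow_zero, Module.End.one_apply] at hk
    rw [hk, map_zero]
  · exact key k hk

theorem weight_ne_zero {lam : ℕ} (hlam : 1 ≤ lam) (k : ℕ) :
    ((k + 1) * ((lam : K) + k) : K) ≠ 0 := by
  have : ((k + 1) * (lam + k) : ℕ) ≠ 0 := Nat.mul_ne_zero (by omega) (by omega)
  exact_mod_cast this

/-- An invariant vector in the image of an equivariant map `d` lifts to an invariant vector, as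
soon as it lifts to a vector of weight `0`. -/
theorem exists_invariant_lift (r : Sl2Relations E F H) (hE : ∀ v, ∃ k, (E ^ k) v = 0)
    (hF : ∀ v, ∃ k, (F ^ k) v = 0)
    {d : Module.End K V} (hdE : ∀ v, d (E v) = E (d v)) (hdF : ∀ v, d (F v) = F (d v))
    (hdH : ∀ v, d (H v) = H (d v)) {w v : V} (hwE : E w = 0) (hv : d v = w)
    (hvH : H v = 0) : ∃ v', d v' = w ∧ E v' = 0 ∧ F v' = 0 ∧ H v' = 0 := by
  have hl : ∀ k : ℕ, ((k + 1) * ((2 : K) + k) : K) ≠ 0 := fun k => by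
    exact_mod_cast weight_ne_zero (K := K) (lam := 2) (by norm_num) k
  let S : Submodule K V := LinearMap.ker (H - (2 : K) • LinearMap.id)
  have hS : ∀ x, x ∈ S ↔ H x = (2 : K) • x := fun x => by
    rw [LinearMap.mem_ker, LinearMap.sub_apply, sub_eq_zero]; rfl
  obtain ⟨k, hk⟩ := hE (E v)
  obtain ⟨u, hu, hue⟩ := r.exists_ef_eq hl (S := S) (fun x hx => (hS x).1 hx) (fun x hx => by
      rw [hS] at hx ⊢
      rw [r.lie_h_e, r.lie_h_f, hx, map_sub, map_smul, map_smul]; module) k (E v)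
      ((hS _).2 (by rw [r.lie_h_e, hvH, map_zero, zero_add])) hk
  have hu2 := (hS u).1 hu
  have hH0 : H (F u) = 0 := by rw [r.lie_h_f, hu2, map_smul, sub_self]
  have hv' : E (v - F u) = 0 := by rw [map_sub, hue, sub_self]
  have hvH' : H (v - F u) = 0 := by rw [map_sub, hvH, hH0, sub_self]
  obtain ⟨k', hk'⟩ := hF (v - F u)
  have hdu : d u = 0 := by
    obtain ⟨l, hl'⟩ := hE (d u)
    refine r.eq_zero_of_ef_eq_zero hl (lam := 2) (by rw [← hdH, hu2, map_smul]) ?_ l hl'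
    rw [← hdF, ← hdE, hue, hdE, hv, hwE]
  refine ⟨v - F u, ?_, hv', r.f_eq_zero hvH' hv' k' hk', hvH'⟩
  rw [map_sub, hv, hdF, hdu, map_zero, sub_zero]

end Sl2Relations

end Sl2LinearAlgebra

section Supertrace

variable {K : Type*} [Field K] {V : Type*} [AddCommGroup V] [Module K V]

/-- The Euler characteristic of the kernel of a surjection `A₀ ⊕ A₁ → B₀ ⊕ B₁` of super vector
spaces vanishes when this kernel carries an odd differential without homology. -/
theorem finrank_add_finrank_eq {A B : Bool → Submodule K V} [∀ e, FiniteDimensional K (A e)]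
    {E d : Module.End K V} (hE : ∀ e, (A e).map E = B e)
    (hd : ∀ e, ∀ w ∈ A e, E w = 0 → d w ∈ A (!e) ∧ E (d w) = 0)
    (hex : ∀ e, ∀ w ∈ A e, E w = 0 → d w = 0 → ∃ v ∈ A (!e), E v = 0 ∧ d v = w)
    (hdd : ∀ w, d (d w) = 0) :
    Module.finrank K (A false) + Module.finrank K (B true) =
      Module.finrank K (A true) + Module.finrank K (B false) := by
  let C : Bool → Submodule K V := fun e => A e ⊓ LinearMap.ker E
  let Z : Bool → Submodule K V := fun e => C e ⊓ LinearMap.ker d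
  have hCfin : ∀ e, FiniteDimensional K (C e) := fun e =>
    Submodule.finiteDimensional_of_le inf_le_left
  have rn : ∀ (f : Module.End K V) (S : Submodule K V) [FiniteDimensional K S],
      Module.finrank K (S.map f) + Module.finrank K (S ⊓ LinearMap.ker f : Submodule K V) =
        Module.finrank K S := by
    intro f S _
    rw [← LinearMap.finrank_range_add_finrank_ker (f.domRestrict S), LinearMap.range_domRestrict]
    congr 1
    have : (LinearMap.ker (f.domRestrict S)).map S.subtype = S ⊓ LinearMap.ker f := by
      ext x
      simp only [Submodule.mem_map, LinearMap.mem_ker, Submodule.mem_inf]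
      constructor
      · rintro ⟨⟨y, hy⟩, h, rfl⟩
        exact ⟨hy, h⟩
      · rintro ⟨hy, h⟩
        exact ⟨⟨x, hy⟩, h, rfl⟩
    rw [← this]
    exact LinearEquiv.finrank_eq
      (Submodule.equivMapOfInjective S.subtype S.injective_subtype _).symm
  have hZ : ∀ e, (C e).map d = Z (!e) := by
    intro e
    ext w
    constructor
    · rintro ⟨v, ⟨hv, hv'⟩, rfl⟩
      exact ⟨⟨(hd e v hv hv').1, (hd e v hv hv').2⟩, hdd v⟩
    · rintro ⟨⟨hw, hw'⟩, hw''⟩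
      obtain ⟨v, hv, hve, hvd⟩ := hex (!e) w hw hw' hw''
      rw [Bool.not_not] at hv
      exact ⟨v, ⟨hv, hve⟩, hvd⟩
  have h1 := rn E (A false)
  have h2 := rn E (A true)
  have h3 := rn d (C false)
  have h4 := rn d (C true)
  rw [hE] at h1 h2
  rw [hZ] at h3 h4
  change Module.finrank K (Z true) + Module.finrank K (Z false) = Module.finrank K (C false) at h3
  change Module.finrank K (Z false) + Module.finrank K (Z true) = Module.finrank K (C true) at h4
  change _ + Module.finrank K (C _) = _ at h1
  change _ + Module.finrank K (C _) = _ at h2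
  omega

end Supertrace

section Functoriality

variable {K : Type*} [Field K]
  {J : Type*} [NonUnitalNonAssocCommRing J] [Module K J] [IsScalarTower K J J] [SMulCommClass K J J]
  {J' : Type*} [NonUnitalNonAssocCommRing J'] [Module K J'] [IsScalarTower K J' J']
  [SMulCommClass K J' J']
  {J'' : Type*} [NonUnitalNonAssocCommRing J''] [Module K J''] [IsScalarTower K J'' J'']
  [SMulCommClass K J'' J'']

theorem jordanPartial_map (f : J →ₙₐ[K] J') (a b x : J) :
    jordanPartial K (f a) (f b) (f x) = f (jordanPartial K a b x) := by
  simp only [jordanPartial_apply, map_sub, map_mul]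

/-- The functoriality of `ℬ`. -/
def tagBMap (f : J →ₙₐ[K] J') : TagB K J →ₗ[K] TagB K J' :=
  (tagRelations K J).mapQ (tagRelations K J')
    (TensorProduct.map (f : J →ₗ[K] J') (f : J →ₗ[K] J')) (by
      refine Submodule.span_le.2 ?_
      rintro _ (⟨a, rfl⟩ | ⟨a, rfl⟩)
      · exact Submodule.subset_span (Or.inl ⟨f a, rfl⟩)
      · refine Submodule.subset_span (Or.inr ⟨f a, ?_⟩)
        rw [TensorProduct.map_tmul]
        change f a ⊗ₜ f (a * a) = _
        rw [map_mul])

@[simp]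
theorem tagBMap_wedge (f : J →ₙₐ[K] J') (a b : J) :
    tagBMap f (tagWedge K a b) = tagWedge K (f a) (f b) := rfl

theorem tagBMap_id (w : TagB K J) : tagBMap (NonUnitalAlgHom.id K J) w = w := by
  have h : tagBMap (NonUnitalAlgHom.id K J) = LinearMap.id := tagB_hom_ext fun a b => rfl
  rw [h]; rfl

theorem tagBMap_comp (f : J →ₙₐ[K] J') (f' : J' →ₙₐ[K] J'') (w : TagB K J) :
    tagBMap (f'.comp f) w = tagBMap f' (tagBMap f w) := by
  have h : tagBMap (f'.comp f) = tagBMap f' ∘ₗ tagBMap f := tagB_hom_ext fun a b => rfl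
  rw [h]; rfl

variable [IsCommJordan J] [IsCommJordan J'] [IsCommJordan J'']

theorem tagPartial_map (f : J →ₙₐ[K] J') (w : TagB K J) (x : J) :
    tagPartial K J' (tagBMap f w) (f x) = f (tagPartial K J w x) := by
  induction w using tagB_induction with
  | h0 => simp
  | hw a b => exact jordanPartial_map f a b x
  | hadd u v hu hv => simp only [map_add, LinearMap.add_apply, hu, hv]

variable [CharZero K]

theorem tagAction_map (f : J →ₙₐ[K] J') (w w' : TagB K J) :
    tagAction K J' (tagBMap f w) (tagBMap f w') = tagBMap f (tagAction K J w w') := by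
  induction w' using tagB_induction with
  | h0 => simp
  | hw a b => simp only [tagBMap_wedge, tagAction_wedge, tagPartial_map, map_add]
  | hadd u v hu hv => simp only [map_add, hu, hv]

namespace TAG

theorem bracketSl_map (f : J →ₙₐ[K] J') (u v : Sl2 K ⊗[K] J) :
    bracketSl K J' ((f : J →ₗ[K] J').lTensor (Sl2 K) u) ((f : J →ₗ[K] J').lTensor (Sl2 K) v) =
      (f : J →ₗ[K] J').lTensor (Sl2 K) (bracketSl K J u v) := by
  induction u using TensorProduct.induction_on with
  | zero => simp
  | add x y hx hy => simp only [map_add, LinearMap.add_apply, hx, hy]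
  | tmul x a =>
    induction v using TensorProduct.induction_on with
    | zero => simp
    | add x y hx hy => simp only [map_add, hx, hy]
    | tmul y b =>
      simp only [LinearMap.lTensor_tmul, bracketSl_tmul]
      congr 1
      exact (map_mul f a b).symm

theorem bracketB_map (f : J →ₙₐ[K] J') (u v : Sl2 K ⊗[K] J) :
    bracketB K J' ((f : J →ₗ[K] J').lTensor (Sl2 K) u) ((f : J →ₗ[K] J').lTensor (Sl2 K) v) =
      tagBMap f (bracketB K J u v) := by
  induction u using TensorProduct.induction_on with
  | zero => simp
  | add x y hx hy => simp only [map_add, LinearMap.add_apply, hx, hy]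
  | tmul x a =>
    induction v using TensorProduct.induction_on with
    | zero => simp
    | add x y hx hy => simp only [map_add, hx, hy]
    | tmul y b =>
      simp only [LinearMap.lTensor_tmul, bracketB_tmul, map_smul, tagBMap_wedge]
      rfl

theorem actSl_map (f : J →ₙₐ[K] J') (w : TagB K J) (u : Sl2 K ⊗[K] J) :
    actSl K J' (tagBMap f w) ((f : J →ₗ[K] J').lTensor (Sl2 K) u) =
      (f : J →ₗ[K] J').lTensor (Sl2 K) (actSl K J w u) := by
  induction u using TensorProduct.induction_on with
  | zero => simp
  | add x y hx hy => simp only [map_add, hx, hy]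
  | tmul x a =>
    simp only [LinearMap.lTensor_tmul, actSl_tmul]
    congr 1
    exact tagPartial_map f w a

/-- The functoriality of the Tits–Allison–Gao construction. -/
def map (f : J →ₙₐ[K] J') : TAG K J →ₗ⁅K⁆ TAG K J' where
  toLinearMap := LinearMap.prodMap (tagBMap f) ((f : J →ₗ[K] J').lTensor (Sl2 K))
  map_lie' {X Y} := by
    refine TAG.ext ?_ ?_
    · change tagBMap f ⁅X, Y⁆.1 = tagAction K J' (tagBMap f X.1) (tagBMap f Y.1) +
        bracketB K J' ((f : J →ₗ[K] J').lTensor (Sl2 K) X.2)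
          ((f : J →ₗ[K] J').lTensor (Sl2 K) Y.2)
      rw [lie_fst, map_add, tagAction_map, bracketB_map]
    · change (f : J →ₗ[K] J').lTensor (Sl2 K) ⁅X, Y⁆.2 =
        bracketSl K J' ((f : J →ₗ[K] J').lTensor (Sl2 K) X.2)
          ((f : J →ₗ[K] J').lTensor (Sl2 K) Y.2) +
        actSl K J' (tagBMap f X.1) ((f : J →ₗ[K] J').lTensor (Sl2 K) Y.2) -
        actSl K J' (tagBMap f Y.1) ((f : J →ₗ[K] J').lTensor (Sl2 K) X.2)
      rw [lie_snd, map_sub, map_add, bracketSl_map, actSl_map, actSl_map]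

theorem map_fst (f : J →ₙₐ[K] J') (X : TAG K J) : (map f X).1 = tagBMap f X.1 := rfl

theorem map_snd (f : J →ₙₐ[K] J') (X : TAG K J) :
    (map f X).2 = (f : J →ₗ[K] J').lTensor (Sl2 K) X.2 := rfl

theorem map_sl2Der (f : J →ₙₐ[K] J') (x : Sl2 K) (X : TAG K J) :
    map f (sl2Der x X) = sl2Der x (map f X) := by
  refine TAG.ext ?_ ?_
  · rw [map_fst, sl2Der_apply, sl2Der_apply, sl2Endo_fst, sl2Endo_fst, map_zero]
  · rw [map_snd, sl2Der_apply, sl2Der_apply, sl2Endo_snd, sl2Endo_snd, map_snd]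
    generalize X.2 = u
    induction u using TensorProduct.induction_on with
    | zero => simp
    | add x y hx hy => simp only [map_add, hx, hy]
    | tmul y a => rfl

theorem map_map_of_leftInverse {f : J →ₙₐ[K] J'} {r : J' →ₙₐ[K] J}
    (h : r.comp f = NonUnitalAlgHom.id K J) (X : TAG K J) : map r (map f X) = X := by
  refine TAG.ext ?_ ?_
  · rw [map_fst, map_fst, ← tagBMap_comp, h, tagBMap_id]
  · rw [map_snd, map_snd, ← LinearMap.comp_apply, ← LinearMap.lTensor_comp]
    have e : (r : J' →ₗ[K] J) ∘ₗ (f : J →ₗ[K] J') = LinearMap.id :=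
      LinearMap.ext fun x => DFunLike.congr_fun h x
    rw [e, LinearMap.lTensor_id]
    rfl

end TAG

section Acyclic

variable (K J) in
/-- The `sl₂`-invariant cycles of positive degree of the Chevalley–Eilenberg complex of `sl₂ J`
are boundaries. -/
def InvariantsAcyclic : Prop :=
  ∀ w : ExteriorAlgebra K (TAG K J), ceDifferential K (TAG K J) w = 0 →
    (∀ x : Sl2 K, exteriorDerivation (TAG.sl2Endo x) w = 0) →
    ∃ (c : K) (v : ExteriorAlgebra K (TAG K J)),
      w = algebraMap K _ c + ceDifferential K (TAG K J) v

theorem invariantsAcyclic_of_vanishing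
    (h : ∀ k : ℕ, 1 ≤ k → lieHomologyInvariants (TAG.sl2Action K J) k = ⊥) :
    InvariantsAcyclic K J := by
  classical
  intro w hd hw
  let π : ℕ → ExteriorAlgebra K (TAG K J) → ExteriorAlgebra K (TAG K J) :=
    fun k x => (DirectSum.decompose (fun n => ⋀[K]^n (TAG K J)) x k : ExteriorAlgebra K (TAG K J))
  have hsum : ∀ x, x = ∑ k ∈ (DirectSum.decompose (fun n => ⋀[K]^n (TAG K J)) x).support, π k x :=
    fun x => (DirectSum.sum_support_decompose (fun n => ⋀[K]^n (TAG K J)) x).symm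
  have hπ : ∀ k x, π k x ∈ ⋀[K]^k (TAG K J) := fun k x => SetLike.coe_mem _
  have hadd : ∀ k x y, π k (x + y) = π k x + π k y := fun k x y => by
    simp only [π, DirectSum.decompose_add, DirectSum.add_apply, Submodule.coe_add]
  have h0 : ∀ k, π k 0 = 0 := fun k => by
    simp only [π, DirectSum.decompose_zero, DirectSum.zero_apply, Submodule.coe_zero]
  have hsame : ∀ k x, x ∈ ⋀[K]^k (TAG K J) → π k x = x := fun k x hx =>
    DirectSum.decompose_of_mem_same _ hx
  have hne : ∀ k l x, x ∈ ⋀[K]^k (TAG K J) → k ≠ l → π l x = 0 := fun k l x hx hkl =>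
    DirectSum.decompose_of_mem_ne _ hx hkl
  have key : ∀ (Q : Module.End K (ExteriorAlgebra K (TAG K J))) (s : ℕ → ℕ)
      (t : ℕ → ℕ), (∀ k x, x ∈ ⋀[K]^k (TAG K J) → Q x = 0 ∨ (Q x ∈ ⋀[K]^(s k) (TAG K J) ∧
        t (s k) = k)) → ∀ x, Q x = 0 → ∀ k, Q (π k x) = 0 := by
    intro Q s t hQ x hx k
    rcases hQ k (π k x) (hπ k x) with h1 | ⟨h1, h2⟩
    · exact h1
    · have e : ∀ (T : Finset ℕ), π (s k) (Q (∑ l ∈ T, π l x)) =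
          if k ∈ T then Q (π k x) else 0 := by
        intro T
        induction T using Finset.induction_on with
        | empty => simp [h0]
        | insert l T hl ih =>
          rw [Finset.sum_insert hl, map_add, hadd, ih]
          by_cases hkl : k = l
          · subst hkl
            rw [hsame _ _ h1]
            simp [hl]
          · have : π (s k) (Q (π l x)) = 0 := by
              rcases hQ l (π l x) (hπ l x) with h3 | ⟨h3, h4⟩
              · rw [h3, h0]
              · refine hne _ _ _ h3 fun h5 => hkl ?_
                rw [← h2, ← h4, h5]
            rw [this, zero_add]
            simp [hkl]
      have e2 := e (DirectSum.decompose (fun n => ⋀[K]^n (TAG K J)) x).support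
      rw [← hsum, hx, h0] at e2
      by_cases hk : k ∈ (DirectSum.decompose (fun n => ⋀[K]^n (TAG K J)) x).support
      · rw [if_pos hk] at e2
        exact e2.symm
      · have : π k x = 0 := by
          have := DFinsupp.notMem_support_iff.1 hk
          simp only [π, this, Submodule.coe_zero]
        rw [this, map_zero]
  have hdk := key (ceDifferential K (TAG K J)) (fun k => k - 1) (fun k => k + 1) (fun k x hx => by
    rcases k with _ | k
    · exact Or.inl (ceDifferential_mem_zero hx)
    · exact Or.inr ⟨ceDifferential_mem k hx, rfl⟩) w hd
  have hxk := fun x => key (exteriorDerivation (TAG.sl2Endo x)) id id (fun k x hx =>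
    Or.inr ⟨exteriorDerivation_mem _ _ hx, rfl⟩) w (hw x)
  have hb : ∀ k, ∃ (c : K) (v : ExteriorAlgebra K (TAG K J)),
      π k w = algebraMap K _ c + ceDifferential K (TAG K J) v := by
    intro k
    rcases k with _ | k
    · have h1 := hπ 0 w
      change _ ∈ LinearMap.range (ExteriorAlgebra.ι K) ^ 0 at h1
      rw [pow_zero, Submodule.mem_one] at h1
      obtain ⟨r, hr⟩ := h1
      exact ⟨r, 0, by rw [map_zero, add_zero, hr]⟩
    · have hc : π (k + 1) w ∈ ceCycles K (TAG K J) (k + 1) := ⟨hdk (k + 1), hπ _ w⟩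
      have h1 : (Submodule.Quotient.mk ⟨π (k + 1) w, hc⟩ : LieHomology K (TAG K J) (k + 1)) ∈
          lieHomologyInvariants (TAG.sl2Action K J) (k + 1) := by
        refine Submodule.mem_iInf _ |>.2 fun x => ?_
        rw [LinearMap.mem_ker]
        change Submodule.Quotient.mk (ceCyclesMap _ _ _) = _
        have : ceCyclesMap (TAG.sl2Action K J x) (k + 1) ⟨π (k + 1) w, hc⟩ = 0 :=
          Subtype.ext (hxk x (k + 1))
        rw [this]
        rfl
      rw [h (k + 1) (by omega), Submodule.mem_bot, Submodule.Quotient.mk_eq_zero] at h1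
      obtain ⟨v, _, hv⟩ := h1
      exact ⟨0, v, by rw [map_zero, zero_add, hv]; rfl⟩
  choose c v hcv using hb
  refine ⟨∑ k ∈ (DirectSum.decompose (fun n => ⋀[K]^n (TAG K J)) w).support, c k,
    ∑ k ∈ (DirectSum.decompose (fun n => ⋀[K]^n (TAG K J)) w).support, v k, ?_⟩
  rw [map_sum, map_sum, ← Finset.sum_add_distrib]
  conv_lhs => rw [hsum w]
  exact Finset.sum_congr rfl fun k _ => hcv k

theorem InvariantsAcyclic.of_retract {f : J →ₙₐ[K] J'} {r : J' →ₙₐ[K] J}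
    (h : r.comp f = NonUnitalAlgHom.id K J) (hJ' : InvariantsAcyclic K J') :
    InvariantsAcyclic K J := by
  intro w hd hw
  obtain ⟨c, v, hv⟩ := hJ' (ExteriorAlgebra.map (TAG.map f : TAG K J →ₗ[K] TAG K J') w)
    (by rw [← map_ceDifferential, hd, map_zero])
    (fun x => by
      have h1 := map_exteriorDerivation (φ := TAG.sl2Endo x) (ψ := TAG.sl2Endo x)
        (TAG.map f : TAG K J →ₗ[K] TAG K J') (fun X => TAG.map_sl2Der f x X) w
      rw [hw x, map_zero] at h1
      exact h1.symm)
  refine ⟨c, ExteriorAlgebra.map (TAG.map r : TAG K J' →ₗ[K] TAG K J) v, ?_⟩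
  have h1 := congrArg (ExteriorAlgebra.map (TAG.map r : TAG K J' →ₗ[K] TAG K J)) hv
  rw [map_add, AlgHom.commutes, map_ceDifferential] at h1
  rw [← h1, ← AlgHom.comp_apply, ExteriorAlgebra.map_comp_map]
  have e : (TAG.map r : TAG K J' →ₗ[K] TAG K J) ∘ₗ (TAG.map f : TAG K J →ₗ[K] TAG K J') =
      LinearMap.id := LinearMap.ext fun X => TAG.map_map_of_leftInverse h X
  rw [e, ExteriorAlgebra.map_id]
  rfl

end Acyclic

end Functoriality

section WeightProjection

variable {K : Type*} [Field K] {V : Type*} [AddCommGroup V] [Module K V]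
  {ι M : Type*} [DecidableEq M] (b : Module.Basis ι K V) (wt : ι → M)

/-- The vectors of weight `m`, for a basis `b` whose `i`-th vector has weight `wt i`. -/
def basisWeightSpace (m : M) : Submodule K V where
  carrier := {v | ∀ i, b.repr v i ≠ 0 → wt i = m}
  zero_mem' i h := by simp at h
  add_mem' {x y} hx hy i h := by
    rw [map_add, Finsupp.add_apply] at h
    by_cases h1 : b.repr x i = 0
    · exact hy i fun h2 => h (by rw [h1, h2, add_zero])
    · exact hx i h1
  smul_mem' c x hx i h := hx i fun h1 => h (by
    rw [map_smul, Finsupp.smul_apply, h1, smul_zero])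

theorem basis_mem_weightSpace (i : ι) : b i ∈ basisWeightSpace b wt (wt i) := by
  classical
  intro k hk
  rw [Module.Basis.repr_self, Finsupp.single_apply] at hk
  by_cases h : i = k
  · rw [h]
  · simp [h] at hk

/-- The projection to the weight space of weight `m`. -/
def weightProj (m : M) : V →ₗ[K] V :=
  b.constr K fun i => if wt i = m then b i else 0

theorem weightProj_basis (m : M) (i : ι) :
    weightProj b wt m (b i) = if wt i = m then b i else 0 := by
  rw [weightProj, Module.Basis.constr_basis]

theorem repr_weightProj (m : M) (v : V) (i : ι) :
    b.repr (weightProj b wt m v) i = if wt i = m then b.repr v i else 0 := by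
  classical
  have h : (Finsupp.lapply i ∘ₗ b.repr.toLinearMap) ∘ₗ weightProj b wt m =
      if wt i = m then Finsupp.lapply i ∘ₗ b.repr.toLinearMap else 0 := by
    refine b.ext fun k => ?_
    rw [LinearMap.comp_apply, weightProj_basis]
    by_cases hk : wt k = m
    · rw [if_pos hk]
      by_cases hi : wt i = m
      · rw [if_pos hi]
      · rw [if_neg hi]
        have : k ≠ i := fun h => hi (h ▸ hk)
        simp [this]
    · rw [if_neg hk, map_zero]
      by_cases hi : wt i = m
      · rw [if_pos hi]
        have : k ≠ i := fun h => hk (h ▸ hi)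
        simp [this]
      · rw [if_neg hi]; rfl
  have h2 := LinearMap.congr_fun h v
  split_ifs at h2 ⊢
  · exact h2
  · exact h2

theorem weightProj_mem (m : M) (v : V) : weightProj b wt m v ∈ basisWeightSpace b wt m := by
  intro i hi
  rw [repr_weightProj] at hi
  by_contra h
  rw [if_neg h] at hi
  exact hi rfl

variable {b wt}

theorem weightProj_of_mem {m : M} {v : V} (hv : v ∈ basisWeightSpace b wt m) :
    weightProj b wt m v = v := by
  refine b.ext_elem fun i => ?_
  rw [repr_weightProj]
  split_ifs with h
  · rfl
  · by_contra h2
    exact h (hv i (Ne.symm h2))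

theorem weightProj_of_mem_ne {m m' : M} {v : V} (hv : v ∈ basisWeightSpace b wt m)
    (h : m ≠ m') : weightProj b wt m' v = 0 := by
  refine b.ext_elem fun i => ?_
  rw [repr_weightProj, map_zero, Finsupp.zero_apply]
  split_ifs with h1
  · by_contra h2
    exact h ((hv i h2).symm.trans h1)
  · rfl

theorem weightProj_comm {V' ι' M' : Type*} [AddCommGroup V'] [Module K V'] [DecidableEq M']
    {b' : Module.Basis ι' K V'} {wt' : ι' → M'} {Q : V →ₗ[K] V'} {s : M → M'}
    (hs : Function.Injective s) (hQ : ∀ i, Q (b i) ∈ basisWeightSpace b' wt' (s (wt i))) (m : M)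
    (v : V) : weightProj b' wt' (s m) (Q v) = Q (weightProj b wt m v) := by
  have h : weightProj b' wt' (s m) ∘ₗ Q = Q ∘ₗ weightProj b wt m := by
    refine b.ext fun i => ?_
    rw [LinearMap.comp_apply, LinearMap.comp_apply, weightProj_basis]
    split_ifs with h1
    · rw [← h1, weightProj_of_mem (hQ i)]
    · rw [map_zero, weightProj_of_mem_ne (hQ i) fun h2 => h1 (hs h2)]
  exact LinearMap.congr_fun h v

theorem repr_of_diagonal {A : Module.End K V} {c : ι → K} (hA : ∀ i, A (b i) = c i • b i) (v : V)
    (i : ι) : b.repr (A v) i = c i * b.repr v i := by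
  classical
  have h : (Finsupp.lapply i ∘ₗ b.repr.toLinearMap) ∘ₗ A =
      c i • (Finsupp.lapply i ∘ₗ b.repr.toLinearMap) := by
    refine b.ext fun k => ?_
    rw [LinearMap.comp_apply, hA, map_smul, LinearMap.smul_apply]
    by_cases hk : k = i
    · rw [hk]
    · simp [hk]
  exact LinearMap.congr_fun h v

theorem eq_of_diagonal {A : Module.End K V} {c : ι → K} (hA : ∀ i, A (b i) = c i • b i) {v : V}
    {lam : K} (hv : A v = lam • v) {i : ι} (hi : b.repr v i ≠ 0) : c i = lam := by
  have h := repr_of_diagonal hA v i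
  rw [hv, map_smul, Finsupp.smul_apply, smul_eq_mul] at h
  exact (mul_right_cancel₀ hi h).symm

theorem eigen_of_mem {A : Module.End K V} {c : M → K} (hA : ∀ i, A (b i) = c (wt i) • b i) {v : V}
    {m : M} (hv : v ∈ basisWeightSpace b wt m) : A v = c m • v := by
  refine b.ext_elem fun i => ?_
  rw [repr_of_diagonal hA, map_smul, Finsupp.smul_apply, smul_eq_mul]
  by_cases h : b.repr v i = 0
  · rw [h, mul_zero, mul_zero]
  · rw [hv i h]

theorem basisWeightSpace_eq_span (m : M) :
    basisWeightSpace b wt m = Submodule.span K (Set.range fun i : {i // wt i = m} => b i) := by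
  refine le_antisymm (fun v hv => ?_) (Submodule.span_le.2 ?_)
  · rw [← b.linearCombination_repr v, Finsupp.linearCombination_apply, Finsupp.sum]
    exact Submodule.sum_mem _ fun i hi => Submodule.smul_mem _ _
      (Submodule.subset_span ⟨⟨i, hv i (Finsupp.mem_support_iff.1 hi)⟩, rfl⟩)
  · rintro _ ⟨⟨i, rfl⟩, rfl⟩
    exact basis_mem_weightSpace b wt i

theorem finrank_basisWeightSpace (m : M) :
    Module.finrank K (basisWeightSpace b wt m) = Nat.card {i // wt i = m} := by
  rw [basisWeightSpace_eq_span]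
  exact Module.finrank_eq_nat_card_basis
    (Module.Basis.span (b.linearIndependent.comp (fun i : {i // wt i = m} => (i : ι))
      Subtype.val_injective))

theorem finiteDimensional_basisWeightSpace (m : M) [Finite {i // wt i = m}] :
    FiniteDimensional K (basisWeightSpace b wt m) := by
  rw [basisWeightSpace_eq_span]
  exact FiniteDimensional.span_of_finite K (Set.finite_range _)

end WeightProjection

section Sl2OnExterior

variable {K : Type*} [Field K]

/-- The matrix unit `e` of `sl₂`. -/
def sl2E (K : Type*) [Field K] : Sl2 K := ⟨!![0, 1; 0, 0], by
  change Matrix.trace (!![0, 1; 0, 0] : Matrix (Fin 2) (Fin 2) K) = 0; simp [Matrix.trace_fin_two]⟩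

/-- The matrix unit `f` of `sl₂`. -/
def sl2F (K : Type*) [Field K] : Sl2 K := ⟨!![0, 0; 1, 0], by
  change Matrix.trace (!![0, 0; 1, 0] : Matrix (Fin 2) (Fin 2) K) = 0; simp [Matrix.trace_fin_two]⟩

/-- The element `h = [e, f]` of `sl₂`. -/
def sl2H (K : Type*) [Field K] : Sl2 K := ⟨!![1, 0; 0, -1], by
  change Matrix.trace (!![1, 0; 0, -1] : Matrix (Fin 2) (Fin 2) K) = 0; simp [Matrix.trace_fin_two]⟩

theorem sl2_lie_h_e : ⁅sl2H K, sl2E K⁆ = (2 : K) • sl2E K := by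
  apply Subtype.ext
  change (sl2H K).1 * (sl2E K).1 - (sl2E K).1 * (sl2H K).1 = (2 : K) • (sl2E K).1
  ext i j
  fin_cases i <;> fin_cases j <;> simp [sl2H, sl2E]
  norm_num

theorem sl2_lie_h_f : ⁅sl2H K, sl2F K⁆ = -((2 : K) • sl2F K) := by
  apply Subtype.ext
  change (sl2H K).1 * (sl2F K).1 - (sl2F K).1 * (sl2H K).1 = -((2 : K) • (sl2F K).1)
  ext i j
  fin_cases i <;> fin_cases j <;> simp [sl2H, sl2F]
  norm_num

theorem sl2_lie_e_f : ⁅sl2E K, sl2F K⁆ = sl2H K := by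
  apply Subtype.ext
  change (sl2E K).1 * (sl2F K).1 - (sl2F K).1 * (sl2E K).1 = (sl2H K).1
  ext i j
  fin_cases i <;> fin_cases j <;> simp [sl2H, sl2E, sl2F]

theorem sl2_eq (x : Sl2 K) :
    x = x.1 0 1 • sl2E K + x.1 0 0 • sl2H K + x.1 1 0 • sl2F K := by
  have h : Matrix.trace x.1 = 0 := x.2
  rw [Matrix.trace_fin_two] at h
  apply Subtype.ext
  change x.1 = x.1 0 1 • (sl2E K).1 + x.1 0 0 • (sl2H K).1 + x.1 1 0 • (sl2F K).1
  ext i j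
  fin_cases i <;> fin_cases j <;> simp [sl2H, sl2E, sl2F]
  linear_combination h

/-- The basis `e, h, f` of `sl₂`. -/
def sl2Basis (K : Type*) [Field K] : Module.Basis (Fin 3) K (Sl2 K) :=
  Module.Basis.ofEquivFun
    { toFun := fun x => ![x.1 0 1, x.1 0 0, x.1 1 0]
      map_add' := fun x y => by ext i; fin_cases i <;> rfl
      map_smul' := fun c x => by ext i; fin_cases i <;> rfl
      invFun := fun c => c 0 • sl2E K + c 1 • sl2H K + c 2 • sl2F K
      left_inv := fun x => (sl2_eq x).symm
      right_inv := fun c => by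
        have h : (c 0 • sl2E K + c 1 • sl2H K + c 2 • sl2F K).1 =
            c 0 • (sl2E K).1 + c 1 • (sl2H K).1 + c 2 • (sl2F K).1 := rfl
        ext i
        fin_cases i <;> simp [sl2H, sl2E, sl2F] }

theorem sl2Basis_apply (k : Fin 3) : sl2Basis K k = ![sl2E K, sl2H K, sl2F K] k := by
  rw [sl2Basis, Module.Basis.coe_ofEquivFun]
  change (Pi.single k 1 : Fin 3 → K) 0 • sl2E K + (Pi.single k 1 : Fin 3 → K) 1 • sl2H K +
    (Pi.single k 1 : Fin 3 → K) 2 • sl2F K = _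
  fin_cases k <;> simp

/-- The weights of the basis vectors `e, h, f`. -/
def sl2Weight (k : Fin 3) : ℤ := 1 - (k : ℤ)

theorem sl2_lie_h_basis (k : Fin 3) :
    ⁅sl2H K, sl2Basis K k⁆ = ((2 * sl2Weight k : ℤ) : K) • sl2Basis K k := by
  rw [sl2Basis_apply]
  fin_cases k
  · simpa [sl2Weight] using sl2_lie_h_e
  · simp [sl2Weight]
  · simpa [sl2Weight] using sl2_lie_h_f

theorem sl2_ad_cube_e (x : Sl2 K) : ⁅sl2E K, ⁅sl2E K, ⁅sl2E K, x⁆⁆⁆ = 0 := by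
  have h1 : ⁅sl2E K, sl2H K⁆ = -((2 : K) • sl2E K) := by rw [← lie_skew, sl2_lie_h_e]
  rw [sl2_eq x]
  simp [sl2_lie_e_f, h1]

theorem sl2_ad_cube_f (x : Sl2 K) : ⁅sl2F K, ⁅sl2F K, ⁅sl2F K, x⁆⁆⁆ = 0 := by
  have h1 : ⁅sl2F K, sl2H K⁆ = (2 : K) • sl2F K := by rw [← lie_skew, sl2_lie_h_f, neg_neg]
  have h2 : ⁅sl2F K, sl2E K⁆ = -sl2H K := by rw [← lie_skew, sl2_lie_e_f]
  rw [sl2_eq x]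
  simp [h1, h2]

theorem exteriorDerivation_locally_nilpotent {g : Type*} [LieRing g] [LieAlgebra K g]
    {φ : g →ₗ[K] g} (h : ∀ y, ∃ a, (φ ^ a) y = 0) (w : ExteriorAlgebra K g) :
    ∃ k, ((exteriorDerivation φ) ^ k) w = 0 := by
  have key : ∀ n a c : ℕ, a + c = n → ∀ (y : g) (w : ExteriorAlgebra K g), (φ ^ a) y = 0 →
      ((exteriorDerivation φ) ^ c) w = 0 →
      ((exteriorDerivation φ) ^ n) (ExteriorAlgebra.ι K y * w) = 0 := by
    intro n
    induction n with
    | zero =>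
      intro a c hac y w hy _
      obtain rfl : a = 0 := by omega
      rw [pow_zero, Module.End.one_apply] at hy
      rw [hy, map_zero, zero_mul, map_zero]
    | succ n ih =>
      intro a c hac y w hy hw
      rcases a with _ | a
      · rw [pow_zero, Module.End.one_apply] at hy
        rw [hy, map_zero, zero_mul, map_zero]
      · rcases c with _ | c
        · rw [pow_zero, Module.End.one_apply] at hw
          rw [hw, mul_zero, map_zero]
        · rw [pow_succ, Module.End.mul_apply, exteriorDerivation_ι_mul, map_add,
            ih a (c + 1) (by omega) _ _ (by rwa [pow_succ, Module.End.mul_apply] at hy) hw,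
            ih (a + 1) c (by omega) _ _ hy (by rwa [pow_succ, Module.End.mul_apply] at hw),
            add_zero]
  have mono : ∀ {V : Type _} [AddCommGroup V] [Module K V] (A : Module.End K V) (v : V) (k l : ℕ),
      (A ^ k) v = 0 → (A ^ (l + k)) v = 0 := by
    intro V _ _ A v k l hk
    rw [pow_add, Module.End.mul_apply, hk, map_zero]
  induction w using exteriorAlgebra_induction with
  | h0 r => exact ⟨1, by rw [pow_one, exteriorDerivation_algebraMap]⟩
  | hadd x y hx hy =>
    obtain ⟨k, hk⟩ := hx
    obtain ⟨l, hl⟩ := hy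
    exact ⟨k + l, by rw [map_add, mono _ _ _ _ hl, add_comm k, mono _ _ _ _ hk, add_zero]⟩
  | hι w y hw =>
    obtain ⟨c, hc⟩ := hw
    obtain ⟨a, ha⟩ := h y
    exact ⟨a + c, key _ a c rfl y w ha hc⟩

variable [CharZero K] {J : Type*} [NonUnitalNonAssocCommRing J] [Module K J]
  [IsScalarTower K J J] [SMulCommClass K J J] [IsCommJordan J]

namespace TAG

/-- The action of `sl₂` on the exterior algebra of `sl₂ J`. -/
def sl2Ext (J : Type*) [NonUnitalNonAssocCommRing J] [Module K J]
    [IsScalarTower K J J] [SMulCommClass K J J] [IsCommJordan J] (x : Sl2 K) :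
    Module.End K (ExteriorAlgebra K (TAG K J)) :=
  exteriorDerivation (sl2Endo x)

theorem sl2Endo_add (x y : Sl2 K) :
    (sl2Endo (x + y) : TAG K J →ₗ[K] TAG K J) = sl2Endo x + sl2Endo y :=
  congrArg LieDerivation.toLinearMap ((sl2Action K J).map_add x y)

theorem sl2Endo_smul (c : K) (x : Sl2 K) :
    (sl2Endo (c • x) : TAG K J →ₗ[K] TAG K J) = c • sl2Endo x :=
  congrArg LieDerivation.toLinearMap ((sl2Action K J).map_smul c x)

theorem sl2Endo_lie (x y : Sl2 K) :
    (sl2Endo ⁅x, y⁆ : TAG K J →ₗ[K] TAG K J) =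
      sl2Endo x ∘ₗ sl2Endo y - sl2Endo y ∘ₗ sl2Endo x := by
  have h := (sl2Action K J).map_lie x y
  refine LinearMap.ext fun X => ?_
  have h2 := DFunLike.congr_fun h X
  rw [LieDerivation.commutator_apply] at h2
  exact h2

theorem sl2Ext_lie (x y : Sl2 K) (w : ExteriorAlgebra K (TAG K J)) :
    sl2Ext J ⁅x, y⁆ w = sl2Ext J x (sl2Ext J y w) - sl2Ext J y (sl2Ext J x w) := by
  rw [sl2Ext, sl2Endo_lie, exteriorDerivation_commutator]
  rfl

theorem sl2Ext_smul (c : K) (x : Sl2 K) : sl2Ext J (c • x) = c • sl2Ext J x := by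
  rw [sl2Ext, sl2Endo_smul, exteriorDerivation_smul]
  rfl

theorem sl2Ext_add (x y : Sl2 K) : sl2Ext J (x + y) = sl2Ext J x + sl2Ext J y := by
  rw [sl2Ext, sl2Endo_add, exteriorDerivation_add]
  rfl

theorem sl2Ext_relations :
    Sl2Relations (sl2Ext J (sl2E K)) (sl2Ext J (sl2F K)) (sl2Ext J (sl2H K)) where
  lie_h_e v := by
    have h := sl2Ext_lie (J := J) (sl2H K) (sl2E K) v
    rw [sl2_lie_h_e, sl2Ext_smul, LinearMap.smul_apply] at h
    rw [h]; abel
  lie_h_f v := by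
    have h := sl2Ext_lie (J := J) (sl2H K) (sl2F K) v
    rw [sl2_lie_h_f, ← neg_smul, sl2Ext_smul, LinearMap.smul_apply] at h
    linear_combination (norm := module) -h
  lie_e_f v := by
    have h := sl2Ext_lie (J := J) (sl2E K) (sl2F K) v
    rw [sl2_lie_e_f] at h
    rw [h]; abel

theorem sl2Endo_locally_nilpotent {x : Sl2 K} (hx : ∀ y : Sl2 K, ⁅x, ⁅x, ⁅x, y⁆⁆⁆ = 0)
    (X : TAG K J) : ((sl2Endo x : TAG K J →ₗ[K] TAG K J) ^ 3) X = 0 := by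
  change sl2Endo x (sl2Endo x (sl2Endo x X)) = 0
  refine TAG.ext rfl ?_
  simp only [sl2Endo_snd]
  change _ = (0 : Sl2 K ⊗[K] J)
  generalize X.2 = u
  induction u using TensorProduct.induction_on with
  | zero => simp
  | add a b ha hb => simp only [map_add, ha, hb, add_zero]
  | tmul y a => simp only [LinearMap.rTensor_tmul, LieAlgebra.ad_apply, hx, TensorProduct.zero_tmul]

theorem sl2Ext_e_locally_nilpotent (w : ExteriorAlgebra K (TAG K J)) :
    ∃ k, ((sl2Ext J (sl2E K)) ^ k) w = 0 := by
  unfold sl2Ext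
  refine exteriorDerivation_locally_nilpotent (fun y => ⟨3, ?_⟩) w
  exact sl2Endo_locally_nilpotent sl2_ad_cube_e y

theorem sl2Ext_f_locally_nilpotent (w : ExteriorAlgebra K (TAG K J)) :
    ∃ k, ((sl2Ext J (sl2F K)) ^ k) w = 0 := by
  unfold sl2Ext
  refine exteriorDerivation_locally_nilpotent (fun y => ⟨3, ?_⟩) w
  exact sl2Endo_locally_nilpotent sl2_ad_cube_f y

theorem ceDifferential_sl2Ext (x : Sl2 K) (w : ExteriorAlgebra K (TAG K J)) :
    ceDifferential K (TAG K J) (sl2Ext J x w) = sl2Ext J x (ceDifferential K (TAG K J) w) :=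
  ceDifferential_comm (sl2Der x) w

theorem sl2Ext_eq_zero {w : ExteriorAlgebra K (TAG K J)} (he : sl2Ext J (sl2E K) w = 0)
    (hf : sl2Ext J (sl2F K) w = 0) (hh : sl2Ext J (sl2H K) w = 0) (x : Sl2 K) :
    sl2Ext J x w = 0 := by
  rw [sl2_eq x, sl2Ext_add, sl2Ext_add, sl2Ext_smul, sl2Ext_smul, sl2Ext_smul]
  simp [he, hf, hh]

section Basis

variable {IB IJ : Type*} (bB : Module.Basis IB K (TagB K J)) (bJ : Module.Basis IJ K J)

/-- The basis of `sl₂ J` given by bases of `ℬJ` and `J`. -/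
def basis : Module.Basis (IB ⊕ (Fin 3 × IJ)) K (TAG K J) :=
  (bB.prod ((sl2Basis K).tensorProduct bJ) :
    Module.Basis (IB ⊕ (Fin 3 × IJ)) K (TagB K J × (Sl2 K ⊗[K] J)))

theorem basis_inl_fst (i : IB) : (basis bB bJ (Sum.inl i)).1 = bB i := by
  change (bB.prod ((sl2Basis K).tensorProduct bJ) (Sum.inl i)).1 = _
  simp

theorem basis_inl_snd (i : IB) : (basis bB bJ (Sum.inl i)).2 = 0 := by
  change (bB.prod ((sl2Basis K).tensorProduct bJ) (Sum.inl i)).2 = _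
  simp

theorem basis_inr_fst (i : Fin 3 × IJ) : (basis bB bJ (Sum.inr i)).1 = 0 := by
  change (bB.prod ((sl2Basis K).tensorProduct bJ) (Sum.inr i)).1 = _
  simp

theorem basis_inr_snd (i : Fin 3 × IJ) :
    (basis bB bJ (Sum.inr i)).2 = sl2Basis K i.1 ⊗ₜ bJ i.2 := by
  change (bB.prod ((sl2Basis K).tensorProduct bJ) (Sum.inr i)).2 = _
  simp [Module.Basis.tensorProduct_apply']

/-- The `sl₂`-weights of the basis vectors of `sl₂ J`. -/
def basisSl2Weight : IB ⊕ (Fin 3 × IJ) → ℤ := Sum.elim (fun _ => 0) (fun i => sl2Weight i.1)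

theorem sl2Endo_h_basis (i : IB ⊕ (Fin 3 × IJ)) :
    sl2Endo (sl2H K) (basis bB bJ i) = ((2 * basisSl2Weight i : ℤ) : K) • basis bB bJ i := by
  refine TAG.ext ?_ ?_
  · rw [sl2Endo_fst, fst_smul]
    rcases i with i | i
    · simp [basisSl2Weight]
    · rw [basis_inr_fst, smul_zero]
  · rw [sl2Endo_snd, snd_smul]
    rcases i with i | i
    · rw [basis_inl_snd, map_zero, smul_zero]
    · rw [basis_inr_snd, LinearMap.rTensor_tmul, LieAlgebra.ad_apply, sl2_lie_h_basis,
        TensorProduct.smul_tmul']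
      rfl

end Basis

end TAG

theorem InvariantsAcyclic.exists_invariant (hJ : InvariantsAcyclic K J)
    {w : ExteriorAlgebra K (TAG K J)} (hd : ceDifferential K (TAG K J) w = 0)
    (hw : ∀ x : Sl2 K, TAG.sl2Ext J x w = 0) :
    ∃ (c : K) (v : ExteriorAlgebra K (TAG K J)), (∀ x : Sl2 K, TAG.sl2Ext J x v = 0) ∧
      w = algebraMap K _ c + ceDifferential K (TAG K J) v := by
  classical
  obtain ⟨c, v, hv⟩ := hJ w hd hw
  let bB := Module.Basis.ofVectorSpace K (TagB K J)
  let bJ := Module.Basis.ofVectorSpace K J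
  let b := TAG.basis bB bJ
  let _ : LinearOrder (Module.Basis.ofVectorSpaceIndex K (TagB K J) ⊕
    (Fin 3 × Module.Basis.ofVectorSpaceIndex K J)) := linearOrderOfSTO WellOrderingRel
  let wt : Finset (Module.Basis.ofVectorSpaceIndex K (TagB K J) ⊕
    (Fin 3 × Module.Basis.ofVectorSpaceIndex K J)) → ℤ := fun S => ∑ i ∈ S, TAG.basisSl2Weight i
  have hH : ∀ S, TAG.sl2Ext J (sl2H K) (b.ExteriorAlgebra S) =
      ((2 * wt S : ℤ) : K) • b.ExteriorAlgebra S := fun S => by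
    rw [TAG.sl2Ext, exteriorDerivation_basis b _ _ (TAG.sl2Endo_h_basis bB bJ)]
    congr 1
    simp only [wt, Finset.mul_sum]
    push_cast
    rfl
  let v0 := weightProj b.ExteriorAlgebra wt 0 v
  have hv0 : TAG.sl2Ext J (sl2H K) v0 = 0 := by
    rw [eigen_of_mem (c := fun m : ℤ => ((2 * m : ℤ) : K)) hH (weightProj_mem _ wt 0 v)]
    simp
  have hinv1 : ∀ x : Sl2 K, TAG.sl2Ext J x (algebraMap K _ c) = 0 := fun x =>
    exteriorDerivation_algebraMap _ _
  have hmem : ∀ u, TAG.sl2Ext J (sl2H K) u = 0 → weightProj b.ExteriorAlgebra wt 0 u = u := by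
    intro u hu
    refine weightProj_of_mem fun S hS => ?_
    have := eq_of_diagonal hH (lam := 0) (by rw [hu, zero_smul]) hS
    have h2 : (2 * wt S : ℤ) = 0 := by exact_mod_cast this
    omega
  have hdv0 : ceDifferential K (TAG K J) v0 = w - algebraMap K _ c := by
    have := weightProj_comm (b := b.ExteriorAlgebra) (wt := wt) (b' := b.ExteriorAlgebra)
      (wt' := wt) (s := id)
      (Q := ceDifferential K (TAG K J)) Function.injective_id (fun S => by
        intro S' hS'
        have := eq_of_diagonal hH (v := ceDifferential K (TAG K J) (b.ExteriorAlgebra S))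
          (lam := ((2 * wt S : ℤ) : K)) (by rw [← TAG.ceDifferential_sl2Ext, hH, map_smul]) hS'
        have h2 : (2 * wt S' : ℤ) = 2 * wt S := by exact_mod_cast this
        change wt S' = wt S
        omega) 0 v
    rw [← this]
    change weightProj b.ExteriorAlgebra wt 0 _ = _
    have hdv : ceDifferential K (TAG K J) v = w - algebraMap K _ c := by rw [hv]; abel
    rw [hdv]
    exact hmem _ (by rw [map_sub, hw, hinv1, sub_zero])
  obtain ⟨v', h1, h2, h3, h4⟩ := (TAG.sl2Ext_relations (K := K) (J := J)).exists_invariant_lift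
    TAG.sl2Ext_e_locally_nilpotent TAG.sl2Ext_f_locally_nilpotent
    (d := ceDifferential K (TAG K J)) (TAG.ceDifferential_sl2Ext _) (TAG.ceDifferential_sl2Ext _)
    (TAG.ceDifferential_sl2Ext _) (w := w - algebraMap K _ c)
    (by rw [map_sub, hw, hinv1, sub_zero]) hdv0 hv0
  exact ⟨c, v', TAG.sl2Ext_eq_zero h2 h3 h4, by rw [h1]; abel⟩

end Sl2OnExterior

section CentralElements

theorem not_exact_of_nilpotent_contraction {K V : Type*} [Field K] [AddCommGroup V] [Module K V]
    {d i e : Module.End K V} {ε : Module.Dual K V} {one : V}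
    (hdd : ∀ w, d (d w) = 0) (hee : ∀ w, e (e w) = 0)
    (hde : ∀ w, d (e w) = -e (d w)) (hie : ∀ w, i (e w) + e (i w) = w)
    (hXe : ∀ w, (d * i + i * d) (e w) = e ((d * i + i * d) w))
    (hεd : ∀ w, ε (d w) = 0) (hεe : ∀ w, ε (e w) = 0) (hε1 : ε one = 1) (hd1 : d one = 0)
    (hi1 : i one = 0) (hex : ∀ w, d w = 0 → ∃ (c : K) (v : V), w = c • one + d v)
    (M : ℕ) (hM : ∀ w, ε (((d * i + i * d) ^ M) w) = 0) : False := by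
  set X := d * i + i * d with hX
  have hXd : Commute X d := by
    refine LinearMap.ext fun w => ?_
    simp only [hX, Module.End.mul_apply, LinearMap.add_apply, map_add, hdd, map_zero, zero_add,
      add_zero]
  have hXe' : Commute X e := LinearMap.ext hXe
  have hXk : ∀ k w, (X ^ k) (d w) = d ((X ^ k) w) := fun k w =>
    LinearMap.congr_fun (hXd.pow_left k) w
  have hXek : ∀ k w, (X ^ k) (e w) = e ((X ^ k) w) := fun k w =>
    LinearMap.congr_fun (hXe'.pow_left k) w
  have key : ∀ m, (∃ γ : Module.Dual K V, (∀ w, ε ((X ^ m) w) = γ (d w)) ∧ ∀ w, γ (e w) = 0) →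
      False := by
    intro m
    induction m with
    | zero =>
      rintro ⟨γ, h1, _⟩
      have h := h1 one
      rw [pow_zero, Module.End.one_apply, hε1, hd1, map_zero] at h
      exact one_ne_zero h
    | succ m ih =>
      rintro ⟨γ, h1, h2⟩
      refine ih ?_
      let γ0 : Module.Dual K V := γ - γ one • ε
      have hγd : ∀ w, γ0 (d w) = γ (d w) := fun w => by
        simp [γ0, hεd]
      have hγe : ∀ w, γ0 (e w) = 0 := fun w => by simp [γ0, h2, hεe]
      have hγ1 : γ0 one = 0 := by simp [γ0, hε1]
      let φ : Module.Dual K V := (ε ∘ₗ (X ^ m)) ∘ₗ i - γ0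
      have hφ : ∀ w, φ w = ε ((X ^ m) (i w)) - γ0 w := fun w => rfl
      have hφ0 : φ ∈ LinearMap.range (LinearMap.dualMap d) := by
        rw [LinearMap.range_dualMap_eq_dualAnnihilator_ker, Submodule.mem_dualAnnihilator]
        intro w hw
        obtain ⟨c, v, rfl⟩ := hex w hw
        have e1 : φ one = 0 := by rw [hφ, hi1, map_zero, map_zero, hγ1, sub_zero]
        have e2 : φ (d v) = 0 := by
          rw [hφ, hγd, ← h1, pow_succ, Module.End.mul_apply]
          simp only [hX, LinearMap.add_apply, Module.End.mul_apply, map_add]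
          rw [← hX, hXk, hεd]
          ring
        rw [map_add, map_smul, e1, e2, smul_zero, add_zero]
      obtain ⟨γ', hγ'⟩ := hφ0
      have hγ'' : ∀ w, γ' (d w) = φ w := fun w => LinearMap.congr_fun hγ' w
      refine ⟨-(γ' ∘ₗ e), fun w => ?_, fun w => ?_⟩
      · have h3 := hγ'' (e w)
        rw [hφ, hγe, sub_zero, eq_sub_of_add_eq (hie w), map_sub, map_sub, hXek, hεe, sub_zero,
          hde, map_neg] at h3
        rw [← h3]
        rfl
      · rw [LinearMap.neg_apply, LinearMap.comp_apply, hee, map_zero, neg_zero]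
  exact key M ⟨0, fun w => by rw [hM]; rfl, fun w => rfl⟩

variable {K : Type*} [Field K] {g : Type*} [LieRing g] [LieAlgebra K g]

/-- The contraction of the exterior algebra with a linear form. -/
def exteriorContract (α : Module.Dual K g) : Module.End K (ExteriorAlgebra K g) :=
  CliffordAlgebra.contractLeft (Q := (0 : QuadraticForm K g)) α

theorem exteriorContract_ι_mul (α : Module.Dual K g) (y : g) (w : ExteriorAlgebra K g) :
    exteriorContract α (ExteriorAlgebra.ι K y * w) =
      α y • w - ExteriorAlgebra.ι K y * exteriorContract α w :=
  CliffordAlgebra.contractLeft_ι_mul _ _ _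

theorem exteriorContract_algebraMap (α : Module.Dual K g) (r : K) :
    exteriorContract α (algebraMap K _ r) = 0 :=
  CliffordAlgebra.contractLeft_algebraMap (0 : QuadraticForm K g) α r

theorem exteriorContract_comm (α β : Module.Dual K g) (w : ExteriorAlgebra K g) :
    exteriorContract α (exteriorContract β w) = -exteriorContract β (exteriorContract α w) :=
  CliffordAlgebra.contractLeft_comm _ _ _

theorem exteriorContract_zero (w : ExteriorAlgebra K g) :
    exteriorContract (0 : Module.Dual K g) w = 0 := by
  simp [exteriorContract]

theorem exteriorContract_exteriorDerivation (α : Module.Dual K g) (φ : g →ₗ[K] g)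
    (w : ExteriorAlgebra K g) :
    exteriorContract α (exteriorDerivation φ w) =
      exteriorDerivation φ (exteriorContract α w) + exteriorContract (α ∘ₗ φ) w := by
  induction w using exteriorAlgebra_induction with
  | h0 r => simp [exteriorDerivation_algebraMap, exteriorContract_algebraMap]
  | hadd x y hx hy => simp only [map_add, hx, hy]; abel
  | hι w y hw =>
    simp only [exteriorDerivation_ι_mul, map_add, exteriorContract_ι_mul, hw, map_sub, map_smul,
      LinearMap.comp_apply, mul_add]
    abel

theorem map_exteriorContract {g' : Type*} [LieRing g'] [LieAlgebra K g'] (f : g →ₗ[K] g')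
    {α : Module.Dual K g} {β : Module.Dual K g'} (h : ∀ x, β (f x) = α x)
    (w : ExteriorAlgebra K g) :
    ExteriorAlgebra.map f (exteriorContract α w) =
      exteriorContract β (ExteriorAlgebra.map f w) := by
  induction w using exteriorAlgebra_induction with
  | h0 r => simp [exteriorContract_algebraMap]
  | hadd x y hx hy => simp only [map_add, hx, hy]
  | hι w y hw =>
    simp only [exteriorContract_ι_mul, map_sub, map_smul, map_mul, ExteriorAlgebra.map_apply_ι, hw,
      h]

/-- The contraction with the coboundary of a linear form `ζ`. -/
def coboundaryContract (ζ : Module.Dual K g) : Module.End K (ExteriorAlgebra K g) :=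
  ceDifferential K g * exteriorContract ζ + exteriorContract ζ * ceDifferential K g

/-- The linear map `y ↦ ζ ∘ ad y`. -/
def coboundaryForm (ζ : Module.Dual K g) : g →ₗ[K] Module.Dual K g :=
  LinearMap.llcomp K g g K ζ ∘ₗ (LieAlgebra.ad K g : g →ₗ[K] Module.End K g)

theorem coboundaryForm_apply (ζ : Module.Dual K g) (y x : g) :
    coboundaryForm ζ y x = ζ ⁅y, x⁆ := rfl

theorem coboundaryContract_ι_mul (ζ : Module.Dual K g) (y : g) (w : ExteriorAlgebra K g) :
    coboundaryContract ζ (ExteriorAlgebra.ι K y * w) =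
      ExteriorAlgebra.ι K y * coboundaryContract ζ w +
        exteriorContract (coboundaryForm ζ y) w := by
  have h := exteriorContract_exteriorDerivation ζ (LieAlgebra.ad K g y : g →ₗ[K] g) w
  simp only [coboundaryContract, LinearMap.add_apply, Module.End.mul_apply, exteriorContract_ι_mul,
    ceDifferential_ι_mul, map_sub, map_smul, h, mul_add]
  change _ = _ + exteriorContract (ζ ∘ₗ (LieAlgebra.ad K g y : g →ₗ[K] g)) w
  abel

theorem coboundaryContract_algebraMap (ζ : Module.Dual K g) (r : K) :
    coboundaryContract ζ (algebraMap K _ r) = 0 := by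
  simp [coboundaryContract, exteriorContract_algebraMap, ceDifferential_algebraMap]

theorem coboundaryContract_exteriorContract (ζ α : Module.Dual K g) (w : ExteriorAlgebra K g) :
    coboundaryContract ζ (exteriorContract α w) = exteriorContract α (coboundaryContract ζ w) := by
  induction w using exteriorAlgebra_induction with
  | h0 r => simp [exteriorContract_algebraMap, coboundaryContract_algebraMap]
  | hadd x y hx hy => simp only [map_add, hx, hy]
  | hι w y hw =>
    rw [exteriorContract_ι_mul, map_sub, map_smul, coboundaryContract_ι_mul,
      coboundaryContract_ι_mul, map_add, exteriorContract_ι_mul, hw, exteriorContract_comm α]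
    abel

theorem pow_coboundaryContract_ι_mul (ζ : Module.Dual K g) (y : g) (w : ExteriorAlgebra K g)
    (k : ℕ) :
    (coboundaryContract ζ ^ (k + 1)) (ExteriorAlgebra.ι K y * w) =
      ExteriorAlgebra.ι K y * (coboundaryContract ζ ^ (k + 1)) w +
        ((k + 1 : ℕ) : K) •
          exteriorContract (coboundaryForm ζ y) ((coboundaryContract ζ ^ k) w) := by
  induction k with
  | zero => simp [coboundaryContract_ι_mul]
  | succ k ih =>
    have e : ∀ (l : ℕ) (u : ExteriorAlgebra K g), (coboundaryContract ζ ^ (l + 1)) u =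
        coboundaryContract ζ ((coboundaryContract ζ ^ l) u) := fun l u => by
      rw [pow_succ', Module.End.mul_apply]
    rw [e (k + 1), ih, map_add, map_smul, coboundaryContract_ι_mul,
      coboundaryContract_exteriorContract, ← e, ← e]
    push_cast
    module

theorem pow_coboundaryContract_ιMulti (ζ : Module.Dual K g) {n k : ℕ} (hk : n < k) (v : Fin n → g) :
    (coboundaryContract ζ ^ k) (ExteriorAlgebra.ιMulti K n v) = 0 := by
  induction n generalizing k with
  | zero =>
    obtain ⟨k, rfl⟩ := Nat.exists_eq_succ_of_ne_zero (by omega : k ≠ 0)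
    rw [ExteriorAlgebra.ιMulti_zero_apply, ← map_one (algebraMap K _), pow_succ,
      Module.End.mul_apply, coboundaryContract_algebraMap, map_zero]
  | succ n ih =>
    obtain ⟨k, rfl⟩ := Nat.exists_eq_succ_of_ne_zero (by omega : k ≠ 0)
    rw [ExteriorAlgebra.ιMulti_succ_apply, pow_coboundaryContract_ι_mul, ih (by omega),
      ih (by omega), mul_zero, map_zero, smul_zero, add_zero]

theorem map_coboundaryContract (ζ : Module.Dual K g) {π : g →ₗ[K] g}
    (h : ∀ y, coboundaryForm ζ (π y) = coboundaryForm ζ y) (w : ExteriorAlgebra K g) :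
    ExteriorAlgebra.map π (coboundaryContract ζ w) =
      coboundaryContract ζ (ExteriorAlgebra.map π w) := by
  have h' : ∀ y x, coboundaryForm ζ y (π x) = coboundaryForm ζ y x := fun y x => by
    have := LinearMap.congr_fun (h x) y
    rw [coboundaryForm_apply, coboundaryForm_apply, ← lie_skew, ← lie_skew x, map_neg, map_neg,
      neg_inj] at this
    exact this
  induction w using exteriorAlgebra_induction with
  | h0 r => simp [coboundaryContract_algebraMap]
  | hadd x y hx hy => simp only [map_add, hx, hy]
  | hι w y hw =>
    rw [coboundaryContract_ι_mul, map_add, map_mul, map_mul, ExteriorAlgebra.map_apply_ι,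
      coboundaryContract_ι_mul, hw, map_exteriorContract π (h' y), h]

theorem exists_pow_coboundaryContract_eq_zero (ζ : Module.Dual K g)
    {π : g →ₗ[K] g} (hπ : ∀ y, coboundaryForm ζ (π y) = coboundaryForm ζ y)
    [FiniteDimensional K (LinearMap.range π)] :
    ∃ M : ℕ, ∀ w : ExteriorAlgebra K g,
      ExteriorAlgebra.algebraMapInv ((coboundaryContract ζ ^ M) w) = 0 := by
  let N := Module.finrank K (LinearMap.range π)
  have hzero : ∀ w, (coboundaryContract ζ ^ (N + 1)) (ExteriorAlgebra.map π w) = 0 := by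
    intro w
    have hw : w ∈ ⨆ n, ⋀[K]^n g := by
      rw [(DirectSum.Decomposition.isInternal (fun n => ⋀[K]^n g)).submodule_iSup_eq_top]
      trivial
    induction hw using Submodule.iSup_induction' with
    | zero => rw [map_zero, map_zero]
    | add x y _ _ hx hy => rw [map_add, map_add, hx, hy, add_zero]
    | mem n x hx =>
      rw [← ExteriorAlgebra.ιMulti_span_fixedDegree] at hx
      induction hx using Submodule.span_induction with
      | zero => rw [map_zero, map_zero]
      | add x y _ _ hx hy => rw [map_add, map_add, hx, hy, add_zero]
      | smul c x _ hx => rw [map_smul, map_smul, hx, smul_zero]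
      | mem x hx =>
        obtain ⟨v, rfl⟩ := hx
        rw [ExteriorAlgebra.map_apply_ιMulti]
        by_cases hn : n < N + 1
        · exact pow_coboundaryContract_ιMulti ζ hn _
        · rw [AlternatingMap.map_linearDependent (ExteriorAlgebra.ιMulti K (M := g) n), map_zero]
          intro hli
          have e : (π ∘ v : Fin n → g) =
            (LinearMap.range π).subtype ∘ fun i => π.rangeRestrict (v i) := rfl
          rw [e] at hli
          have h2 := (hli.of_comp (LinearMap.range π).subtype).fintype_card_le_finrank
          rw [Fintype.card_fin] at h2
          exact hn (Nat.lt_succ_of_le h2)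
  refine ⟨N + 1, fun w => ?_⟩
  have hcomm : ∀ k w, ExteriorAlgebra.map π ((coboundaryContract ζ ^ k) w) =
      (coboundaryContract ζ ^ k) (ExteriorAlgebra.map π w) := by
    intro k
    induction k with
    | zero => intro w; rfl
    | succ k ih =>
      intro w
      rw [pow_succ, Module.End.mul_apply, ih, map_coboundaryContract ζ hπ, Module.End.mul_apply]
  have hε : ∀ w : ExteriorAlgebra K g, ExteriorAlgebra.algebraMapInv (ExteriorAlgebra.map π w) =
      ExteriorAlgebra.algebraMapInv w := by
    intro w
    have : (ExteriorAlgebra.algebraMapInv.comp (ExteriorAlgebra.map π) :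
        ExteriorAlgebra K g →ₐ[K] K) = ExteriorAlgebra.algebraMapInv := by
      ext x
      simp [ExteriorAlgebra.algebraMapInv]
    exact DFunLike.congr_fun this w
  rw [← hε, hcomm, hzero, map_zero]

theorem algebraMapInv_ι_mul (y : g) (w : ExteriorAlgebra K g) :
    ExteriorAlgebra.algebraMapInv (ExteriorAlgebra.ι K y * w) = 0 := by
  rw [map_mul]
  simp [ExteriorAlgebra.algebraMapInv]

theorem algebraMapInv_exteriorDerivation (φ : g →ₗ[K] g) (w : ExteriorAlgebra K g) :
    ExteriorAlgebra.algebraMapInv (exteriorDerivation φ w) = 0 := by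
  induction w using exteriorAlgebra_induction with
  | h0 r => simp [exteriorDerivation_algebraMap]
  | hadd x y hx hy => rw [map_add, map_add, hx, hy, add_zero]
  | hι w y hw =>
    rw [exteriorDerivation_ι_mul, map_add, algebraMapInv_ι_mul, algebraMapInv_ι_mul, add_zero]

theorem algebraMapInv_ceDifferential (w : ExteriorAlgebra K g) :
    ExteriorAlgebra.algebraMapInv (ceDifferential K g w) = 0 := by
  induction w using exteriorAlgebra_induction with
  | h0 r => simp [ceDifferential_algebraMap]
  | hadd x y hx hy => rw [map_add, map_add, hx, hy, add_zero]
  | hι w y hw =>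
    rw [ceDifferential_ι_mul, map_sub, algebraMapInv_exteriorDerivation, algebraMapInv_ι_mul,
      sub_zero]

/-- If a subcomplex of the Chevalley–Eilenberg complex is acyclic in positive degrees, then
no central element is detected by a linear form whose coboundary has finite rank. -/
theorem not_central_of_acyclic {z : g} (hz : ∀ x : g, ⁅z, x⁆ = 0) {ζ : Module.Dual K g}
    (hζ : ζ z = 1)
    {π : g →ₗ[K] g} (hπ : ∀ y, coboundaryForm ζ (π y) = coboundaryForm ζ y)
    [FiniteDimensional K (LinearMap.range π)]
    (C : Submodule K (ExteriorAlgebra K g)) (h1 : 1 ∈ C)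
    (hd : ∀ w ∈ C, ceDifferential K g w ∈ C) (hi : ∀ w ∈ C, exteriorContract ζ w ∈ C)
    (he : ∀ w ∈ C, ExteriorAlgebra.ι K z * w ∈ C)
    (hex : ∀ w ∈ C, ceDifferential K g w = 0 →
      ∃ (c : K), ∃ v ∈ C, w = algebraMap K _ c + ceDifferential K g v) : False := by
  have hz0 : coboundaryForm ζ z = 0 := LinearMap.ext fun x => by
    rw [coboundaryForm_apply, hz, map_zero]; rfl
  have hadz : exteriorDerivation (LieAlgebra.ad K g z : g →ₗ[K] g) = 0 := by
    have : (LieAlgebra.ad K g z : g →ₗ[K] g) = (0 : K) • LinearMap.id := by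
      ext x; simp [hz]
    rw [this, exteriorDerivation_smul, zero_smul]
  let d : Module.End K C := (ceDifferential K g).restrict hd
  let i : Module.End K C := (exteriorContract ζ).restrict hi
  let e : Module.End K C := (LinearMap.mulLeft K (ExteriorAlgebra.ι K z)).restrict he
  let ε : Module.Dual K C := ExteriorAlgebra.algebraMapInv.toLinearMap ∘ₗ C.subtype
  have hX : ∀ w : C, (((d * i + i * d) w : C) : ExteriorAlgebra K g) = coboundaryContract ζ w :=
    fun w => rfl
  have hXk : ∀ (k : ℕ) (w : C), ((((d * i + i * d) ^ k) w : C) : ExteriorAlgebra K g) =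
      (coboundaryContract ζ ^ k) w := by
    intro k
    induction k with
    | zero => intro w; rfl
    | succ k ih =>
      intro w
      rw [pow_succ, Module.End.mul_apply, ih, hX, pow_succ, Module.End.mul_apply]
  obtain ⟨M, hM⟩ := exists_pow_coboundaryContract_eq_zero ζ hπ
  refine not_exact_of_nilpotent_contraction (d := d) (i := i) (e := e) (ε := ε) (one := ⟨1, h1⟩)
    (fun w => Subtype.ext (ceDifferential_ceDifferential _))
    (fun w => Subtype.ext ?_) (fun w => Subtype.ext ?_) (fun w => Subtype.ext ?_)
    (fun w => Subtype.ext ?_)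
    (fun w => algebraMapInv_ceDifferential _) (fun w => algebraMapInv_ι_mul _ _)
    (map_one ExteriorAlgebra.algebraMapInv)
    (Subtype.ext ?_) (Subtype.ext ?_) (fun w hw => ?_) M (fun w => ?_)
  · change ExteriorAlgebra.ι K z * (ExteriorAlgebra.ι K z * (w : ExteriorAlgebra K g)) = 0
    rw [← mul_assoc, ExteriorAlgebra.ι_sq_zero, zero_mul]
  · change ceDifferential K g (ExteriorAlgebra.ι K z * w) =
      -(ExteriorAlgebra.ι K z * ceDifferential K g w)
    rw [ceDifferential_ι_mul, hadz, LinearMap.zero_apply, zero_sub]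
  · change exteriorContract ζ (ExteriorAlgebra.ι K z * w) +
      ExteriorAlgebra.ι K z * exteriorContract ζ w = w
    rw [exteriorContract_ι_mul, hζ, one_smul, sub_add_cancel]
  · change coboundaryContract ζ (ExteriorAlgebra.ι K z * w) =
      ExteriorAlgebra.ι K z * coboundaryContract ζ w
    rw [coboundaryContract_ι_mul, hz0, exteriorContract_zero, add_zero]
  · change ceDifferential K g 1 = 0
    rw [← map_one (algebraMap K _), ceDifferential_algebraMap]
  · change exteriorContract ζ 1 = 0
    rw [← map_one (algebraMap K _), exteriorContract_algebraMap]
  · obtain ⟨c, v, hv, hw2⟩ := hex w w.2 (congrArg Subtype.val hw)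
    refine ⟨c, ⟨v, hv⟩, Subtype.ext ?_⟩
    rw [hw2, Algebra.algebraMap_eq_smul_one]
    rfl
  · change ExteriorAlgebra.algebraMapInv ((((d * i + i * d) ^ M) w : C) : ExteriorAlgebra K g) = 0
    rw [hXk]
    exact hM _

end CentralElements

section IndependentFamilies

variable {K : Type*} [Field K] {V : Type*} [AddCommGroup V] [Module K V]

theorem le_span_of_iSupIndep {κ ι : Type*} {W : κ → Submodule K V} (hW : iSupIndep W) {v : ι → V}
    {c : ι → κ} (hv : ∀ i, v i ∈ W (c i)) (htop : Submodule.span K (Set.range v) = ⊤) (k : κ) :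
    W k = Submodule.span K (v '' {i | c i = k}) := by
  have hle : ∀ k, Submodule.span K (v '' {i | c i = k}) ≤ W k := by
    intro k
    refine Submodule.span_le.2 ?_
    rintro _ ⟨i, rfl, rfl⟩
    exact hv i
  refine le_antisymm (fun x hx => ?_) (hle k)
  have hx' : x ∈ Submodule.span K (v '' {i | c i = k}) ⊔ ⨆ j ≠ k, W j := by
    have : (⊤ : Submodule K V) ≤ Submodule.span K (v '' {i | c i = k}) ⊔ ⨆ j ≠ k, W j := by
      rw [← htop]
      refine Submodule.span_le.2 ?_
      rintro _ ⟨i, rfl⟩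
      by_cases h : c i = k
      · exact Submodule.mem_sup_left (Submodule.subset_span ⟨i, h, rfl⟩)
      · refine Submodule.mem_sup_right ?_
        exact Submodule.mem_iSup_of_mem (c i) (Submodule.mem_iSup_of_mem h (hv i))
    exact this trivial
  obtain ⟨y, hy, z, hz, rfl⟩ := Submodule.mem_sup.1 hx'
  have hz' : z ∈ W k := by
    have := sub_mem hx (hle k hy)
    rwa [add_sub_cancel_left] at this
  have : z = 0 := Submodule.disjoint_def.1 (hW k) z hz' hz
  rw [this, add_zero]
  exact hy

theorem isInternal_of_iSupIndep {κ ι : Type*} [DecidableEq κ] {W : κ → Submodule K V}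
    (hW : iSupIndep W) {v : ι → V} {c : ι → κ} (hv : ∀ i, v i ∈ W (c i))
    (htop : Submodule.span K (Set.range v) = ⊤) : DirectSum.IsInternal W := by
  rw [DirectSum.isInternal_submodule_iff_iSupIndep_and_iSup_eq_top]
  refine ⟨hW, eq_top_iff.2 ?_⟩
  rw [← htop]
  refine Submodule.span_le.2 ?_
  rintro _ ⟨i, rfl⟩
  exact Submodule.mem_iSup_of_mem (c i) (hv i)

end IndependentFamilies

section Torus

variable {K : Type*} [Field K] {X : Type*} [Fintype X] {V : Type*} [AddCommGroup V] [Module K V]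

/-- The weight space of weight `m` of a family of operators indexed by the torus. -/
def torusWeightSpace (T : (X → Kˣ) → Module.End K V) (m : X →₀ ℕ) : Submodule K V :=
  ⨅ t : X → Kˣ, LinearMap.ker (T t - (∏ i, (t i : K) ^ m i) • LinearMap.id)

theorem mem_torusWeightSpace {T : (X → Kˣ) → Module.End K V} {m : X →₀ ℕ} {v : V} :
    v ∈ torusWeightSpace T m ↔ ∀ t, T t v = (∏ i, (t i : K) ^ m i) • v := by
  rw [torusWeightSpace, Submodule.mem_iInf]
  refine forall_congr' fun t => ?_
  rw [LinearMap.mem_ker, LinearMap.sub_apply, sub_eq_zero]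
  rfl

variable [CharZero K]

theorem two_pow_injective (K : Type*) [Field K] [CharZero K] :
    Function.Injective fun n : ℕ => (2 : K) ^ n := by
  intro a b h
  have h2 : ((2 ^ a : ℕ) : K) = ((2 ^ b : ℕ) : K) := by push_cast; exact h
  exact Nat.pow_right_injective le_rfl (Nat.cast_injective h2)

variable (K) in
/-- The unit `2`. -/
def unitTwo : Kˣ := Units.mk0 2 two_ne_zero

theorem prod_update_two [DecidableEq X] (i : X) (m : X →₀ ℕ) :
    ∏ k, ((Function.update (1 : X → Kˣ) i (unitTwo K) k : Kˣ) : K) ^ m k = 2 ^ m i := by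
  rw [Finset.prod_eq_single i]
  · simp [unitTwo]
  · intro k _ hk
    simp [Function.update_of_ne hk]
  · simp

theorem iSupIndep_torusWeightSpace (T : (X → Kˣ) → Module.End K V) :
    iSupIndep (torusWeightSpace T) := by
  classical
  suffices h : ∀ (s : Finset (X →₀ ℕ)) (m : X →₀ ℕ), m ∉ s →
      Disjoint (torusWeightSpace T m) (s.sup (torusWeightSpace T)) by
    rw [iSupIndep_iff_supIndep]
    intro s
    rw [Finset.supIndep_iff_disjoint_erase]
    exact fun m _ => h _ _ (s.notMem_erase m)
  intro s m
  induction s using Finset.induction_on with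
  | empty => simp
  | insert p s _ ih =>
    intro hm
    rw [Finset.mem_insert, not_or] at hm
    have hdis := ih hm.2
    rw [Submodule.disjoint_def] at hdis ⊢
    intro x hx hx'
    rw [Finset.sup_insert] at hx'
    obtain ⟨y, hy, z, hz, rfl⟩ := Submodule.mem_sup.1 hx'
    obtain ⟨i, hi⟩ := Finsupp.ne_iff.1 hm.1
    let A : Module.End K V := T (Function.update 1 i (unitTwo K))
    have hA : ∀ q v, v ∈ torusWeightSpace T q → A v = (2 : K) ^ q i • v := fun q v hv => by
      rw [mem_torusWeightSpace.1 hv, prod_update_two]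
    have hz' : A z ∈ s.sup (torusWeightSpace T) := by
      rw [Finset.sup_eq_iSup] at hz ⊢
      have hmap : (⨆ q ∈ s, torusWeightSpace T q).map A ≤ ⨆ q ∈ s, torusWeightSpace T q := by
        simp_rw [Submodule.map_iSup]
        refine iSup₂_mono fun q _ => ?_
        rintro _ ⟨v, hv, rfl⟩
        rw [hA q v hv]
        exact Submodule.smul_mem _ _ hv
      exact hmap ⟨z, hz, rfl⟩
    have e1 : A (y + z) - (2 : K) ^ p i • (y + z) = A z - (2 : K) ^ p i • z := by
      rw [map_add, hA p y hy]; module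
    have e2 : A (y + z) - (2 : K) ^ p i • (y + z) = ((2 : K) ^ m i - 2 ^ p i) • (y + z) := by
      rw [hA m _ hx]; module
    have hne : ((2 : K) ^ m i - 2 ^ p i) ≠ 0 := by
      rw [sub_ne_zero]
      exact fun h => hi (two_pow_injective K h)
    refine hdis _ hx ?_
    have h3 : ((2 : K) ^ m i - 2 ^ p i) • (y + z) ∈ s.sup (torusWeightSpace T) := by
      rw [← e2, e1]
      exact sub_mem hz' (Submodule.smul_mem _ _ hz)
    have h4 := Submodule.smul_mem _ ((2 : K) ^ m i - 2 ^ p i)⁻¹ h3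
    rwa [inv_smul_smul₀ hne] at h4

/-- A spanning family of weight vectors with finitely many vectors of each weight. -/
structure IsWeightFamily {ι : Type*} (T : (X → Kˣ) → Module.End K V) (v : ι → V)
    (c : ι → X →₀ ℕ) : Prop where
  mem : ∀ i, v i ∈ torusWeightSpace T (c i)
  span : Submodule.span K (Set.range v) = ⊤
  finite : ∀ m, {i | c i = m}.Finite

namespace IsWeightFamily

variable {ι : Type*} {T : (X → Kˣ) → Module.End K V} {v : ι → V} {c : ι → X →₀ ℕ}

theorem weightSpace_eq (h : IsWeightFamily T v c) (m : X →₀ ℕ) :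
    torusWeightSpace T m = Submodule.span K (v '' {i | c i = m}) :=
  le_span_of_iSupIndep (iSupIndep_torusWeightSpace T) h.mem h.span m

theorem finiteDimensional (h : IsWeightFamily T v c) (m : X →₀ ℕ) :
    FiniteDimensional K (torusWeightSpace T m) := by
  rw [h.weightSpace_eq]
  exact FiniteDimensional.span_of_finite K ((h.finite m).image v)

theorem isInternal (h : IsWeightFamily T v c) [DecidableEq (X →₀ ℕ)] :
    DirectSum.IsInternal (torusWeightSpace T) :=
  isInternal_of_iSupIndep (iSupIndep_torusWeightSpace T) h.mem h.span

/-- A basis of weight vectors. -/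
def basis (h : IsWeightFamily T v c) :
    Module.Basis (Σ m : X →₀ ℕ, Fin (Module.finrank K (torusWeightSpace T m))) K V :=
  open Classical in
  h.isInternal.collectedBasis fun m =>
    haveI := h.finiteDimensional m
    Module.finBasis K (torusWeightSpace T m)

theorem basis_mem (h : IsWeightFamily T v c)
    (i : Σ m : X →₀ ℕ, Fin (Module.finrank K (torusWeightSpace T m))) :
    h.basis i ∈ torusWeightSpace T i.1 := by
  classical
  exact h.isInternal.collectedBasis_mem _ i

theorem basisWeightSpace_eq [DecidableEq (X →₀ ℕ)] (h : IsWeightFamily T v c) (m : X →₀ ℕ) :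
    basisWeightSpace h.basis Sigma.fst m = torusWeightSpace T m := by
  rw [basisWeightSpace_eq_span, le_span_of_iSupIndep (iSupIndep_torusWeightSpace T) h.basis_mem
    h.basis.span_eq m]
  congr 1
  ext x
  simp

end IsWeightFamily

end Torus

section Words

variable (K : Type*) [Field K] {X : Type*}

/-- The multidegree of a non-associative word. -/
def wordContent : FreeMagma X → X →₀ ℕ
  | FreeMagma.of x => Finsupp.single x 1
  | FreeMagma.mul a b => wordContent a + wordContent b

/-- The element of the free Jordan algebra represented by a non-associative word. -/
def word : FreeMagma X → FreeJordan K X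
  | FreeMagma.of x => FreeJordan.of x
  | FreeMagma.mul a b => word a * word b

variable {K}

theorem wordContent_ne_zero (w : FreeMagma X) : wordContent w ≠ 0 := by
  induction w with
  | ih1 x => exact Finsupp.single_ne_zero.2 one_ne_zero
  | ih2 a b ha hb =>
    intro h
    change wordContent a + wordContent b = 0 at h
    exact ha (by simpa using (add_eq_zero.1 h).1)

theorem mk_single (w : FreeMagma X) (r : K) :
    (FreeJordan.mk (MonoidAlgebra.single w r) : FreeJordan K X) = r • word K w := by
  have h1 : ∀ w : FreeMagma X,
      (FreeJordan.mk (MonoidAlgebra.single w (1 : K)) : FreeJordan K X) = word K w := by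
    intro w
    induction w with
    | ih1 x => rfl
    | ih2 a b ha hb =>
      have : (MonoidAlgebra.single (a * b) (1 : K) : FreeNonUnitalNonAssocAlgebra K X) =
          MonoidAlgebra.single a (1 : K) * MonoidAlgebra.single b (1 : K) := by
        rw [MonoidAlgebra.single_mul_single, mul_one]
      rw [this, FreeJordan.mk_mul, ha, hb]
      rfl
  rw [← h1, ← map_smul]
  congr 1
  change _ = r • (MonoidAlgebra.single w (1 : K) : MonoidAlgebra K (FreeMagma X))
  rw [MonoidAlgebra.smul_single, smul_eq_mul, mul_one]

theorem span_word : Submodule.span K (Set.range (word K : FreeMagma X → FreeJordan K X)) = ⊤ := by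
  rw [eq_top_iff]
  rintro a -
  obtain ⟨a, rfl⟩ := FreeJordan.mk_surjective a
  induction a using MonoidAlgebra.induction_linear with
  | zero => rw [map_zero]; exact zero_mem _
  | add f g hf hg => rw [map_add]; exact add_mem hf hg
  | single w r =>
    rw [mk_single]
    exact Submodule.smul_mem _ _ (Submodule.subset_span ⟨w, rfl⟩)

theorem finite_wordContent_eq [DecidableEq X] (m : X →₀ ℕ) :
    {w : FreeMagma X | wordContent w = m}.Finite := by
  induction m using WellFoundedLT.induction with
  | ind m ih =>
    have hfin : (⋃ p ∈ (Finset.HasAntidiagonal.antidiagonal m).filter fun p => p.1 < m ∧ p.2 < m,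
        Set.image2 FreeMagma.mul {w : FreeMagma X | wordContent w = p.1}
          {w : FreeMagma X | wordContent w = p.2}).Finite := by
      refine Set.Finite.biUnion (Finset.finite_toSet _) fun p hp => ?_
      have hp' := (Finset.mem_filter.1 hp).2
      exact Set.Finite.image2 _ (ih _ hp'.1) (ih _ hp'.2)
    have hfin2 : (FreeMagma.of '' (m.support : Set X)).Finite :=
      (Finset.finite_toSet _).image _
    refine (hfin2.union hfin).subset ?_
    rintro w rfl
    rcases w with x | ⟨a, b⟩
    · left
      exact ⟨x, by simp [wordContent], rfl⟩
    · right
      simp only [Set.mem_iUnion]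
      have hs : wordContent (FreeMagma.mul a b) = wordContent a + wordContent b := rfl
      refine ⟨(wordContent a, wordContent b), ?_, a, rfl, b, rfl, rfl⟩
      rw [Finset.mem_filter, Finset.HasAntidiagonal.mem_antidiagonal]
      refine ⟨hs.symm, ?_, ?_⟩
      · rw [hs]
        exact lt_add_of_pos_right _ (pos_iff_ne_zero.2 (wordContent_ne_zero b))
      · rw [hs]
        exact lt_add_of_pos_left _ (pos_iff_ne_zero.2 (wordContent_ne_zero a))

variable (K) in
/-- The diagonal substitution `xᵢ ↦ tᵢ xᵢ`. -/
def scaleHom (t : X → Kˣ) : FreeJordan K X →ₙₐ[K] FreeJordan K X :=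
  FreeJordan.lift fun i => (t i : K) • FreeJordan.of i

variable [Fintype X]

theorem scaleHom_word (t : X → Kˣ) (w : FreeMagma X) :
    scaleHom K t (word K w) = (∏ i, (t i : K) ^ wordContent w i) • word K w := by
  classical
  induction w with
  | ih1 x =>
    change scaleHom K t (FreeJordan.of x) = (∏ i, (t i : K) ^ (Finsupp.single x 1) i) • _
    rw [scaleHom, FreeJordan.lift_of, Finset.prod_eq_single x]
    · simp; rfl
    · intro k _ hk
      simp [hk.symm]
    · simp
  | ih2 a b ha hb =>
    change scaleHom K t (word K a * word K b) =
      (∏ i, (t i : K) ^ (wordContent a + wordContent b) i) • (word K a * word K b)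
    rw [map_mul, ha, hb, smul_mul_smul_comm, ← Finset.prod_mul_distrib]
    simp only [Finsupp.add_apply, pow_add]

variable (K X) in
/-- The action of the torus on the free Jordan algebra. -/
def jordanTorus (t : X → Kˣ) : Module.End K (FreeJordan K X) :=
  (scaleHom K t : FreeJordan K X →ₗ[K] FreeJordan K X)

variable (K X) in
/-- The action of the torus on `ℬ` of the free Jordan algebra. -/
def tagBTorus (t : X → Kˣ) : Module.End K (TagB K (FreeJordan K X)) :=
  tagBMap (scaleHom K t)

variable [CharZero K]

theorem isWeightFamily_word : IsWeightFamily (jordanTorus K X) (word K) wordContent where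
  mem w := mem_torusWeightSpace.2 fun t => scaleHom_word t w
  span := span_word
  finite m := by classical exact finite_wordContent_eq m

theorem tagWedge_mem_torusWeightSpace {a b : FreeJordan K X} {m p : X →₀ ℕ}
    (ha : a ∈ torusWeightSpace (jordanTorus K X) m)
    (hb : b ∈ torusWeightSpace (jordanTorus K X) p) :
    tagWedge K a b ∈ torusWeightSpace (tagBTorus K X) (m + p) := by
  rw [mem_torusWeightSpace] at *
  intro t
  change tagWedge K (jordanTorus K X t a) (jordanTorus K X t b) = _
  rw [ha, hb, map_smul, map_smul, LinearMap.smul_apply, smul_smul, ← Finset.prod_mul_distrib]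
  congr 1
  refine Finset.prod_congr rfl fun i _ => ?_
  rw [Finsupp.add_apply, pow_add, mul_comm]

theorem mul_mem_torusWeightSpace {a b : FreeJordan K X} {m p : X →₀ ℕ}
    (ha : a ∈ torusWeightSpace (jordanTorus K X) m)
    (hb : b ∈ torusWeightSpace (jordanTorus K X) p) :
    a * b ∈ torusWeightSpace (jordanTorus K X) (m + p) := by
  rw [mem_torusWeightSpace] at *
  intro t
  have h : jordanTorus K X t (a * b) = jordanTorus K X t a * jordanTorus K X t b :=
    map_mul (scaleHom K t) a b
  rw [h, ha, hb, smul_mul_smul_comm, ← Finset.prod_mul_distrib]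
  congr 1
  refine Finset.prod_congr rfl fun i _ => ?_
  rw [Finsupp.add_apply, pow_add]

theorem tagPartial_mem_torusWeightSpace {w : TagB K (FreeJordan K X)} {a : FreeJordan K X}
    {m p : X →₀ ℕ} (hw : w ∈ torusWeightSpace (tagBTorus K X) m)
    (ha : a ∈ torusWeightSpace (jordanTorus K X) p) :
    tagPartial K _ w a ∈ torusWeightSpace (jordanTorus K X) (m + p) := by
  rw [mem_torusWeightSpace] at *
  intro t
  have h : jordanTorus K X t (tagPartial K _ w a) =
      tagPartial K _ (tagBTorus K X t w) (jordanTorus K X t a) :=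
    (tagPartial_map (scaleHom K t) w a).symm
  rw [h, hw, ha, map_smul, map_smul, LinearMap.smul_apply, smul_smul, ← Finset.prod_mul_distrib]
  congr 1
  refine Finset.prod_congr rfl fun i _ => ?_
  rw [Finsupp.add_apply, pow_add, mul_comm]

theorem isWeightFamily_tagWedge : IsWeightFamily (tagBTorus K X)
    (fun p : FreeMagma X × FreeMagma X => tagWedge K (word K p.1) (word K p.2))
    (fun p => wordContent p.1 + wordContent p.2) where
  mem p := tagWedge_mem_torusWeightSpace (isWeightFamily_word.mem p.1) (isWeightFamily_word.mem p.2)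
  span := by
    rw [eq_top_iff]
    rintro w -
    induction w using tagB_induction with
    | h0 => exact zero_mem _
    | hadd x y hx hy => exact add_mem hx hy
    | hw a b =>
      have ha : a ∈ Submodule.span K (Set.range (word K : FreeMagma X → FreeJordan K X)) := by
        rw [span_word]; trivial
      have hb : b ∈ Submodule.span K (Set.range (word K : FreeMagma X → FreeJordan K X)) := by
        rw [span_word]; trivial
      induction ha using Submodule.span_induction with
      | zero => rw [map_zero]; exact zero_mem _
      | add x y _ _ hx hy => rw [map_add]; exact add_mem hx hy
      | smul c x _ hx => rw [map_smul]; exact Submodule.smul_mem _ _ hx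
      | mem x hx =>
        obtain ⟨u, rfl⟩ := hx
        induction hb using Submodule.span_induction with
        | zero => rw [map_zero]; exact zero_mem _
        | add x y _ _ hx hy => rw [map_add]; exact add_mem hx hy
        | smul c x _ hx => rw [map_smul]; exact Submodule.smul_mem _ _ hx
        | mem x hx =>
          obtain ⟨v, rfl⟩ := hx
          exact Submodule.subset_span ⟨(u, v), rfl⟩
  finite m := by
    classical
    refine ((Finset.finite_toSet (Finset.HasAntidiagonal.antidiagonal m)).biUnion (t := fun p =>
      {w : FreeMagma X | wordContent w = p.1} ×ˢ {w : FreeMagma X | wordContent w = p.2})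
      (fun p _ => (finite_wordContent_eq p.1).prod (finite_wordContent_eq p.2))).subset ?_
    rintro ⟨u, v⟩ h
    simp only [Set.mem_iUnion]
    exact ⟨(wordContent u, wordContent v), Finset.HasAntidiagonal.mem_antidiagonal.2 h, rfl, rfl⟩

end Words

section TorusOnTAG

variable (K : Type*) [Field K] [CharZero K] (X : Type*) [Fintype X]

theorem torusChar_injective {m p : X →₀ ℕ}
    (h : ∀ t : X → Kˣ, ∏ i, (t i : K) ^ m i = ∏ i, (t i : K) ^ p i) : m = p := by
  classical
  refine Finsupp.ext fun i => two_pow_injective K ?_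
  have := h (Function.update 1 i (unitTwo K))
  rwa [prod_update_two, prod_update_two] at this

/-- The index set of a basis of weight vectors of the free Jordan algebra. -/
abbrev JordanIndex : Type _ :=
  Σ m : X →₀ ℕ, Fin (Module.finrank K (torusWeightSpace (jordanTorus K X) m))

/-- The index set of a basis of weight vectors of `ℬ` of the free Jordan algebra. -/
abbrev TagBIndex : Type _ :=
  Σ m : X →₀ ℕ, Fin (Module.finrank K (torusWeightSpace (tagBTorus K X) m))

/-- The index set of a basis of weight vectors of `sl₂` of the free Jordan algebra. -/
abbrev TAGIndex : Type _ := TagBIndex K X ⊕ (Fin 3 × JordanIndex K X)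

/-- A basis of weight vectors of the free Jordan algebra. -/
abbrev jordanBasis : Module.Basis (JordanIndex K X) K (FreeJordan K X) := isWeightFamily_word.basis

/-- A basis of weight vectors of `ℬ` of the free Jordan algebra. -/
abbrev tagBBasis : Module.Basis (TagBIndex K X) K (TagB K (FreeJordan K X)) :=
  isWeightFamily_tagWedge.basis

/-- A basis of weight vectors of `sl₂` of the free Jordan algebra. -/
abbrev tagBasis : Module.Basis (TAGIndex K X) K (TAG K (FreeJordan K X)) :=
  TAG.basis (tagBBasis K X) (jordanBasis K X)

variable {K X}

/-- The multidegrees of the vectors of `tagBasis`. -/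
def tagDegree : TAGIndex K X → X →₀ ℕ := Sum.elim Sigma.fst fun i => i.2.1

theorem tagDegree_inl (i : TagBIndex K X) : tagDegree (Sum.inl i : TAGIndex K X) = i.1 := rfl

theorem tagDegree_inr (i : Fin 3 × JordanIndex K X) :
    tagDegree (Sum.inr i : TAGIndex K X) = i.2.1 := rfl

theorem TAG.basis_repr_inl {J : Type*} [NonUnitalNonAssocCommRing J] [Module K J]
    [IsScalarTower K J J] [SMulCommClass K J J] {IB IJ : Type*}
    (bB : Module.Basis IB K (TagB K J)) (bJ : Module.Basis IJ K J) (Y : TAG K J) (i : IB) :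
    (TAG.basis bB bJ).repr Y (Sum.inl i) = bB.repr Y.1 i :=
  Module.Basis.prod_repr_inl _ _ _ _

theorem map_scaleHom_tagBasis (t : X → Kˣ) (i : TAGIndex K X) :
    TAG.map (scaleHom K t) (tagBasis K X i) =
      (∏ x, (t x : K) ^ tagDegree i x) • tagBasis K X i := by
  refine TAG.ext ?_ ?_
  · rw [TAG.map_fst, TAG.fst_smul]
    rcases i with i | i
    · rw [TAG.basis_inl_fst]
      exact mem_torusWeightSpace.1 (isWeightFamily_tagWedge.basis_mem i) t
    · rw [TAG.basis_inr_fst, map_zero, smul_zero]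
  · rw [TAG.map_snd, TAG.snd_smul]
    rcases i with i | i
    · rw [TAG.basis_inl_snd, map_zero, smul_zero]
    · rw [TAG.basis_inr_snd, LinearMap.lTensor_tmul, ← TensorProduct.tmul_smul]
      congr 1
      exact mem_torusWeightSpace.1 (isWeightFamily_word.basis_mem i.2) t

theorem lie_tagBasis_mem [DecidableEq (X →₀ ℕ)] (i j : TAGIndex K X) :
    ⁅tagBasis K X i, tagBasis K X j⁆ ∈
      basisWeightSpace (tagBasis K X) tagDegree (tagDegree i + tagDegree j) := by
  intro k hk
  refine torusChar_injective K X fun t => ?_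
  refine eq_of_diagonal (b := tagBasis K X)
    (A := (TAG.map (scaleHom K t) : TAG K (FreeJordan K X) →ₗ[K] TAG K (FreeJordan K X)))
    (c := fun k => ∏ x, (t x : K) ^ tagDegree k x) (map_scaleHom_tagBasis t) ?_ hk
  have h := LieHom.map_lie (TAG.map (scaleHom K t)) (tagBasis K X i) (tagBasis K X j)
  rw [map_scaleHom_tagBasis, map_scaleHom_tagBasis, smul_lie, lie_smul, smul_smul,
    ← Finset.prod_mul_distrib] at h
  refine h.trans ?_
  congr 1
  refine Finset.prod_congr rfl fun x _ => ?_
  rw [Finsupp.add_apply, pow_add]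

theorem finite_tagDegree_le (m : X →₀ ℕ) : {i : TAGIndex K X | tagDegree i ≤ m}.Finite := by
  classical
  let S1 : Finset (TagBIndex K X) := (Finset.Iic m).sigma fun _ => Finset.univ
  let S2 : Finset (JordanIndex K X) := (Finset.Iic m).sigma fun _ => Finset.univ
  refine (Finset.finite_toSet (S1.disjSum (Finset.univ ×ˢ S2))).subset ?_
  rintro (i | ⟨k, i⟩) h
  · exact Finset.inl_mem_disjSum.2 (Finset.mem_sigma.2 ⟨Finset.mem_Iic.2 h, Finset.mem_univ _⟩)
  · exact Finset.inr_mem_disjSum.2 (Finset.mem_product.2 ⟨Finset.mem_univ _,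
      Finset.mem_sigma.2 ⟨Finset.mem_Iic.2 h, Finset.mem_univ _⟩⟩)

theorem TAG.lie_eq_zero_of_tagPartial_eq_zero {J : Type*} [NonUnitalNonAssocCommRing J]
    [Module K J] [IsScalarTower K J J] [SMulCommClass K J J] [IsCommJordan J] {w : TagB K J}
    (hw : tagPartial K J w = 0) {z : TAG K J} (h1 : z.1 = w) (h2 : z.2 = 0) (Y : TAG K J) :
    ⁅z, Y⁆ = 0 := by
  refine TAG.ext ?_ ?_
  · rw [TAG.lie_fst, h1, h2, map_zero, LinearMap.zero_apply, add_zero]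
    change _ = (0 : TagB K J)
    generalize Y.1 = u
    induction u using tagB_induction with
    | h0 => rw [map_zero]
    | hadd x y hx hy => rw [map_add, hx, hy, add_zero]
    | hw a b => rw [tagAction_wedge, hw]; simp
  · rw [TAG.lie_snd, h1, h2, map_zero, LinearMap.zero_apply, map_zero, zero_add, sub_zero]
    change _ = (0 : Sl2 K ⊗[K] J)
    generalize Y.2 = u
    induction u using TensorProduct.induction_on with
    | zero => rw [map_zero]
    | add x y hx hy => rw [map_add, hx, hy, add_zero]
    | tmul x a => rw [TAG.actSl_tmul, hw, LinearMap.zero_apply, TensorProduct.tmul_zero]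

/-- If the invariant part of the Chevalley–Eilenberg complex is acyclic, the elements of `ℬ` act
faithfully on the free Jordan algebra. -/
theorem tagPartial_injective (hJ : InvariantsAcyclic K (FreeJordan K X)) :
    Function.Injective (tagPartial K (FreeJordan K X)) := by
  classical
  rw [← LinearMap.ker_eq_bot, eq_bot_iff]
  intro w hw
  rw [LinearMap.mem_ker] at hw
  rw [Submodule.mem_bot]
  by_contra hne
  obtain ⟨i, hi⟩ : ∃ i, (tagBBasis K X).repr w i ≠ 0 := by
    by_contra! h
    exact hne ((tagBBasis K X).ext_elem fun i => by rw [h, map_zero]; rfl)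
  set m := i.1 with hm
  let u := weightProj (tagBBasis K X) Sigma.fst m w
  have hui : (tagBBasis K X).repr u i = (tagBBasis K X).repr w i := by
    rw [repr_weightProj, if_pos rfl]
  have hu : tagPartial K (FreeJordan K X) u = 0 := by
    refine (jordanBasis K X).ext fun k => ?_
    have h := weightProj_comm (b := tagBBasis K X) (b' := jordanBasis K X) (wt := Sigma.fst)
      (wt' := Sigma.fst) (Q := (tagPartial K (FreeJordan K X)).flip (jordanBasis K X k))
      (s := fun p => p + k.1) (add_left_injective _) (fun i => by
        rw [IsWeightFamily.basisWeightSpace_eq]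
        exact tagPartial_mem_torusWeightSpace (isWeightFamily_tagWedge.basis_mem i)
          (isWeightFamily_word.basis_mem k)) m w
    rw [LinearMap.flip_apply, hw, LinearMap.zero_apply, map_zero, LinearMap.flip_apply] at h
    exact h.symm
  let z : TAG K (FreeJordan K X) := (u, 0)
  let ζ : Module.Dual K (TAG K (FreeJordan K X)) :=
    ((tagBBasis K X).repr w i)⁻¹ • (tagBasis K X).coord (Sum.inl i)
  have hζ : ∀ Y, ζ Y = ((tagBBasis K X).repr w i)⁻¹ * (tagBasis K X).repr Y (Sum.inl i) :=
    fun Y => rfl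
  let π : TAG K (FreeJordan K X) →ₗ[K] TAG K (FreeJordan K X) :=
    (tagBasis K X).constr K fun k => if tagDegree k ≤ m then tagBasis K X k else 0
  have : FiniteDimensional K (LinearMap.range π) := by
    have hfin := FiniteDimensional.span_of_finite K
      ((finite_tagDegree_le (K := K) m).image (tagBasis K X))
    refine Submodule.finiteDimensional_of_le (S₂ := Submodule.span K
      (tagBasis K X '' {i | tagDegree i ≤ m})) ?_
    rw [Module.Basis.constr_range]
    refine Submodule.span_le.2 ?_
    rintro _ ⟨k, rfl⟩
    dsimp only
    split_ifs with h
    · exact Submodule.subset_span ⟨k, h, rfl⟩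
    · exact zero_mem _
  have hz1 : ζ z = 1 := by
    rw [hζ, TAG.basis_repr_inl]
    change _ * (tagBBasis K X).repr u i = 1
    rw [hui, inv_mul_cancel₀ hi]
  have hζx : ∀ x : Sl2 K, ζ ∘ₗ TAG.sl2Endo x = 0 := fun x => LinearMap.ext fun Y => by
    rw [LinearMap.comp_apply, hζ, TAG.basis_repr_inl, TAG.sl2Endo_fst, map_zero]
    simp
  refine not_central_of_acyclic (z := z) (TAG.lie_eq_zero_of_tagPartial_eq_zero hu rfl rfl) hz1
    (π := π) (fun y => ?_) (⨅ x : Sl2 K, LinearMap.ker (TAG.sl2Ext (FreeJordan K X) x))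
    ?_ ?_ ?_ ?_ ?_
  · have : coboundaryForm ζ ∘ₗ π = coboundaryForm ζ := by
      refine (tagBasis K X).ext fun k => ?_
      rw [LinearMap.comp_apply, Module.Basis.constr_basis]
      split_ifs with hk
      · rfl
      · rw [map_zero]
        refine (tagBasis K X).ext fun l => ?_
        rw [coboundaryForm_apply, LinearMap.zero_apply, hζ]
        by_cases h : (tagBasis K X).repr ⁅tagBasis K X k, tagBasis K X l⁆ (Sum.inl i) = 0
        · rw [h, mul_zero]
        · have h2 := lie_tagBasis_mem k l _ h
          rw [tagDegree_inl, ← hm] at h2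
          exact absurd (h2 ▸ le_self_add) hk
    exact LinearMap.congr_fun this y
  · simp only [Submodule.mem_iInf, LinearMap.mem_ker]
    intro x
    rw [← map_one (algebraMap K _)]
    exact exteriorDerivation_algebraMap _ _
  · intro v hv
    simp only [Submodule.mem_iInf, LinearMap.mem_ker] at hv ⊢
    intro x
    rw [← TAG.ceDifferential_sl2Ext, hv, map_zero]
  · intro v hv
    simp only [Submodule.mem_iInf, LinearMap.mem_ker] at hv ⊢
    intro x
    have h := exteriorContract_exteriorDerivation ζ (TAG.sl2Endo x) v
    rw [hζx, exteriorContract_zero, add_zero] at h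
    have h2 := hv x
    unfold TAG.sl2Ext at h2 ⊢
    rw [← h, h2, map_zero]
  · intro v hv
    simp only [Submodule.mem_iInf, LinearMap.mem_ker] at hv ⊢
    intro x
    have h2 := hv x
    unfold TAG.sl2Ext at h2 ⊢
    have h3 : TAG.sl2Endo x z = 0 := TAG.ext rfl (by
      rw [TAG.sl2Endo_snd]
      change _ = (0 : Sl2 K ⊗[K] FreeJordan K X)
      exact map_zero _)
    rw [exteriorDerivation_ι_mul, h2, h3, map_zero, zero_mul, mul_zero, add_zero]
  · intro v hv hdv
    simp only [Submodule.mem_iInf, LinearMap.mem_ker] at hv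
    obtain ⟨c, v', h1, h2⟩ := hJ.exists_invariant hdv hv
    exact ⟨c, v', by simpa only [Submodule.mem_iInf, LinearMap.mem_ker] using h1, h2⟩

end TorusOnTAG

section Euler

variable (K : Type*) [Field K] [CharZero K] (X : Type*) [Fintype X]

/-- The vectors of `tagBasis` of degree `≤ n`. -/
def tagIndicesLE (n : X →₀ ℕ) : Finset (TAGIndex K X) := (finite_tagDegree_le n).toFinset

/-- The alternating sum of the dimensions of the weight spaces of weight `(n, j)` in the
exterior powers of `sl₂` of the free Jordan algebra. -/
def tagEuler (n : X →₀ ℕ) (j : ℤ) : ℤ :=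
  open Classical in
  ∑ S ∈ (tagIndicesLE K X n).powerset with
    ∑ i ∈ S, tagDegree i = n ∧ ∑ i ∈ S, TAG.basisSl2Weight i = j, (-1) ^ S.card

variable {K X}

theorem mem_tagIndicesLE {n : X →₀ ℕ} {i : TAGIndex K X} :
    i ∈ tagIndicesLE K X n ↔ tagDegree i ≤ n := Set.Finite.mem_toFinset _

/-- The parity, the multidegree, and the `sl₂`-weight of a basis vector of the exterior algebra. -/
def exteriorWeight (S : Finset (TAGIndex K X)) : Bool × (X →₀ ℕ) × ℤ :=
  (decide (Odd S.card), ∑ i ∈ S, tagDegree i, ∑ i ∈ S, TAG.basisSl2Weight i)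

theorem exteriorWeight_eq_iff {S : Finset (TAGIndex K X)} {e : Bool} {n : X →₀ ℕ} {j : ℤ} :
    exteriorWeight S = (e, n, j) ↔ decide (Odd S.card) = e ∧ ∑ i ∈ S, tagDegree i = n ∧
      ∑ i ∈ S, TAG.basisSl2Weight i = j := by
  rw [exteriorWeight, Prod.mk.injEq, Prod.mk.injEq]

theorem subset_tagIndicesLE {S : Finset (TAGIndex K X)} {n : X →₀ ℕ}
    (h : ∑ i ∈ S, tagDegree i = n) : S ⊆ tagIndicesLE K X n := fun i hi => by
  rw [mem_tagIndicesLE, ← h]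
  exact Finset.single_le_sum (f := tagDegree) (fun _ _ => zero_le) hi

theorem finite_exteriorWeight (p : Bool × (X →₀ ℕ) × ℤ) :
    {S : Finset (TAGIndex K X) | exteriorWeight S = p}.Finite := by
  classical
  refine (Finset.finite_toSet (tagIndicesLE K X p.2.1).powerset).subset fun S hS => ?_
  exact Finset.mem_powerset.2 (subset_tagIndicesLE (exteriorWeight_eq_iff.1 hS).2.1)

theorem tagEuler_eq_card_sub_card (n : X →₀ ℕ) (j : ℤ) :
    tagEuler K X n j =
      (Nat.card {S : Finset (TAGIndex K X) // exteriorWeight S = (false, n, j)} : ℤ) -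
        Nat.card {S : Finset (TAGIndex K X) // exteriorWeight S = (true, n, j)} := by
  classical
  have key : ∀ e : Bool,
      Nat.card {S : Finset (TAGIndex K X) // exteriorWeight S = (e, n, j)} =
      (((tagIndicesLE K X n).powerset.filter fun S => ∑ i ∈ S, tagDegree i = n ∧
        ∑ i ∈ S, TAG.basisSl2Weight i = j).filter fun S => decide (Odd S.card) = e).card := by
    intro e
    refine Nat.subtype_card _ fun S => ?_
    rw [Finset.mem_filter, Finset.mem_filter, Finset.mem_powerset, exteriorWeight_eq_iff]
    exact ⟨fun h => ⟨h.2, h.1.2⟩, fun h => ⟨⟨subset_tagIndicesLE h.2.1, h.2⟩, h.1⟩⟩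
  rw [key, key, tagEuler]
  generalize ((tagIndicesLE K X n).powerset.filter fun S => ∑ i ∈ S, tagDegree i = n ∧
    ∑ i ∈ S, TAG.basisSl2Weight i = j) = F
  rw [← Finset.sum_filter_add_sum_filter_not F (fun S => decide (Odd S.card) = false),
    sub_eq_add_neg]
  congr 1
  · rw [Finset.cast_card]
    refine Finset.sum_congr rfl fun S hS => ?_
    have h := (Finset.mem_filter.1 hS).2
    rw [decide_eq_false_iff_not, Nat.not_odd_iff_even] at h
    exact h.neg_one_pow
  · rw [Finset.cast_card, ← Finset.sum_neg_distrib]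
    have e : F.filter (fun S => ¬ decide (Odd S.card) = false) =
        F.filter fun S => decide (Odd S.card) = true :=
      Finset.filter_congr fun S _ => by simp
    rw [e]
    refine Finset.sum_congr rfl fun S hS => ?_
    have h := (Finset.mem_filter.1 hS).2
    rw [decide_eq_true_iff] at h
    exact h.neg_one_pow

section Ordered

variable [LinearOrder (TAGIndex K X)]

theorem mem_exteriorWeightSpace {e : Bool} {n : X →₀ ℕ} {j : ℤ}
    {w : ExteriorAlgebra K (TAG K (FreeJordan K X))} :
    w ∈ basisWeightSpace (tagBasis K X).ExteriorAlgebra exteriorWeight (e, n, j) ↔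
      exteriorParity K _ w = (if e then (-1 : K) else 1) • w ∧
      (∀ t : X → Kˣ, ExteriorAlgebra.map (TAG.map (scaleHom K t) :
        TAG K (FreeJordan K X) →ₗ[K] TAG K (FreeJordan K X)) w = (∏ x, (t x : K) ^ n x) • w) ∧
      TAG.sl2Ext (FreeJordan K X) (sl2H K) w = ((2 * j : ℤ) : K) • w := by
  classical
  have h1 : ∀ S, exteriorParity K _ ((tagBasis K X).ExteriorAlgebra S) =
      (if (exteriorWeight S).1 then (-1 : K) else 1) • (tagBasis K X).ExteriorAlgebra S :=
      fun S => by
    rw [exteriorParity_basis]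
    congr 1
    by_cases h : Odd S.card
    · simp [exteriorWeight, h, h.neg_one_pow]
    · simp [exteriorWeight, h, (Nat.not_odd_iff_even.1 h).neg_one_pow]
  have h2 : ∀ (t : X → Kˣ) S, (ExteriorAlgebra.map (TAG.map (scaleHom K t) :
        TAG K (FreeJordan K X) →ₗ[K] TAG K (FreeJordan K X))).toLinearMap
          ((tagBasis K X).ExteriorAlgebra S) =
      (∏ x, (t x : K) ^ (exteriorWeight S).2.1 x) • (tagBasis K X).ExteriorAlgebra S :=
      fun t S => by
    refine (map_basis (tagBasis K X) _ _ (map_scaleHom_tagBasis t) S).trans ?_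
    congr 1
    rw [Finset.prod_comm]
    refine Finset.prod_congr rfl fun x _ => ?_
    rw [exteriorWeight, Finsupp.finsetSum_apply, Finset.prod_pow_eq_pow_sum]
  have h3 : ∀ S, TAG.sl2Ext (FreeJordan K X) (sl2H K) ((tagBasis K X).ExteriorAlgebra S) =
      ((2 * (exteriorWeight S).2.2 : ℤ) : K) • (tagBasis K X).ExteriorAlgebra S :=
      fun S => by
    rw [TAG.sl2Ext, exteriorDerivation_basis (tagBasis K X) _ _ (TAG.sl2Endo_h_basis _ _)]
    congr 1
    rw [exteriorWeight, Finset.mul_sum]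
    push_cast
    rfl
  constructor
  · intro hw
    refine ⟨eigen_of_mem (c := fun p : Bool × (X →₀ ℕ) × ℤ => if p.1 then (-1 : K) else 1) h1 hw,
      fun t => ?_,
      eigen_of_mem (c := fun p : Bool × (X →₀ ℕ) × ℤ => ((2 * p.2.2 : ℤ) : K)) h3 hw⟩
    exact eigen_of_mem (c := fun p : Bool × (X →₀ ℕ) × ℤ => ∏ x, (t x : K) ^ p.2.1 x) (h2 t) hw
  · rintro ⟨e1, e2, e3⟩ S hS
    have f1 := eq_of_diagonal h1 e1 hS
    have f2 := fun t => eq_of_diagonal (h2 t) (e2 t) hS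
    have f3 := eq_of_diagonal h3 e3 hS
    refine Prod.ext ?_ (Prod.ext (torusChar_injective K X f2) ?_)
    · have hne : (-1 : K) ≠ 1 := by norm_num
      dsimp only at f1 ⊢
      generalize (exteriorWeight S).1 = e' at f1 ⊢
      cases e <;> cases e'
      · rfl
      · exact absurd f1 hne
      · exact absurd f1.symm hne
      · rfl
    · have : (2 * (exteriorWeight S).2.2 : ℤ) = 2 * j := by exact_mod_cast f3
      change (exteriorWeight S).2.2 = j
      omega

/-- The map of exterior algebras induced by a diagonal substitution commutes with `sl₂`. -/
theorem map_scaleHom_sl2Ext (t : X → Kˣ) (x : Sl2 K)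
    (w : ExteriorAlgebra K (TAG K (FreeJordan K X))) :
    ExteriorAlgebra.map (TAG.map (scaleHom K t) :
        TAG K (FreeJordan K X) →ₗ[K] TAG K (FreeJordan K X)) (TAG.sl2Ext _ x w) =
      TAG.sl2Ext _ x (ExteriorAlgebra.map (TAG.map (scaleHom K t) :
        TAG K (FreeJordan K X) →ₗ[K] TAG K (FreeJordan K X)) w) := by
  have h := map_exteriorDerivation (φ := TAG.sl2Endo x) (ψ := TAG.sl2Endo x)
    (TAG.map (scaleHom K t) : TAG K (FreeJordan K X) →ₗ[K] TAG K (FreeJordan K X))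
    (fun Y => TAG.map_sl2Der (scaleHom K t) x Y) w
  unfold TAG.sl2Ext
  exact h

theorem sl2Ext_e_mem {e : Bool} {n : X →₀ ℕ} {j : ℤ}
    {w : ExteriorAlgebra K (TAG K (FreeJordan K X))}
    (hw : w ∈ basisWeightSpace (tagBasis K X).ExteriorAlgebra exteriorWeight (e, n, j)) :
    TAG.sl2Ext _ (sl2E K) w ∈
      basisWeightSpace (tagBasis K X).ExteriorAlgebra exteriorWeight (e, n, j + 1) := by
  rw [mem_exteriorWeightSpace] at hw ⊢
  obtain ⟨h1, h2, h3⟩ := hw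
  refine ⟨?_, fun t => ?_, ?_⟩
  · rw [TAG.sl2Ext, exteriorParity_exteriorDerivation, h1, map_smul]
  · rw [map_scaleHom_sl2Ext, h2, map_smul]
  · rw [TAG.sl2Ext_relations.lie_h_e, h3, map_smul]
    push_cast
    module

theorem sl2Ext_f_mem {e : Bool} {n : X →₀ ℕ} {j : ℤ}
    {w : ExteriorAlgebra K (TAG K (FreeJordan K X))}
    (hw : w ∈ basisWeightSpace (tagBasis K X).ExteriorAlgebra exteriorWeight (e, n, j)) :
    TAG.sl2Ext _ (sl2F K) w ∈
      basisWeightSpace (tagBasis K X).ExteriorAlgebra exteriorWeight (e, n, j - 1) := by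
  rw [mem_exteriorWeightSpace] at hw ⊢
  obtain ⟨h1, h2, h3⟩ := hw
  refine ⟨?_, fun t => ?_, ?_⟩
  · rw [TAG.sl2Ext, exteriorParity_exteriorDerivation, h1, map_smul]
  · rw [map_scaleHom_sl2Ext, h2, map_smul]
  · rw [TAG.sl2Ext_relations.lie_h_f, h3, map_smul]
    push_cast
    module

theorem ceDifferential_mem_exteriorWeightSpace {e : Bool} {n : X →₀ ℕ} {j : ℤ}
    {w : ExteriorAlgebra K (TAG K (FreeJordan K X))}
    (hw : w ∈ basisWeightSpace (tagBasis K X).ExteriorAlgebra exteriorWeight (e, n, j)) :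
    ceDifferential K _ w ∈
      basisWeightSpace (tagBasis K X).ExteriorAlgebra exteriorWeight (!e, n, j) := by
  rw [mem_exteriorWeightSpace] at hw ⊢
  obtain ⟨h1, h2, h3⟩ := hw
  refine ⟨?_, fun t => ?_, ?_⟩
  · rw [exteriorParity_ceDifferential, h1, map_smul, ← neg_smul]
    congr 1
    cases e <;> simp
  · have h := map_ceDifferential (TAG.map (scaleHom K t)) w
    rw [h2, map_smul] at h
    exact h
  · rw [← TAG.ceDifferential_sl2Ext, h3, map_smul]

theorem algebraMap_mem_exteriorWeightSpace (c : K) :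
    algebraMap K (ExteriorAlgebra K (TAG K (FreeJordan K X))) c ∈
      basisWeightSpace (tagBasis K X).ExteriorAlgebra exteriorWeight (false, 0, 0) := by
  rw [mem_exteriorWeightSpace]
  refine ⟨?_, fun t => ?_, ?_⟩
  · rw [exteriorParity_algebraMap]; simp
  · rw [AlgHom.commutes]; simp
  · rw [TAG.sl2Ext, exteriorDerivation_algebraMap]; simp

end Ordered

/-- If the invariant part of the Chevalley–Eilenberg complex of `sl₂` of the free Jordan algebra is
acyclic, its Euler characteristic vanishes in each nonzero multidegree. -/
theorem tagEuler_zero_eq_one (hJ : InvariantsAcyclic K (FreeJordan K X)) {n : X →₀ ℕ}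
    (hn : n ≠ 0) : tagEuler K X n 0 = tagEuler K X n 1 := by
  classical
  let _ : LinearOrder (TAGIndex K X) := linearOrderOfSTO WellOrderingRel
  let W : Bool → ℤ → Submodule K (ExteriorAlgebra K (TAG K (FreeJordan K X))) := fun e j =>
    basisWeightSpace (tagBasis K X).ExteriorAlgebra exteriorWeight (e, n, j)
  have hfin : ∀ e j, FiniteDimensional K (W e j) := fun e j => by
    have : Finite {S : Finset (TAGIndex K X) // exteriorWeight S = (e, n, j)} :=
      finite_exteriorWeight (e, n, j)
    exact finiteDimensional_basisWeightSpace _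
  have hfA : ∀ e, FiniteDimensional K (W e 0) := fun e => hfin e 0
  have key := finrank_add_finrank_eq (A := fun e => W e 0) (B := fun e => W e 1)
    (E := TAG.sl2Ext _ (sl2E K)) (d := ceDifferential K _) (fun e => ?_) (fun e w hw hE => ?_)
    (fun e w hw hE hd => ?_) ceDifferential_ceDifferential
  · simp only [W, finrank_basisWeightSpace] at key
    rw [tagEuler_eq_card_sub_card, tagEuler_eq_card_sub_card]
    omega
  · refine le_antisymm ?_ fun w hw => ?_
    · rintro _ ⟨w, hw, rfl⟩
      exact sl2Ext_e_mem hw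
    · obtain ⟨k, hk⟩ := TAG.sl2Ext_e_locally_nilpotent w
      have hl : ∀ k : ℕ, ((k + 1) * ((2 : K) + k) : K) ≠ 0 := fun k => by
        exact_mod_cast Sl2Relations.weight_ne_zero (K := K) (lam := 2) (by norm_num) k
      obtain ⟨u, hu, huw⟩ := TAG.sl2Ext_relations.exists_ef_eq (S := W e 1) hl
        (fun w hw => by
          rw [(mem_exteriorWeightSpace.1 hw).2.2]
          norm_num)
        (fun w hw => by
          have := sl2Ext_e_mem (sl2Ext_f_mem hw)
          rwa [sub_add_cancel] at this) k w hw hk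
      exact ⟨_, by simpa using sl2Ext_f_mem hu, huw⟩
  · exact ⟨ceDifferential_mem_exteriorWeightSpace hw, by
      rw [← TAG.ceDifferential_sl2Ext, hE, map_zero]⟩
  · have hH : TAG.sl2Ext _ (sl2H K) w = 0 := by
      rw [(mem_exteriorWeightSpace.1 hw).2.2]
      simp
    obtain ⟨k, hk⟩ := TAG.sl2Ext_f_locally_nilpotent w
    have hF := TAG.sl2Ext_relations.f_eq_zero hH hE k hk
    obtain ⟨c, v, hv, hcv⟩ := hJ.exists_invariant hd (TAG.sl2Ext_eq_zero hE hF hH)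
    refine ⟨weightProj (tagBasis K X).ExteriorAlgebra exteriorWeight (!e, n, 0) v,
      weightProj_mem _ _ _ _, ?_, ?_⟩
    · have h := weightProj_comm (b := (tagBasis K X).ExteriorAlgebra) (wt := exteriorWeight)
        (b' := (tagBasis K X).ExteriorAlgebra) (wt' := exteriorWeight)
        (Q := TAG.sl2Ext _ (sl2E K))
        (s := fun p : Bool × (X →₀ ℕ) × ℤ => (p.1, p.2.1, p.2.2 + 1))
        (fun p q h => by
          simp only [Prod.mk.injEq, add_left_inj] at h
          exact Prod.ext h.1 (Prod.ext h.2.1 h.2.2))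
        (fun S => sl2Ext_e_mem (basis_mem_weightSpace _ _ S)) (!e, n, 0) v
      rw [hv, map_zero] at h
      exact h.symm
    · have h := weightProj_comm (b := (tagBasis K X).ExteriorAlgebra) (wt := exteriorWeight)
        (b' := (tagBasis K X).ExteriorAlgebra) (wt' := exteriorWeight)
        (Q := ceDifferential K _)
        (s := fun p : Bool × (X →₀ ℕ) × ℤ => (!p.1, p.2.1, p.2.2))
        (fun p q h => by
          simp only [Prod.mk.injEq, Bool.not_inj_iff] at h
          exact Prod.ext h.1 (Prod.ext h.2.1 h.2.2))
        (fun S => ceDifferential_mem_exteriorWeightSpace (basis_mem_weightSpace _ _ S)) (!e, n, 0) v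
      rw [← h]
      have h2 := congrArg
        (weightProj (tagBasis K X).ExteriorAlgebra exteriorWeight (e, n, 0)) hcv
      rw [weightProj_of_mem hw, map_add, weightProj_of_mem_ne
        (algebraMap_mem_exteriorWeightSpace c) (fun h => hn (by
          simp only [Prod.mk.injEq] at h
          exact h.2.1.symm)), zero_add] at h2
      dsimp only
      rw [Bool.not_not]
      exact h2.symm

end Euler

section PowerSeries

variable {σ R : Type*} [CommRing R]

/-- Two power series have the same coefficients in the degrees `≤ n`. -/
def AgreeLE (n : σ →₀ ℕ) (f g : MvPowerSeries σ R) : Prop :=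
  ∀ k ≤ n, MvPowerSeries.coeff k f = MvPowerSeries.coeff k g

theorem AgreeLE.refl (n : σ →₀ ℕ) (f : MvPowerSeries σ R) : AgreeLE n f f := fun _ _ => rfl

theorem AgreeLE.trans {n : σ →₀ ℕ} {f g e : MvPowerSeries σ R} (h : AgreeLE n f g)
    (h' : AgreeLE n g e) : AgreeLE n f e := fun k hk => (h k hk).trans (h' k hk)

theorem AgreeLE.mul {n : σ →₀ ℕ} {f g f' g' : MvPowerSeries σ R} (h : AgreeLE n f f')
    (h' : AgreeLE n g g') : AgreeLE n (f * g) (f' * g') := by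
  classical
  intro k hk
  rw [MvPowerSeries.coeff_mul, MvPowerSeries.coeff_mul]
  refine Finset.sum_congr rfl fun p hp => ?_
  have hp' := Finset.HasAntidiagonal.mem_antidiagonal.1 hp
  rw [h p.1 ((hp' ▸ le_self_add).trans hk), h' p.2 ((hp' ▸ le_add_self).trans hk)]

theorem AgreeLE.prod {ι : Type*} {n : σ →₀ ℕ} (F : Finset ι) {f g : ι → MvPowerSeries σ R}
    (h : ∀ i ∈ F, AgreeLE n (f i) (g i)) : AgreeLE n (∏ i ∈ F, f i) (∏ i ∈ F, g i) := by
  classical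
  induction F using Finset.induction_on with
  | empty => exact AgreeLE.refl _ _
  | insert i F hi ih =>
    rw [Finset.prod_insert hi, Finset.prod_insert hi]
    exact (h i (Finset.mem_insert_self i F)).mul
      (ih fun j hj => h j (Finset.mem_insert_of_mem hj))

theorem agreeLE_one_sub_monomial {n d : σ →₀ ℕ} (h : ¬ d ≤ n) (c : R) :
    AgreeLE n (1 - MvPowerSeries.monomial d c) 1 := by
  classical
  intro k hk
  rw [map_sub, MvPowerSeries.coeff_monomial, if_neg, sub_zero]
  rintro rfl
  exact h hk

/-- `f` has no term of degree `< n`. -/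
def VanishLT (n : σ →₀ ℕ) (f : MvPowerSeries σ R) : Prop :=
  ∀ k < n, MvPowerSeries.coeff k f = 0

theorem VanishLT.mul_right {n : σ →₀ ℕ} {f : MvPowerSeries σ R} (h : VanishLT n f)
    (g : MvPowerSeries σ R) : VanishLT n (f * g) := by
  classical
  intro k hk
  rw [MvPowerSeries.coeff_mul]
  refine Finset.sum_eq_zero fun p hp => ?_
  have hp' := Finset.HasAntidiagonal.mem_antidiagonal.1 hp
  rw [h p.1 ((hp' ▸ le_self_add : p.1 ≤ k).trans_lt hk), zero_mul]

theorem VanishLT.sub {n : σ →₀ ℕ} {f g : MvPowerSeries σ R} (hf : VanishLT n f)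
    (hg : VanishLT n g) : VanishLT n (f - g) := fun k hk => by
  rw [map_sub, hf k hk, hg k hk, sub_zero]

theorem VanishLT.coeff_mul {n : σ →₀ ℕ} {f : MvPowerSeries σ R} (h : VanishLT n f)
    (g : MvPowerSeries σ R) : MvPowerSeries.coeff n (f * g) =
      MvPowerSeries.coeff n f * MvPowerSeries.constantCoeff g := by
  classical
  rw [MvPowerSeries.coeff_mul, Finset.sum_eq_single (n, 0)]
  · rfl
  · intro p hp hne
    have hp' := Finset.HasAntidiagonal.mem_antidiagonal.1 hp
    have hle : p.1 ≤ n := hp' ▸ le_self_add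
    rw [h p.1 (lt_of_le_of_ne hle fun h1 => hne ?_), zero_mul]
    refine Prod.ext h1 ?_
    rw [h1] at hp'
    exact left_eq_add.1 hp'.symm
  · intro hn
    exact absurd (Finset.HasAntidiagonal.mem_antidiagonal.2 (add_zero n)) hn

theorem vanishLT_prod_one_sub_monomial {ι : Type*} {n : σ →₀ ℕ} (hn : n ≠ 0) (F : Finset ι)
    (c : ι → R) : VanishLT n (∏ i ∈ F, (1 - MvPowerSeries.monomial n (c i)) - 1) ∧
      MvPowerSeries.coeff n (∏ i ∈ F, (1 - MvPowerSeries.monomial n (c i)) - 1) =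
        -∑ i ∈ F, c i := by
  classical
  induction F using Finset.induction_on with
  | empty => simp [VanishLT]
  | insert i F hi ih =>
    set y := ∏ i ∈ F, (1 - MvPowerSeries.monomial n (c i)) - 1 with hy
    have hv : VanishLT n (MvPowerSeries.monomial n (c i)) := fun k hk => by
      rw [MvPowerSeries.coeff_monomial, if_neg hk.ne]
    have e : ∏ i ∈ insert i F, (1 - MvPowerSeries.monomial n (c i)) - 1 =
        y - MvPowerSeries.monomial n (c i) - MvPowerSeries.monomial n (c i) * y := by
      rw [Finset.prod_insert hi, hy]; ring
    rw [e]
    refine ⟨(ih.1.sub hv).sub (hv.mul_right y), ?_⟩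
    have h0 : MvPowerSeries.constantCoeff y = 0 := by
      have := ih.1 0 (pos_iff_ne_zero.2 hn)
      rwa [MvPowerSeries.coeff_zero_eq_constantCoeff] at this
    rw [map_sub, map_sub, ih.2, hv.coeff_mul, h0, mul_zero, sub_zero,
      MvPowerSeries.coeff_monomial_same, Finset.sum_insert hi]
    ring

/-- The dependence of a quotient of power series on the last coefficients. -/
theorem coeff_div_sub_coeff_div {n : σ →₀ ℕ} {x x' u u' v v' w : MvPowerSeries σ R}
    (h : x * v = u) (h' : x' * v' = u') (hvw : v * w = 1)
    (hx' : MvPowerSeries.constantCoeff x' = 1) (hw : MvPowerSeries.constantCoeff w = 1)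
    (hu : VanishLT n (u - u')) (hv : VanishLT n (v - v')) :
    MvPowerSeries.coeff n x - MvPowerSeries.coeff n x' =
      MvPowerSeries.coeff n (u - u') - MvPowerSeries.coeff n (v - v') := by
  have e : x - x' = ((u - u') - (v - v') * x') * w := by
    rw [← h, ← h']
    linear_combination (x' - x) * hvw
  rw [← map_sub, e, (hu.sub (hv.mul_right x')).coeff_mul, map_sub, hv.coeff_mul, hx', hw]
  ring

end PowerSeries

section Lambda

open scoped LaurentPolynomial

variable {D : ℕ}

/-- The effective part `∑_j max(c_j, 0) t ^ j` of a Laurent polynomial. -/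
def laurentPos (c : ℤ[T;T⁻¹]) : ℤ[T;T⁻¹] :=
  ∑ j ∈ c.coeff.support, ∑ _i ∈ Finset.range (c.coeff j).toNat, LaurentPolynomial.T j

/-- The contribution to `λ` of the weight lines of degree `m`. -/
def lineFactor (m : Fin D →₀ ℕ) (c : ℤ[T;T⁻¹]) : MvPowerSeries (Fin D) ℤ[T;T⁻¹] :=
  ∏ j ∈ c.coeff.support, ∏ _i ∈ Finset.range (c.coeff j).toNat,
    (1 - MvPowerSeries.monomial m (LaurentPolynomial.T j))

theorem coeff_lambdaEffective (a : MvPowerSeries (Fin D) ℤ[T;T⁻¹]) (n : Fin D →₀ ℕ) :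
    MvPowerSeries.coeff n (lambdaEffective a) = MvPowerSeries.coeff n
      (∏ m ∈ (Finset.Iic n).erase 0, lineFactor m (MvPowerSeries.coeff m a)) := by
  have h1 : MvPowerSeries.coeff n (lambdaEffective a) =
      MvPowerSeries.coeff n (∑ S ∈ (weightLines a n).powerset,
        (-1) ^ S.card * ∏ l ∈ S, MvPowerSeries.monomial l.1 (LaurentPolynomial.T l.2.1)) := rfl
  rw [h1]
  congr 1
  have h2 : ∏ l ∈ weightLines a n,
      (1 - MvPowerSeries.monomial l.1 (LaurentPolynomial.T l.2.1 : ℤ[T;T⁻¹])) =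
      ∑ S ∈ (weightLines a n).powerset,
        (-1) ^ S.card * ∏ l ∈ S, MvPowerSeries.monomial l.1 (LaurentPolynomial.T l.2.1) := by
    simp only [sub_eq_add_neg]
    rw [Finset.prod_one_add]
    refine Finset.sum_congr rfl fun S _ => ?_
    rw [Finset.prod_neg]
  rw [← h2, weightLines, Finset.prod_sigma]
  refine Finset.prod_congr rfl fun m _ => ?_
  rw [Finset.prod_sigma]
  rfl

theorem agreeLE_lineFactor {m n : Fin D →₀ ℕ} (h : ¬ m ≤ n) (c : ℤ[T;T⁻¹]) :
    AgreeLE n (lineFactor m c) 1 := by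
  have := AgreeLE.prod c.coeff.support
    (f := fun j => ∏ _i ∈ Finset.range (c.coeff j).toNat,
      (1 - MvPowerSeries.monomial m (LaurentPolynomial.T j : ℤ[T;T⁻¹])))
    (g := fun j => ∏ _i ∈ Finset.range (c.coeff j).toNat, (1 : MvPowerSeries (Fin D) ℤ[T;T⁻¹]))
    (n := n) fun j _ => AgreeLE.prod _ fun _ _ => agreeLE_one_sub_monomial h _
  simp only [Finset.prod_const_one] at this
  exact this

theorem agreeLE_lambdaEffective (a : MvPowerSeries (Fin D) ℤ[T;T⁻¹]) (n : Fin D →₀ ℕ) :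
    AgreeLE n (lambdaEffective a)
      (∏ m ∈ (Finset.Iic n).erase 0, lineFactor m (MvPowerSeries.coeff m a)) := by
  intro k hk
  rw [coeff_lambdaEffective]
  have hsub : (Finset.Iic k).erase 0 ⊆ (Finset.Iic n).erase 0 :=
    Finset.erase_subset_erase _ (Finset.Iic_subset_Iic.2 hk)
  rw [← Finset.prod_sdiff hsub]
  have h := (AgreeLE.prod (n := k) ((Finset.Iic n).erase 0 \ (Finset.Iic k).erase 0)
    (f := fun m => lineFactor m (MvPowerSeries.coeff m a)) (g := fun _ => 1) (fun m hm => by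
      refine agreeLE_lineFactor (fun hle => ?_) _
      rw [Finset.mem_sdiff, Finset.mem_erase, Finset.mem_erase, Finset.mem_Iic,
        Finset.mem_Iic] at hm
      exact hm.2 ⟨hm.1.1, hle⟩)).mul
    (AgreeLE.refl k (∏ m ∈ (Finset.Iic k).erase 0, lineFactor m (MvPowerSeries.coeff m a)))
  rw [Finset.prod_const_one, one_mul] at h
  exact (h k le_rfl).symm

theorem constantCoeff_lambdaEffective (a : MvPowerSeries (Fin D) ℤ[T;T⁻¹]) :
    MvPowerSeries.constantCoeff (lambdaEffective a) = 1 := by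
  rw [← MvPowerSeries.coeff_zero_eq_constantCoeff, coeff_lambdaEffective]
  have : (Finset.Iic (0 : Fin D →₀ ℕ)).erase 0 = ∅ := by
    ext m; simp
  rw [this, Finset.prod_empty, MvPowerSeries.coeff_zero_one]

theorem lineFactor_first_order {n : Fin D →₀ ℕ} (hn : n ≠ 0) (c : ℤ[T;T⁻¹]) :
    VanishLT n (lineFactor n c - 1) ∧
      MvPowerSeries.coeff n (lineFactor n c - 1) = -laurentPos c := by
  have h := vanishLT_prod_one_sub_monomial hn
    (c.coeff.support.sigma fun j => Finset.range (c.coeff j).toNat)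
    (fun l => (LaurentPolynomial.T l.1 : ℤ[T;T⁻¹]))
  rwa [Finset.prod_sigma, Finset.sum_sigma] at h

theorem lambdaEffective_sub {n : Fin D →₀ ℕ} (hn : n ≠ 0) {a a' : MvPowerSeries (Fin D) ℤ[T;T⁻¹]}
    (h : ∀ m < n, MvPowerSeries.coeff m a = MvPowerSeries.coeff m a') :
    VanishLT n (lambdaEffective a - lambdaEffective a') ∧
      MvPowerSeries.coeff n (lambdaEffective a - lambdaEffective a') =
        laurentPos (MvPowerSeries.coeff n a') - laurentPos (MvPowerSeries.coeff n a) := by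
  constructor
  · intro k hk
    rw [map_sub, coeff_lambdaEffective, coeff_lambdaEffective, sub_eq_zero]
    congr 1
    refine Finset.prod_congr rfl fun m hm => ?_
    rw [Finset.mem_erase, Finset.mem_Iic] at hm
    rw [h m (hm.2.trans_lt hk)]
  · have hmem : n ∈ (Finset.Iic n).erase 0 :=
      Finset.mem_erase.2 ⟨hn, Finset.mem_Iic.2 le_rfl⟩
    set P := ∏ m ∈ ((Finset.Iic n).erase 0).erase n, lineFactor m (MvPowerSeries.coeff m a)
    have hP' : ∏ m ∈ ((Finset.Iic n).erase 0).erase n, lineFactor m (MvPowerSeries.coeff m a') =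
        P := Finset.prod_congr rfl fun m hm => by
      rw [Finset.mem_erase, Finset.mem_erase, Finset.mem_Iic] at hm
      rw [h m (lt_of_le_of_ne hm.2.2 hm.1)]
    have hP : MvPowerSeries.constantCoeff P = 1 := by
      rw [map_prod]
      refine Finset.prod_eq_one fun m hm => ?_
      rw [Finset.mem_erase, Finset.mem_erase] at hm
      have h1 := (lineFactor_first_order hm.2.1 (MvPowerSeries.coeff m a)).1 0
        (pos_iff_ne_zero.2 hm.2.1)
      rw [map_sub, MvPowerSeries.coeff_zero_one, sub_eq_zero] at h1
      exact h1
    have f1 := lineFactor_first_order hn (MvPowerSeries.coeff n a)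
    have f2 := lineFactor_first_order hn (MvPowerSeries.coeff n a')
    rw [map_sub, coeff_lambdaEffective, coeff_lambdaEffective, ← Finset.mul_prod_erase _ _ hmem,
      ← Finset.mul_prod_erase _ _ hmem, hP', ← map_sub, ← sub_mul]
    have e : lineFactor n (MvPowerSeries.coeff n a) - lineFactor n (MvPowerSeries.coeff n a') =
        (lineFactor n (MvPowerSeries.coeff n a) - 1) -
          (lineFactor n (MvPowerSeries.coeff n a') - 1) := by ring
    rw [e, (f1.1.sub f2.1).coeff_mul, hP, mul_one, map_sub, f1.2, f2.2]
    ring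

theorem laurentPos_coeff (c : ℤ[T;T⁻¹]) (j : ℤ) :
    (laurentPos c).coeff j = ((c.coeff j).toNat : ℤ) := by
  classical
  rw [laurentPos, AddMonoidAlgebra.coeff_sum, Finsupp.finsetSum_apply]
  have h : ∀ k, (∑ _i ∈ Finset.range (c.coeff k).toNat,
      (LaurentPolynomial.T k : ℤ[T;T⁻¹])).coeff j =
      if k = j then ((c.coeff k).toNat : ℤ) else 0 := by
    intro k
    rw [AddMonoidAlgebra.coeff_sum, Finsupp.finsetSum_apply, Finset.sum_const,
      LaurentPolynomial.T_apply, Finset.card_range]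
    simp
  simp only [h]
  rw [Finset.sum_ite_eq']
  split_ifs with hj
  · rfl
  · rw [Finsupp.notMem_support_iff.1 hj]
    rfl

theorem laurentPos_sub_laurentPos_neg (c : ℤ[T;T⁻¹]) : laurentPos c - laurentPos (-c) = c := by
  refine LaurentPolynomial.ext fun j => ?_
  rw [AddMonoidAlgebra.coeff_sub, Finsupp.sub_apply, laurentPos_coeff, laurentPos_coeff,
    AddMonoidAlgebra.coeff_neg, Finsupp.neg_apply]
  omega

theorem lambdaOp_mul (a : MvPowerSeries (Fin D) ℤ[T;T⁻¹]) :
    lambdaOp a * lambdaEffective (-a) = lambdaEffective a := by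
  have h := MvPowerSeries.mul_invOfUnit (lambdaEffective (-a)) 1
    (constantCoeff_lambdaEffective (-a))
  rw [lambdaOp, mul_assoc, mul_comm _ (lambdaEffective (-a)), h, mul_one]

theorem constantCoeff_lambdaOp (a : MvPowerSeries (Fin D) ℤ[T;T⁻¹]) :
    MvPowerSeries.constantCoeff (lambdaOp a) = 1 := by
  have h := congrArg MvPowerSeries.constantCoeff (lambdaOp_mul a)
  rwa [map_mul, constantCoeff_lambdaEffective, constantCoeff_lambdaEffective, mul_one] at h

/-- The coefficient of degree `n` of `λ a` depends on that of `a` through `-a`, the terms of lower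
degree of `a` being fixed. -/
theorem coeff_lambdaOp_sub {n : Fin D →₀ ℕ} (hn : n ≠ 0) {a a' : MvPowerSeries (Fin D) ℤ[T;T⁻¹]}
    (h : ∀ m < n, MvPowerSeries.coeff m a = MvPowerSeries.coeff m a') :
    MvPowerSeries.coeff n (lambdaOp a) - MvPowerSeries.coeff n (lambdaOp a') =
      MvPowerSeries.coeff n a' - MvPowerSeries.coeff n a := by
  have h1 := lambdaEffective_sub hn h
  have h2 := lambdaEffective_sub (a := -a) (a' := -a') hn fun m hm => by
    rw [map_neg, map_neg, h m hm]
  rw [coeff_div_sub_coeff_div (lambdaOp_mul a) (lambdaOp_mul a')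
    (MvPowerSeries.mul_invOfUnit (lambdaEffective (-a)) 1 (constantCoeff_lambdaEffective (-a)))
    (constantCoeff_lambdaOp a') (by rw [MvPowerSeries.constantCoeff_invOfUnit]; rfl) h1.1 h2.1,
    h1.2, h2.2, map_neg, map_neg]
  have e1 := laurentPos_sub_laurentPos_neg (MvPowerSeries.coeff n a)
  have e2 := laurentPos_sub_laurentPos_neg (MvPowerSeries.coeff n a')
  linear_combination e2 - e1

theorem lambdaOp_of_nonneg {a : MvPowerSeries (Fin D) ℤ[T;T⁻¹]}
    (ha : ∀ m j, 0 ≤ (MvPowerSeries.coeff m a).coeff j) : lambdaOp a = lambdaEffective a := by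
  have h : lambdaEffective (-a) = 1 := by
    refine MvPowerSeries.ext fun n => ?_
    rw [coeff_lambdaEffective, Finset.prod_eq_one]
    intro m _
    refine Finset.prod_eq_one fun j _ => ?_
    have : ((MvPowerSeries.coeff m (-a)).coeff j).toNat = 0 := by
      rw [map_neg, Int.toNat_eq_zero]
      have := ha m j
      change -((MvPowerSeries.coeff m a).coeff j) ≤ 0
      omega
    rw [this, Finset.range_zero, Finset.prod_empty]
  have h2 := lambdaOp_mul a
  rwa [h, mul_one] at h2

end Lambda

section LaurentCoefficients

open scoped LaurentPolynomial

theorem laurent_mul_C_coeff (x : ℤ[T;T⁻¹]) (r j : ℤ) :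
    (x * LaurentPolynomial.C r).coeff j = x.coeff j * r := by
  have h : (LaurentPolynomial.C r : ℤ[T;T⁻¹]) = AddMonoidAlgebra.single 0 r := rfl
  rw [h, AddMonoidAlgebra.coeff_mul_single_zero]

theorem laurent_mul_T_coeff (x : ℤ[T;T⁻¹]) (k j : ℤ) :
    (x * LaurentPolynomial.T k).coeff j = x.coeff (j - k) := by
  have h : (LaurentPolynomial.T k : ℤ[T;T⁻¹]) = AddMonoidAlgebra.single k 1 := rfl
  rw [h, AddMonoidAlgebra.coeff_mul_single_apply, mul_one]
  rfl

theorem pslClass_one : pslClass 1 =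
    (LaurentPolynomial.T (-1) + LaurentPolynomial.T 0 + LaurentPolynomial.T 1 : ℤ[T;T⁻¹]) := by
  have h : Finset.Icc (-((1 : ℕ) : ℤ)) ((1 : ℕ) : ℤ) = {-1, 0, 1} := by decide
  rw [pslClass, h]
  simp [add_assoc]

variable {σ : Type*}

/-- The coefficient of `t ^ j` of a power series with coefficients in `ℤ[t, t⁻¹]`. -/
def laurentPart (j : ℤ) : MvPowerSeries σ ℤ[T;T⁻¹] →+ MvPowerSeries σ ℤ where
  toFun f := fun m => (MvPowerSeries.coeff m f).coeff j
  map_zero' := rfl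
  map_add' _ _ := rfl

theorem coeff_laurentPart (j : ℤ) (f : MvPowerSeries σ ℤ[T;T⁻¹]) (m : σ →₀ ℕ) :
    MvPowerSeries.coeff m (laurentPart j f) = (MvPowerSeries.coeff m f).coeff j := rfl

theorem laurentPart_mul_map_C (j : ℤ) (f : MvPowerSeries σ ℤ[T;T⁻¹]) (α : MvPowerSeries σ ℤ) :
    laurentPart j (f * MvPowerSeries.map LaurentPolynomial.C α) = laurentPart j f * α := by
  classical
  refine MvPowerSeries.ext fun m => ?_
  rw [coeff_laurentPart, MvPowerSeries.coeff_mul, MvPowerSeries.coeff_mul,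
    AddMonoidAlgebra.coeff_sum, Finsupp.finsetSum_apply]
  refine Finset.sum_congr rfl fun p _ => ?_
  rw [MvPowerSeries.coeff_map, laurent_mul_C_coeff, coeff_laurentPart]

theorem laurentPart_mul_C_T (j k : ℤ) (f : MvPowerSeries σ ℤ[T;T⁻¹]) :
    laurentPart j (f * MvPowerSeries.C (LaurentPolynomial.T k)) = laurentPart (j - k) f := by
  refine MvPowerSeries.ext fun m => ?_
  rw [coeff_laurentPart, MvPowerSeries.coeff_mul_C, laurent_mul_T_coeff, coeff_laurentPart]

end LaurentCoefficients

section TagClass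

open scoped LaurentPolynomial

variable {D : ℕ}

theorem pslMult_eq (f : MvPowerSeries (Fin D) ℤ[T;T⁻¹]) (k : ℕ) :
    pslMult f k = laurentPart (k : ℤ) f - laurentPart ((k : ℤ) + 1) f := rfl

/-- The class `A [L(2)] + B`. -/
def tagClass (A B : MvPowerSeries (Fin D) ℤ) : MvPowerSeries (Fin D) ℤ[T;T⁻¹] :=
  toPsl A * MvPowerSeries.C (pslClass 1) + toPsl B

theorem coeff_tagClass (A B : MvPowerSeries (Fin D) ℤ) (m : Fin D →₀ ℕ) (j : ℤ) :
    (MvPowerSeries.coeff m (tagClass A B)).coeff j =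
      (if j ∈ Finset.Icc (-1 : ℤ) 1 then MvPowerSeries.coeff m A else 0) +
        if j = 0 then MvPowerSeries.coeff m B else 0 := by
  rw [tagClass, map_add, MvPowerSeries.coeff_mul_C, toPsl, toPsl, MvPowerSeries.coeff_map,
    MvPowerSeries.coeff_map, AddMonoidAlgebra.coeff_add, Finsupp.add_apply, mul_comm,
    laurent_mul_C_coeff, LaurentPolynomial.C_apply, pslClass_one, AddMonoidAlgebra.coeff_add,
    AddMonoidAlgebra.coeff_add, Finsupp.add_apply, Finsupp.add_apply, LaurentPolynomial.T_apply,
    LaurentPolynomial.T_apply, LaurentPolynomial.T_apply]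
  congr 1
  by_cases h : j ∈ Finset.Icc (-1 : ℤ) 1
  · rw [if_pos h]
    rw [Finset.mem_Icc] at h
    obtain rfl | rfl | rfl : j = -1 ∨ j = 0 ∨ j = 1 := by omega
    all_goals simp
  · rw [if_neg h]
    rw [Finset.mem_Icc] at h
    rw [if_neg (by omega), if_neg (by omega), if_neg (by omega)]
    simp

/-- The multiplicity of `L(0)` in the product of a class with `α [L(2)] + β`. -/
theorem pslMult_mul_tagClass {f : MvPowerSeries (Fin D) ℤ[T;T⁻¹]}
    (hf : laurentPart (-1) f = laurentPart 1 f) (α β : MvPowerSeries (Fin D) ℤ) :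
    pslMult (f * tagClass α β) 0 = pslMult f 1 * α + pslMult f 0 * β := by
  have e : f * tagClass α β = f * MvPowerSeries.C (LaurentPolynomial.T (-1)) * toPsl α +
      f * MvPowerSeries.C (LaurentPolynomial.T 0) * toPsl α +
      f * MvPowerSeries.C (LaurentPolynomial.T 1) * toPsl α + f * toPsl β := by
    rw [tagClass, pslClass_one, map_add, map_add]; ring
  have h : ∀ j, laurentPart j (f * tagClass α β) =
      (laurentPart (j + 1) f + laurentPart j f + laurentPart (j - 1) f) * α +
        laurentPart j f * β := fun j => by
    rw [e]
    simp only [map_add, toPsl, laurentPart_mul_map_C, laurentPart_mul_C_T, sub_neg_eq_add,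
      sub_zero, add_mul]
  rw [pslMult_eq, pslMult_eq, pslMult_eq, h, h]
  norm_num
  rw [hf]
  ring

/-- The two equations on `(A, B)` have at most one solution. -/
theorem IsLambdaSolution.unique {A B A' B' : MvPowerSeries (Fin D) ℤ}
    (h : IsLambdaSolution A B) (h' : IsLambdaSolution A' B') : A = A' ∧ B = B' := by
  suffices key : ∀ n, MvPowerSeries.coeff n A = MvPowerSeries.coeff n A' ∧
      MvPowerSeries.coeff n B = MvPowerSeries.coeff n B' from
    ⟨MvPowerSeries.ext fun n => (key n).1, MvPowerSeries.ext fun n => (key n).2⟩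
  intro n
  induction n using WellFoundedLT.induction with
  | ind n ih =>
    by_cases hn : n = 0
    · subst hn
      simp only [MvPowerSeries.coeff_zero_eq_constantCoeff]
      exact ⟨h.zeroA.trans h'.zeroA.symm, h.zeroB.trans h'.zeroB.symm⟩
    have h1 := coeff_lambdaOp_sub (a := tagClass A B) (a' := tagClass A' B') hn fun m hm =>
      LaurentPolynomial.ext fun j => by
        rw [coeff_tagClass, coeff_tagClass, (ih m hm).1, (ih m hm).2]
    have h2 : ∀ j, _ := fun j => congrArg (fun x : ℤ[T;T⁻¹] => x.coeff j) h1
    simp only [AddMonoidAlgebra.coeff_sub, Finsupp.sub_apply, coeff_tagClass] at h2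
    have e0 := congrArg (MvPowerSeries.coeff n) (h.trivial_mult.trans h'.trivial_mult.symm)
    have e1 := congrArg (MvPowerSeries.coeff n) (h.adjoint_mult.trans h'.adjoint_mult.symm)
    change (MvPowerSeries.coeff n (lambdaOp (tagClass A B))).coeff 0 -
      (MvPowerSeries.coeff n (lambdaOp (tagClass A B))).coeff 1 =
      (MvPowerSeries.coeff n (lambdaOp (tagClass A' B'))).coeff 0 -
      (MvPowerSeries.coeff n (lambdaOp (tagClass A' B'))).coeff 1 at e0
    change (MvPowerSeries.coeff n (lambdaOp (tagClass A B))).coeff 1 -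
      (MvPowerSeries.coeff n (lambdaOp (tagClass A B))).coeff 2 =
      (MvPowerSeries.coeff n (lambdaOp (tagClass A' B'))).coeff 1 -
      (MvPowerSeries.coeff n (lambdaOp (tagClass A' B'))).coeff 2 at e1
    have f0 := h2 0
    have f1 := h2 1
    have f2 := h2 2
    simp at f0 f1 f2
    omega

end TagClass

section TagProduct

open scoped LaurentPolynomial

variable {σ : Type*}

/-- The factor `1 - z^m t^j`. -/
def weightFactor (m : σ →₀ ℕ) (j : ℤ) : MvPowerSeries σ ℤ[T;T⁻¹] :=
  1 - MvPowerSeries.monomial m (LaurentPolynomial.T j)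

/-- The part of degree `≤ n` of the product that computes `λ(A [L(2)] + B)`, for `A = ∑ a_m z^m` and
`B = ∑ b_m z^m` effective. -/
def tagProduct [DecidableEq σ] (a b : (σ →₀ ℕ) → ℕ) (n : σ →₀ ℕ) : MvPowerSeries σ ℤ[T;T⁻¹] :=
  ∏ m ∈ Finset.Iic n, (weightFactor m 0 ^ b m *
    (weightFactor m 1 * weightFactor m 0 * weightFactor m (-1)) ^ a m)

theorem map_invert_weightFactor (m : σ →₀ ℕ) (j : ℤ) :
    MvPowerSeries.map (LaurentPolynomial.invert (R := ℤ) : ℤ[T;T⁻¹] →+* ℤ[T;T⁻¹])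
      (weightFactor m j) = weightFactor m (-j) := by
  classical
  refine MvPowerSeries.ext fun k => ?_
  rw [weightFactor, weightFactor, MvPowerSeries.coeff_map, map_sub, map_sub, map_sub,
    MvPowerSeries.coeff_monomial, MvPowerSeries.coeff_monomial, MvPowerSeries.coeff_one]
  split_ifs <;> simp

theorem laurentPart_neg_tagProduct [DecidableEq σ] (a b : (σ →₀ ℕ) → ℕ) (n : σ →₀ ℕ) (j : ℤ) :
    laurentPart (-j) (tagProduct a b n) = laurentPart j (tagProduct a b n) := by
  have h : MvPowerSeries.map (LaurentPolynomial.invert (R := ℤ) : ℤ[T;T⁻¹] →+* ℤ[T;T⁻¹])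
      (tagProduct a b n) = tagProduct a b n := by
    rw [tagProduct, map_prod]
    refine Finset.prod_congr rfl fun m _ => ?_
    simp only [map_mul, map_pow, map_invert_weightFactor, neg_zero, neg_neg]
    ring
  refine MvPowerSeries.ext fun m => ?_
  conv_rhs => rw [← h]
  rw [coeff_laurentPart, coeff_laurentPart, MvPowerSeries.coeff_map]
  simp

variable {D : ℕ}

theorem lineFactor_tagClass (A B : MvPowerSeries (Fin D) ℤ) (m : Fin D →₀ ℕ) {a b : ℕ}
    (hA : MvPowerSeries.coeff m A = a) (hB : MvPowerSeries.coeff m B = b) :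
    lineFactor m (MvPowerSeries.coeff m (tagClass A B)) = weightFactor m 0 ^ b *
      (weightFactor m 1 * weightFactor m 0 * weightFactor m (-1)) ^ a := by
  have hsub : (MvPowerSeries.coeff m (tagClass A B)).coeff.support ⊆ Finset.Icc (-1 : ℤ) 1 := by
    intro j hj
    by_contra h
    rw [Finsupp.mem_support_iff, coeff_tagClass, if_neg h, if_neg] at hj
    · exact hj rfl
    · rintro rfl
      exact h (by decide)
  rw [lineFactor, Finset.prod_subset hsub fun j _ hj => by
    rw [Finsupp.notMem_support_iff.1 hj, Int.toNat_zero, Finset.range_zero, Finset.prod_empty]]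
  have h : Finset.Icc (-1 : ℤ) 1 = {-1, 0, 1} := by decide
  rw [h, Finset.prod_insert (by decide), Finset.prod_insert (by decide), Finset.prod_singleton]
  simp only [Finset.prod_const, Finset.card_range, coeff_tagClass, hA, hB, h]
  have e : ((a : ℤ) + b).toNat = a + b := by omega
  simp only [Finset.mem_insert, Finset.mem_singleton, true_or, or_true, if_true,
    neg_eq_zero, one_ne_zero, if_false, add_zero, e, Int.toNat_natCast, weightFactor]
  rw [pow_add, mul_pow, mul_pow]
  ring

theorem agreeLE_lambdaOp_tagClass {A B : MvPowerSeries (Fin D) ℤ} {a b : (Fin D →₀ ℕ) → ℕ}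
    (hA : ∀ m, MvPowerSeries.coeff m A = a m) (hB : ∀ m, MvPowerSeries.coeff m B = b m)
    (ha : a 0 = 0) (hb : b 0 = 0) (n : Fin D →₀ ℕ) :
    AgreeLE n (lambdaOp (tagClass A B)) (tagProduct a b n) := by
  rw [lambdaOp_of_nonneg]
  · refine (agreeLE_lambdaEffective _ n).trans ?_
    have e : ∏ m ∈ (Finset.Iic n).erase 0, lineFactor m (MvPowerSeries.coeff m (tagClass A B)) =
        tagProduct a b n := by
      rw [tagProduct, ← Finset.mul_prod_erase _ _ (Finset.mem_Iic.2 (zero_le : 0 ≤ n)), ha, hb]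
      simp only [pow_zero, one_mul]
      exact Finset.prod_congr rfl fun m _ => lineFactor_tagClass A B m (hA m) (hB m)
    rw [e]
    exact AgreeLE.refl _ _
  · intro m j
    rw [coeff_tagClass, hA, hB]
    split_ifs <;> omega

end TagProduct

section EulerProduct

open scoped LaurentPolynomial

variable (K : Type*) [Field K] [CharZero K] (X : Type*) [Fintype X]

/-- The dimension of the component of degree `m` of the free Jordan algebra. -/
abbrev jordanDim (m : X →₀ ℕ) : ℕ := Module.finrank K (torusWeightSpace (jordanTorus K X) m)

/-- The dimension of the component of degree `m` of `ℬ` of the free Jordan algebra. -/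
abbrev tagBDim (m : X →₀ ℕ) : ℕ := Module.finrank K (torusWeightSpace (tagBTorus K X) m)

@[to_additive]
theorem prod_tagIndicesLE [DecidableEq X] {M : Type*} [CommMonoid M] (n : X →₀ ℕ)
    (f : (X →₀ ℕ) → ℤ → M) :
    ∏ i ∈ tagIndicesLE K X n, f (tagDegree i) (TAG.basisSl2Weight i) =
      ∏ m ∈ Finset.Iic n, (f m 0 ^ tagBDim K X m *
        (f m 1 * f m 0 * f m (-1)) ^ jordanDim K X m) := by
  have e : tagIndicesLE K X n =
      ((Finset.Iic n).sigma fun m => (Finset.univ : Finset (Fin (tagBDim K X m)))).disjSum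
        ((Finset.univ : Finset (Fin 3)) ×ˢ
          ((Finset.Iic n).sigma fun m => (Finset.univ : Finset (Fin (jordanDim K X m))))) := by
    ext i
    rw [mem_tagIndicesLE]
    rcases i with i | i
    · rw [Finset.inl_mem_disjSum, Finset.mem_sigma, Finset.mem_Iic, tagDegree_inl]
      simp
    · rw [Finset.inr_mem_disjSum, Finset.mem_product, Finset.mem_sigma, Finset.mem_Iic,
        tagDegree_inr]
      simp
  rw [e, Finset.prod_disjSum, Finset.prod_product, Fin.prod_univ_three, Finset.prod_sigma,
    Finset.prod_sigma, Finset.prod_sigma, Finset.prod_sigma, ← Finset.prod_mul_distrib,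
    ← Finset.prod_mul_distrib, ← Finset.prod_mul_distrib]
  refine Finset.prod_congr rfl fun m _ => ?_
  change (∏ _x : Fin (tagBDim K X m), f m 0) * ((∏ _x : Fin (jordanDim K X m), f m 1) *
    (∏ _x : Fin (jordanDim K X m), f m 0) * ∏ _x : Fin (jordanDim K X m), f m (-1)) = _
  simp only [Finset.prod_const, Finset.card_univ, Fintype.card_fin]
  rw [mul_pow, mul_pow]

variable {X}

theorem tagEuler_eq {R : Type*} [CommRing R] (χ : (X →₀ ℕ) → ℤ → R) (h0 : χ 0 0 = 1)
    (hadd : ∀ m m' j j', χ (m + m') (j + j') = χ m j * χ m' j') (φ : R →+ ℤ) (n : X →₀ ℕ)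
    (j : ℤ) (h1 : φ (χ n j) = 1) (hφ : ∀ m i, ¬ (m = n ∧ i = j) → φ (χ m i) = 0) :
    tagEuler K X n j =
      φ (∏ i ∈ tagIndicesLE K X n, (1 - χ (tagDegree i) (TAG.basisSl2Weight i))) := by
  classical
  have hprod : ∀ S : Finset (TAGIndex K X), ∏ i ∈ S, χ (tagDegree i) (TAG.basisSl2Weight i) =
      χ (∑ i ∈ S, tagDegree i) (∑ i ∈ S, TAG.basisSl2Weight i) := by
    intro S
    induction S using Finset.induction_on with
    | empty => simp [h0]
    | insert i S hi ih => rw [Finset.prod_insert hi, Finset.sum_insert hi, Finset.sum_insert hi,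
        hadd, ih]
  simp only [sub_eq_add_neg]
  rw [Finset.prod_one_add, map_sum, tagEuler, Finset.sum_filter]
  refine Finset.sum_congr rfl fun S _ => ?_
  rw [Finset.prod_neg, hprod]
  have hs : ∀ x : R, φ ((-1) ^ S.card * x) = (-1) ^ S.card * φ x := fun x => by
    rcases neg_one_pow_eq_or R S.card with h | h
    · rcases Nat.even_or_odd S.card with h2 | h2
      · rw [h2.neg_one_pow, h2.neg_one_pow, one_mul, one_mul]
      · rw [h2.neg_one_pow, h2.neg_one_pow, neg_one_mul, neg_one_mul, map_neg]
    · rcases Nat.even_or_odd S.card with h2 | h2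
      · rw [h2.neg_one_pow, h2.neg_one_pow, one_mul, one_mul]
      · rw [h2.neg_one_pow, h2.neg_one_pow, neg_one_mul, neg_one_mul, map_neg]
  rw [hs]
  split_ifs with h
  · rw [h.1, h.2, h1, mul_one]
  · rw [hφ _ _ h, mul_zero]

/-- The coefficient of `z^n t^j`. -/
def coeffHom (n : X →₀ ℕ) (j : ℤ) : MvPowerSeries X ℤ[T;T⁻¹] →+ ℤ where
  toFun f := (MvPowerSeries.coeff n f).coeff j
  map_zero' := rfl
  map_add' _ _ := rfl

theorem coeffHom_apply (n : X →₀ ℕ) (j : ℤ) (f : MvPowerSeries X ℤ[T;T⁻¹]) :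
    coeffHom n j f = (MvPowerSeries.coeff n f).coeff j := rfl

theorem coeffHom_monomial_self (n : X →₀ ℕ) (j : ℤ) :
    coeffHom n j (MvPowerSeries.monomial n (LaurentPolynomial.T j)) = 1 := by
  rw [coeffHom_apply, MvPowerSeries.coeff_monomial_same]
  simp

theorem coeffHom_monomial_ne {n m : X →₀ ℕ} {j i : ℤ} (h : ¬ (m = n ∧ i = j)) :
    coeffHom n j (MvPowerSeries.monomial m (LaurentPolynomial.T i)) = 0 := by
  classical
  rw [coeffHom_apply, MvPowerSeries.coeff_monomial]
  split_ifs with h1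
  · rw [LaurentPolynomial.T_apply, if_neg fun h2 => h ⟨h1.symm, h2⟩]
  · rfl

theorem tagEuler_eq_coeff_tagProduct [DecidableEq X] (n : X →₀ ℕ) (j : ℤ) :
    tagEuler K X n j =
      (MvPowerSeries.coeff n (tagProduct (jordanDim K X) (tagBDim K X) n)).coeff j := by
  rw [tagEuler_eq K (fun m i => MvPowerSeries.monomial m (LaurentPolynomial.T i : ℤ[T;T⁻¹]))
    (by simp) (fun m m' i i' => by
      rw [MvPowerSeries.monomial_mul_monomial, LaurentPolynomial.T_add]) (coeffHom n j) n j
    (coeffHom_monomial_self n j) (fun m i h => coeffHom_monomial_ne h)]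
  rw [coeffHom_apply]
  change (MvPowerSeries.coeff n (∏ i ∈ tagIndicesLE K X n,
    weightFactor (tagDegree i) (TAG.basisSl2Weight i))).coeff j = _
  rw [prod_tagIndicesLE K X n fun m i => weightFactor m i]
  rfl

end EulerProduct

section PolynomialProducts

variable {R : Type*} [CommRing R]

theorem coeff_prod_one_sub_monomial {ι : Type*} (F : Finset ι) (d : ι → ℕ) (c : ι → R) :
    (∏ i ∈ F, (1 - Polynomial.monomial (d i) (c i))).coeff 0 =
        ∏ i ∈ F, (if d i = 0 then 1 - c i else 1) ∧
      (∏ i ∈ F, (1 - Polynomial.monomial (d i) (c i))).coeff 1 =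
        -((∏ i ∈ F, (if d i = 0 then 1 - c i else 1)) * ∑ i ∈ F, (if d i = 1 then c i else 0)) := by
  classical
  induction F using Finset.induction_on with
  | empty => simp [Polynomial.coeff_one]
  | insert i F hi ih =>
    rw [Finset.prod_insert hi, Finset.prod_insert hi, Finset.sum_insert hi]
    have e1 : ∀ p : Polynomial R, ((1 - Polynomial.monomial (d i) (c i)) * p).coeff 1 =
        (1 - Polynomial.monomial (d i) (c i)).coeff 0 * p.coeff 1 +
          (1 - Polynomial.monomial (d i) (c i)).coeff 1 * p.coeff 0 := fun p => by
      rw [Polynomial.coeff_mul, Finset.Nat.antidiagonal_succ]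
      simp
    rw [Polynomial.mul_coeff_zero, e1, ih.1, ih.2, Polynomial.coeff_sub, Polynomial.coeff_sub,
      Polynomial.coeff_monomial, Polynomial.coeff_monomial, Polynomial.coeff_one_zero,
      Polynomial.coeff_one]
    by_cases h0 : d i = 0
    · simp [h0]; ring
    · by_cases h1 : d i = 1
      · simp [h1]; ring
      · simp [h0, h1]

end PolynomialProducts

section Equations

open scoped LaurentPolynomial

variable {K : Type*} [Field K] [CharZero K] {D : ℕ}

theorem IsWeightFamily.finrank_eq_zero {X V ι : Type*} [Fintype X] [AddCommGroup V] [Module K V]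
    {T : (X → Kˣ) → Module.End K V} {v : ι → V} {c : ι → X →₀ ℕ} (h : IsWeightFamily T v c)
    {m : X →₀ ℕ} (hm : ∀ i, c i ≠ m) : Module.finrank K (torusWeightSpace T m) = 0 := by
  have : {i | c i = m} = ∅ := Set.eq_empty_of_forall_notMem hm
  rw [h.weightSpace_eq, this, Set.image_empty, Submodule.span_empty, finrank_bot]

theorem jordanDim_zero (X : Type*) [Fintype X] : jordanDim K X 0 = 0 :=
  isWeightFamily_word.finrank_eq_zero wordContent_ne_zero

theorem tagBDim_zero (X : Type*) [Fintype X] : tagBDim K X 0 = 0 :=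
  isWeightFamily_tagWedge.finrank_eq_zero fun p h => wordContent_ne_zero p.1 (add_eq_zero.1 h).1

variable {A B : MvPowerSeries (Fin D) ℤ}

theorem laurentPart_lambdaOp_symm (hA : ∀ m, MvPowerSeries.coeff m A = jordanDim K (Fin D) m)
    (hB : ∀ m, MvPowerSeries.coeff m B = tagBDim K (Fin D) m) :
    laurentPart (-1) (lambdaOp (tagClass A B)) = laurentPart 1 (lambdaOp (tagClass A B)) := by
  refine MvPowerSeries.ext fun n => ?_
  have h := agreeLE_lambdaOp_tagClass hA hB (jordanDim_zero _) (tagBDim_zero _) n n le_rfl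
  have h2 := congrArg (MvPowerSeries.coeff n)
    (laurentPart_neg_tagProduct (jordanDim K (Fin D)) (tagBDim K (Fin D)) n 1)
  rw [coeff_laurentPart, coeff_laurentPart] at h2 ⊢
  rw [h, h2]

theorem pslMult_lambdaOp_zero (hJ : InvariantsAcyclic K (FreeJordan K (Fin D)))
    (hA : ∀ m, MvPowerSeries.coeff m A = jordanDim K (Fin D) m)
    (hB : ∀ m, MvPowerSeries.coeff m B = tagBDim K (Fin D) m) :
    pslMult (lambdaOp (tagClass A B)) 0 = 1 := by
  classical
  refine MvPowerSeries.ext fun n => ?_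
  rw [pslMult_eq, map_sub, coeff_laurentPart, coeff_laurentPart]
  by_cases hn : n = 0
  · subst hn
    rw [MvPowerSeries.coeff_zero_eq_constantCoeff, constantCoeff_lambdaOp,
      MvPowerSeries.coeff_zero_one, ← LaurentPolynomial.T_zero, LaurentPolynomial.T_apply,
      LaurentPolynomial.T_apply]
    simp
  · have h := agreeLE_lambdaOp_tagClass hA hB (jordanDim_zero _) (tagBDim_zero _) n n le_rfl
    rw [h, MvPowerSeries.coeff_one, if_neg hn]
    have h2 := tagEuler_zero_eq_one hJ hn
    rw [tagEuler_eq_coeff_tagProduct, tagEuler_eq_coeff_tagProduct] at h2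
    simp only [Nat.cast_zero, zero_add]
    rw [h2]
    exact sub_self _

end Equations

section EulerOption

open scoped LaurentPolynomial

variable {Y : Type*} [DecidableEq Y]

theorem le_optionElim_iff {p : Option Y →₀ ℕ} {m : Y →₀ ℕ} {c : ℕ} :
    p ≤ m.optionElim c ↔ p none ≤ c ∧ p.some ≤ m := by
  rw [Finsupp.le_def, Finsupp.le_def]
  constructor
  · intro h
    refine ⟨by simpa using h none, fun y => ?_⟩
    simpa using h (some y)
  · rintro ⟨h1, h2⟩ (_ | y)
    · simpa using h1
    · simpa using h2 y

@[to_additive]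
theorem prod_Iic_optionElim {M : Type*} [CommMonoid M] (m : Y →₀ ℕ) {c i : ℕ} (hi : i ≤ c)
    (G : (Option Y →₀ ℕ) → M) :
    ∏ p ∈ Finset.Iic (m.optionElim c), (if p none = i then G p else 1) =
      ∏ q ∈ Finset.Iic m, G (q.optionElim i) := by
  rw [← Finset.prod_filter]
  refine Finset.prod_bij' (fun p _ => p.some) (fun q _ => q.optionElim i) ?_ ?_ ?_ ?_ ?_
  · intro p hp
    rw [Finset.mem_filter, Finset.mem_Iic, le_optionElim_iff] at hp
    exact Finset.mem_Iic.2 hp.1.2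
  · intro q hq
    rw [Finset.mem_filter, Finset.mem_Iic, le_optionElim_iff, Finsupp.optionElim_apply_none,
      Finsupp.some_optionElim]
    exact ⟨⟨hi, Finset.mem_Iic.1 hq⟩, rfl⟩
  · intro p hp
    rw [Finset.mem_filter] at hp
    rw [← hp.2, Finsupp.optionElim_some]
  · intro q _
    rw [Finsupp.some_optionElim]
  · intro p hp
    rw [Finset.mem_filter] at hp
    rw [← hp.2, Finsupp.optionElim_some]

variable (K : Type*) [Field K] [CharZero K] [Fintype Y]

/-- The part of degree `1` in the distinguished variable of the Euler characteristic. -/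
theorem tagEuler_optionElim_one (m : Y →₀ ℕ) (j : ℤ) :
    tagEuler K (Option Y) (m.optionElim 1) j = -(MvPowerSeries.coeff m
      (tagProduct (fun q => jordanDim K (Option Y) (q.optionElim 0))
          (fun q => tagBDim K (Option Y) (q.optionElim 0)) m *
        ∑ q ∈ Finset.Iic m, (tagBDim K (Option Y) (q.optionElim 1) •
            MvPowerSeries.monomial q (LaurentPolynomial.T 0 : ℤ[T;T⁻¹]) +
          jordanDim K (Option Y) (q.optionElim 1) •
            (MvPowerSeries.monomial q (LaurentPolynomial.T 1 : ℤ[T;T⁻¹]) +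
              MvPowerSeries.monomial q (LaurentPolynomial.T 0 : ℤ[T;T⁻¹]) +
              MvPowerSeries.monomial q (LaurentPolynomial.T (-1) : ℤ[T;T⁻¹]))))).coeff j := by
  let φ : Polynomial (MvPowerSeries Y ℤ[T;T⁻¹]) →+ ℤ :=
    (coeffHom m j).comp (Polynomial.lcoeff (MvPowerSeries Y ℤ[T;T⁻¹]) 1).toAddMonoidHom
  have hφ : ∀ f, φ f = coeffHom m j (f.coeff 1) := fun f => rfl
  rw [tagEuler_eq K (fun (p : Option Y →₀ ℕ) i => Polynomial.monomial (p none)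
    (MvPowerSeries.monomial p.some (LaurentPolynomial.T i : ℤ[T;T⁻¹])))
    (by simp) (fun p p' i i' => by
      rw [Polynomial.monomial_mul_monomial, MvPowerSeries.monomial_mul_monomial,
        LaurentPolynomial.T_add, Finsupp.add_apply, Finsupp.some_add]) φ (m.optionElim 1) j
    (by
      rw [hφ, Finsupp.optionElim_apply_none, Finsupp.some_optionElim,
        Polynomial.coeff_monomial_same, coeffHom_monomial_self]) (fun p i h => by
      rw [hφ, Polynomial.coeff_monomial]
      split_ifs with h1
      · refine coeffHom_monomial_ne fun h2 => h ⟨?_, h2.2⟩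
        rw [← h2.1, ← h1, Finsupp.optionElim_some]
      · rw [map_zero])]
  have hQ : ∏ i ∈ tagIndicesLE K (Option Y) (m.optionElim 1),
      (if tagDegree i none = 0 then 1 - MvPowerSeries.monomial (tagDegree i).some
        (LaurentPolynomial.T (TAG.basisSl2Weight i) : ℤ[T;T⁻¹]) else 1) =
      tagProduct (fun q => jordanDim K (Option Y) (q.optionElim 0))
          (fun q => tagBDim K (Option Y) (q.optionElim 0)) m := by
    refine (prod_tagIndicesLE K (Option Y) (m.optionElim 1) fun p i => if p none = 0 then
      1 - MvPowerSeries.monomial p.some (LaurentPolynomial.T i : ℤ[T;T⁻¹]) else 1).trans ?_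
    have h := prod_Iic_optionElim m zero_le_one (fun p : Option Y →₀ ℕ =>
      weightFactor p.some 0 ^ tagBDim K (Option Y) p *
        (weightFactor p.some 1 * weightFactor p.some 0 * weightFactor p.some (-1)) ^
          jordanDim K (Option Y) p)
    simp only [Finsupp.some_optionElim] at h
    rw [tagProduct, ← h]
    refine Finset.prod_congr rfl fun p _ => ?_
    split_ifs with hp
    · rfl
    · rw [one_pow, one_mul, one_mul, one_mul, one_pow]
  have hL : ∑ i ∈ tagIndicesLE K (Option Y) (m.optionElim 1),
      (if tagDegree i none = 1 then MvPowerSeries.monomial (tagDegree i).some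
        (LaurentPolynomial.T (TAG.basisSl2Weight i) : ℤ[T;T⁻¹]) else 0) =
      ∑ q ∈ Finset.Iic m, (tagBDim K (Option Y) (q.optionElim 1) •
            MvPowerSeries.monomial q (LaurentPolynomial.T 0 : ℤ[T;T⁻¹]) +
          jordanDim K (Option Y) (q.optionElim 1) •
            (MvPowerSeries.monomial q (LaurentPolynomial.T 1 : ℤ[T;T⁻¹]) +
              MvPowerSeries.monomial q (LaurentPolynomial.T 0 : ℤ[T;T⁻¹]) +
              MvPowerSeries.monomial q (LaurentPolynomial.T (-1) : ℤ[T;T⁻¹]))) := by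
    refine (sum_tagIndicesLE K (Option Y) (m.optionElim 1) fun p i => if p none = 1 then
      MvPowerSeries.monomial p.some (LaurentPolynomial.T i : ℤ[T;T⁻¹]) else 0).trans ?_
    have h := sum_Iic_optionElim m (le_refl 1) (fun p : Option Y →₀ ℕ =>
      tagBDim K (Option Y) p • MvPowerSeries.monomial p.some (LaurentPolynomial.T 0 : ℤ[T;T⁻¹]) +
        jordanDim K (Option Y) p •
          (MvPowerSeries.monomial p.some (LaurentPolynomial.T 1 : ℤ[T;T⁻¹]) +
            MvPowerSeries.monomial p.some (LaurentPolynomial.T 0 : ℤ[T;T⁻¹]) +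
            MvPowerSeries.monomial p.some (LaurentPolynomial.T (-1) : ℤ[T;T⁻¹])))
    simp only [Finsupp.some_optionElim] at h
    rw [← h]
    refine Finset.sum_congr rfl fun p _ => ?_
    split_ifs with hp
    · rfl
    · rw [smul_zero, zero_add, add_zero, add_zero, smul_zero]
  rw [hφ, (coeff_prod_one_sub_monomial _ _ _).2, hQ, hL, coeffHom_apply, map_neg]
  rfl

variable {K} {D : ℕ}

theorem agreeLE_tagClass {α β : MvPowerSeries (Fin D) ℤ} {a b : (Fin D →₀ ℕ) → ℕ}
    (hα : ∀ m, MvPowerSeries.coeff m α = a m) (hβ : ∀ m, MvPowerSeries.coeff m β = b m)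
    (n : Fin D →₀ ℕ) : AgreeLE n (tagClass α β)
      (∑ q ∈ Finset.Iic n, (b q • MvPowerSeries.monomial q (LaurentPolynomial.T 0 : ℤ[T;T⁻¹]) +
          a q • (MvPowerSeries.monomial q (LaurentPolynomial.T 1 : ℤ[T;T⁻¹]) +
              MvPowerSeries.monomial q (LaurentPolynomial.T 0 : ℤ[T;T⁻¹]) +
              MvPowerSeries.monomial q (LaurentPolynomial.T (-1) : ℤ[T;T⁻¹])))) := by
  intro k hk
  rw [map_sum, Finset.sum_eq_single k]
  · rw [tagClass, map_add, MvPowerSeries.coeff_mul_C, toPsl, toPsl, MvPowerSeries.coeff_map,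
      MvPowerSeries.coeff_map, hα, hβ, pslClass_one, map_add, map_nsmul, map_nsmul, map_add,
      map_add, MvPowerSeries.coeff_monomial_same, MvPowerSeries.coeff_monomial_same,
      MvPowerSeries.coeff_monomial_same, map_natCast, map_natCast, nsmul_eq_mul, nsmul_eq_mul,
      LaurentPolynomial.T_zero]
    ring
  · intro q _ hq
    rw [map_add, map_nsmul, map_nsmul, map_add, map_add, MvPowerSeries.coeff_monomial_ne hq.symm,
      MvPowerSeries.coeff_monomial_ne hq.symm, MvPowerSeries.coeff_monomial_ne hq.symm]
    simp
  · intro h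
    exact absurd (Finset.mem_Iic.2 hk) h

/-- The part of degree `1` in the distinguished variable of the vanishing of the Euler
characteristic. -/
theorem pslMult_lambdaOp_mul_tagClass (hJ : InvariantsAcyclic K (FreeJordan K (Option (Fin D))))
    {A B α β : MvPowerSeries (Fin D) ℤ}
    (hA : ∀ m, MvPowerSeries.coeff m A = jordanDim K (Option (Fin D)) (m.optionElim 0))
    (hB : ∀ m, MvPowerSeries.coeff m B = tagBDim K (Option (Fin D)) (m.optionElim 0))
    (hα : ∀ m, MvPowerSeries.coeff m α = jordanDim K (Option (Fin D)) (m.optionElim 1))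
    (hβ : ∀ m, MvPowerSeries.coeff m β = tagBDim K (Option (Fin D)) (m.optionElim 1)) :
    pslMult (lambdaOp (tagClass A B) * tagClass α β) 0 = 0 := by
  refine MvPowerSeries.ext fun n => ?_
  have h0 : Finsupp.optionElim 0 (0 : Fin D →₀ ℕ) = 0 := by
    rw [Finsupp.optionElim_zero, Finsupp.single_zero]
  have h := (agreeLE_lambdaOp_tagClass hA hB (by rw [h0]; exact jordanDim_zero _)
    (by rw [h0]; exact tagBDim_zero _) n).mul (agreeLE_tagClass hα hβ n) n le_rfl
  have h2 := tagEuler_zero_eq_one hJ (Finsupp.optionElim_ne_zero_of_left 1 n one_ne_zero)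
  rw [tagEuler_optionElim_one, tagEuler_optionElim_one, neg_inj] at h2
  rw [pslMult_eq, map_sub, coeff_laurentPart, coeff_laurentPart, h]
  simp only [Nat.cast_zero, zero_add]
  rw [h2, sub_self, map_zero]

/-- The two equations on the dimensions of the components of the free Jordan algebra. -/
theorem pslMult_lambdaOp_one (hJ : InvariantsAcyclic K (FreeJordan K (Fin D)))
    (hJ' : InvariantsAcyclic K (FreeJordan K (Option (Fin D)))) {A B α β : MvPowerSeries (Fin D) ℤ}
    (hA : ∀ m, MvPowerSeries.coeff m A = jordanDim K (Fin D) m)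
    (hB : ∀ m, MvPowerSeries.coeff m B = tagBDim K (Fin D) m)
    (hA' : ∀ m, jordanDim K (Option (Fin D)) (m.optionElim 0) = jordanDim K (Fin D) m)
    (hB' : ∀ m, tagBDim K (Option (Fin D)) (m.optionElim 0) = tagBDim K (Fin D) m)
    (hα : ∀ m, MvPowerSeries.coeff m α = jordanDim K (Option (Fin D)) (m.optionElim 1))
    (hβ : ∀ m, MvPowerSeries.coeff m β = tagBDim K (Option (Fin D)) (m.optionElim 1))
    (hαβ : β = (∑ i, MvPowerSeries.X i) * α) (hα0 : α ≠ 0) :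
    pslMult (lambdaOp (tagClass A B)) 1 = -∑ i, MvPowerSeries.X i := by
  have h := pslMult_lambdaOp_mul_tagClass hJ' (fun m => by rw [hA, hA']) (fun m => by rw [hB, hB'])
    hα hβ
  rw [pslMult_mul_tagClass (laurentPart_lambdaOp_symm hA hB), pslMult_lambdaOp_zero hJ hA hB,
    one_mul, hαβ, ← add_mul] at h
  exact eq_neg_of_add_eq_zero_left ((mul_eq_zero.1 h).resolve_right hα0)

end EulerOption

section DualExtension

variable (K : Type*) [Field K] (J : Type*) [NonUnitalNonAssocCommRing J] [Module K J]
  [IsScalarTower K J J] [SMulCommClass K J J]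

/-- The split null extension of `J` by the regular bimodule `J` and the bimodule `End J`, on which
`a : J` acts by `f ↦ f ∘ L_a`. -/
def DualExtension : Type _ := J × J × Module.End K J

namespace DualExtension

instance : AddCommGroup (DualExtension K J) :=
  inferInstanceAs (AddCommGroup (J × J × Module.End K J))

instance : Module K (DualExtension K J) := inferInstanceAs (Module K (J × J × Module.End K J))

variable {K J}

/-- The component in `J`. -/
def base : DualExtension K J →ₗ[K] J := LinearMap.fst K J (J × Module.End K J)

/-- The component in the regular bimodule. -/
def infinitesimal : DualExtension K J →ₗ[K] J :=
  LinearMap.fst K J (Module.End K J) ∘ₗ LinearMap.snd K J (J × Module.End K J)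

/-- The component in the bimodule `End J`. -/
def dual : DualExtension K J →ₗ[K] Module.End K J :=
  LinearMap.snd K J (Module.End K J) ∘ₗ LinearMap.snd K J (J × Module.End K J)

theorem ext {x y : DualExtension K J} (h1 : base x = base y)
    (h2 : infinitesimal x = infinitesimal y) (h3 : ∀ z, dual x z = dual y z) : x = y :=
  Prod.ext h1 (Prod.ext h2 (LinearMap.ext h3))

instance : Mul (DualExtension K J) where
  mul x y := (base x * base y, base x * infinitesimal y + base y * infinitesimal x,
    dual x ∘ₗ LinearMap.mul K J (base y) + dual y ∘ₗ LinearMap.mul K J (base x))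

theorem base_mul (x y : DualExtension K J) : base (x * y) = base x * base y := rfl

theorem infinitesimal_mul (x y : DualExtension K J) : infinitesimal (x * y) =
    base x * infinitesimal y + base y * infinitesimal x := rfl

theorem dual_mul (x y : DualExtension K J) (z : J) :
    dual (x * y) z = dual x (base y * z) + dual y (base x * z) := rfl

instance : NonUnitalNonAssocCommRing (DualExtension K J) where
  left_distrib a b c := by
    refine ext ?_ ?_ fun z => ?_
    · simp only [base_mul, map_add, mul_add]
    · simp only [infinitesimal_mul, map_add, mul_add, add_mul]; abel
    · simp only [dual_mul, map_add, LinearMap.add_apply, add_mul]; abel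
  right_distrib a b c := by
    refine ext ?_ ?_ fun z => ?_
    · simp only [base_mul, map_add, add_mul]
    · simp only [infinitesimal_mul, map_add, mul_add, add_mul]; abel
    · simp only [dual_mul, map_add, LinearMap.add_apply, add_mul]; abel
  zero_mul a := by
    refine ext ?_ ?_ fun z => ?_
    · simp only [base_mul, map_zero, zero_mul]
    · simp only [infinitesimal_mul, map_zero, zero_mul, mul_zero, add_zero]
    · simp only [dual_mul, map_zero, LinearMap.zero_apply, zero_mul, add_zero]
  mul_zero a := by
    refine ext ?_ ?_ fun z => ?_
    · simp only [base_mul, map_zero, mul_zero]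
    · simp only [infinitesimal_mul, map_zero, zero_mul, mul_zero, add_zero]
    · simp only [dual_mul, map_zero, LinearMap.zero_apply, zero_mul, add_zero]
  mul_comm a b := by
    refine ext ?_ ?_ fun z => ?_
    · simp only [base_mul, mul_comm]
    · simp only [infinitesimal_mul]; abel
    · simp only [dual_mul]; abel

instance : IsScalarTower K (DualExtension K J) (DualExtension K J) where
  smul_assoc c x y := by
    simp only [smul_eq_mul]
    refine ext ?_ ?_ fun z => ?_
    · simp only [base_mul, map_smul, smul_mul_assoc]
    · simp only [infinitesimal_mul, map_smul, smul_mul_assoc, mul_smul_comm, smul_add]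
    · simp only [dual_mul, map_smul, LinearMap.smul_apply, smul_mul_assoc, smul_add]

instance : SMulCommClass K (DualExtension K J) (DualExtension K J) where
  smul_comm c x y := by
    simp only [smul_eq_mul]
    rw [mul_comm x (c • y), smul_mul_assoc, mul_comm]

instance [CharZero K] [IsCommJordan J] : IsCommJordan (DualExtension K J) where
  lmul_comm_rmul_rmul x y := by
    refine ext ?_ ?_ fun z => ?_
    · simp only [base_mul]
      exact IsCommJordan.lmul_comm_rmul_rmul _ _
    · simp only [base_mul, infinitesimal_mul]
      generalize base x = b
      generalize base y = c
      generalize infinitesimal x = p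
      generalize infinitesimal y = q
      have h1 := jordan_linearized K b b p c
      have h2 := IsCommJordan.lmul_comm_rmul_rmul b q
      simp only [mul_add, mul_comm] at h1 h2 ⊢
      linear_combination (norm := module) -h1 + h2
    · simp only [base_mul, dual_mul]
      generalize base x = b
      generalize base y = c
      generalize dual x = f
      generalize dual y = g
      have h1 := congrArg f (jordan_linearized K b b z c)
      have h2 := congrArg f (jordan_linearized K c b b z)
      have h3 := congrArg g (IsCommJordan.lmul_comm_rmul_rmul b z)
      simp only [map_add, map_sub, map_zero, mul_comm] at h1 h2 h3 ⊢
      linear_combination (norm := module) -h1 + h2 - h3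

end DualExtension

end DualExtension

section OptionDimensions

variable {K : Type*} [Field K] [CharZero K] {Y : Type*}

theorem finrank_eq_of_inverse {V V' : Type*} [AddCommGroup V] [Module K V] [AddCommGroup V']
    [Module K V'] (f : V →ₗ[K] V') (g : V' →ₗ[K] V) {W : Submodule K V} {W' : Submodule K V'}
    (hf : ∀ v ∈ W, f v ∈ W') (hg : ∀ v ∈ W', g v ∈ W) (hgf : ∀ v ∈ W, g (f v) = v)
    (hfg : ∀ v ∈ W', f (g v) = v) : Module.finrank K W = Module.finrank K W' :=
  LinearEquiv.finrank_eq
    { f.restrict hf with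
      invFun := g.restrict hg
      left_inv := fun v => Subtype.ext (hgf v v.2)
      right_inv := fun v => Subtype.ext (hfg v v.2) }

variable (K Y) in
/-- The inclusion of the free Jordan algebra on `Y` in that on `Option Y`. -/
def optionIncl : FreeJordan K Y →ₙₐ[K] FreeJordan K (Option Y) :=
  FreeJordan.lift fun y => FreeJordan.of (some y)

variable (K Y) in
/-- The retraction of the free Jordan algebra on `Option Y` onto that on `Y`. -/
def optionRetr : FreeJordan K (Option Y) →ₙₐ[K] FreeJordan K Y :=
  FreeJordan.lift fun y => y.elim 0 FreeJordan.of

theorem optionRetr_comp_optionIncl :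
    (optionRetr K Y).comp (optionIncl K Y) = NonUnitalAlgHom.id K (FreeJordan K Y) := by
  refine FreeJordan.hom_ext fun y => ?_
  rw [NonUnitalAlgHom.comp_apply, optionIncl, FreeJordan.lift_of, optionRetr, FreeJordan.lift_of]
  rfl

theorem optionIncl_optionRetr_word {w : FreeMagma (Option Y)} (hw : wordContent w none = 0) :
    optionIncl K Y (optionRetr K Y (word K w)) = word K w := by
  induction w with
  | ih1 y =>
    change optionIncl K Y (optionRetr K Y (FreeJordan.of y)) = FreeJordan.of y
    rcases y with _ | y
    · simp [wordContent] at hw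
    · rw [optionRetr, FreeJordan.lift_of, Option.elim_some, optionIncl, FreeJordan.lift_of]
  | ih2 a b ha hb =>
    change wordContent a none + wordContent b none = 0 at hw
    change optionIncl K Y (optionRetr K Y (word K a * word K b)) = word K a * word K b
    rw [map_mul, map_mul, ha (by omega), hb (by omega)]

/-- The action of the torus on a space commutes with a linear map, up to a map `r` of tori. -/
theorem map_mem_torusWeightSpace {X X' V V' : Type*} [Fintype X] [Fintype X'] [AddCommGroup V]
    [Module K V] [AddCommGroup V'] [Module K V'] {T : (X → Kˣ) → Module.End K V}
    {T' : (X' → Kˣ) → Module.End K V'} (f : V →ₗ[K] V') (r : (X' → Kˣ) → X → Kˣ)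
    (h : ∀ t v, T' t (f v) = f (T (r t) v)) {m : X →₀ ℕ} {m' : X' →₀ ℕ}
    (hm : ∀ t : X' → Kˣ, ∏ i, (r t i : K) ^ m i = ∏ i, (t i : K) ^ m' i) {v : V}
    (hv : v ∈ torusWeightSpace T m) : f v ∈ torusWeightSpace T' m' := by
  rw [mem_torusWeightSpace] at hv ⊢
  intro t
  rw [h, hv, map_smul, hm]

variable [Fintype Y]

theorem scaleHom_optionIncl (t : Option Y → Kˣ) :
    (scaleHom K t).comp (optionIncl K Y) =
      (optionIncl K Y).comp (scaleHom K fun y => t (some y)) := by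
  refine FreeJordan.hom_ext fun y => ?_
  simp only [NonUnitalAlgHom.comp_apply, optionIncl, scaleHom, FreeJordan.lift_of, map_smul]

theorem scaleHom_optionRetr (t : Y → Kˣ) :
    (scaleHom K t).comp (optionRetr K Y) =
      (optionRetr K Y).comp (scaleHom K fun y : Option Y => y.elim 1 t) := by
  refine FreeJordan.hom_ext fun y => ?_
  simp only [NonUnitalAlgHom.comp_apply, optionRetr, scaleHom, FreeJordan.lift_of, map_smul]
  rcases y with _ | y
  · simp
  · simp [FreeJordan.lift_of]

theorem prod_optionElim_zero (t : Option Y → Kˣ) (m : Y →₀ ℕ) :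
    ∏ i, (t (some i) : K) ^ m i = ∏ i, (t i : K) ^ (m.optionElim 0) i := by
  rw [Fintype.prod_option]
  simp

theorem prod_elim_one (t : Y → Kˣ) (m : Y →₀ ℕ) :
    ∏ i : Option Y, ((i.elim 1 t : Kˣ) : K) ^ (m.optionElim 0) i = ∏ i, (t i : K) ^ m i := by
  rw [Fintype.prod_option]
  simp

theorem jordanDim_optionElim_zero (m : Y →₀ ℕ) :
    jordanDim K (Option Y) (m.optionElim 0) = jordanDim K Y m := by
  refine finrank_eq_of_inverse (optionRetr K Y : FreeJordan K (Option Y) →ₗ[K] FreeJordan K Y)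
    (optionIncl K Y : FreeJordan K Y →ₗ[K] FreeJordan K (Option Y)) (fun v hv => ?_)
    (fun v hv => ?_) (fun v hv => ?_) (fun v hv => DFunLike.congr_fun optionRetr_comp_optionIncl v)
  · exact map_mem_torusWeightSpace _ (fun t y => y.elim 1 t)
      (fun t v => DFunLike.congr_fun (scaleHom_optionRetr t) v) (fun t => prod_elim_one t m) hv
  · exact map_mem_torusWeightSpace _ (fun t y => t (some y))
      (fun t v => DFunLike.congr_fun (scaleHom_optionIncl t) v)
      (fun t => prod_optionElim_zero t m) hv
  · rw [isWeightFamily_word.weightSpace_eq] at hv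
    induction hv using Submodule.span_induction with
    | zero => rw [map_zero, map_zero]
    | add x y _ _ hx hy => rw [map_add, map_add, hx, hy]
    | smul c x _ hx => rw [map_smul, map_smul, hx]
    | mem x hx =>
      obtain ⟨w, hw, rfl⟩ := hx
      have h0 : wordContent w = m.optionElim 0 := hw
      exact optionIncl_optionRetr_word (by rw [h0, Finsupp.optionElim_apply_none])

theorem tagBDim_optionElim_zero (m : Y →₀ ℕ) :
    tagBDim K (Option Y) (m.optionElim 0) = tagBDim K Y m := by
  refine finrank_eq_of_inverse (tagBMap (optionRetr K Y)) (tagBMap (optionIncl K Y))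
    (fun v hv => ?_) (fun v hv => ?_) (fun v hv => ?_) (fun v hv => ?_)
  · refine map_mem_torusWeightSpace _ (fun t y => y.elim 1 t) (fun t v => ?_)
      (fun t => prod_elim_one t m) hv
    change tagBMap _ _ = tagBMap _ (tagBMap _ _)
    rw [← tagBMap_comp, ← tagBMap_comp, scaleHom_optionRetr]
  · refine map_mem_torusWeightSpace _ (fun t y => t (some y)) (fun t v => ?_)
      (fun t => prod_optionElim_zero t m) hv
    change tagBMap _ _ = tagBMap _ (tagBMap _ _)
    rw [← tagBMap_comp, ← tagBMap_comp, scaleHom_optionIncl]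
  · rw [isWeightFamily_tagWedge.weightSpace_eq] at hv
    induction hv using Submodule.span_induction with
    | zero => rw [map_zero, map_zero]
    | add x y _ _ hx hy => rw [map_add, map_add, hx, hy]
    | smul c x _ hx => rw [map_smul, map_smul, hx]
    | mem x hx =>
      obtain ⟨⟨u, v⟩, hw, rfl⟩ := hx
      have hw' : wordContent u + wordContent v = m.optionElim 0 := hw
      have h0 := DFunLike.congr_fun hw' none
      rw [Finsupp.optionElim_apply_none, Finsupp.add_apply] at h0
      have hu : wordContent u none = 0 := by omega
      have hv : wordContent v none = 0 := by omega
      rw [tagBMap_wedge, tagBMap_wedge, optionIncl_optionRetr_word hu,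
        optionIncl_optionRetr_word hv]
  · rw [← tagBMap_comp, optionRetr_comp_optionIncl, tagBMap_id]

end OptionDimensions

section DegreeOne

open DualExtension

variable {K : Type*} [Field K] [CharZero K] {Y : Type*} [DecidableEq Y]

variable (K) in
/-- The homomorphism to the dual extension that distinguishes the generator `i`. -/
def dualHom (i : Y) :
    FreeJordan K (Option Y) →ₙₐ[K] DualExtension K (FreeJordan K (Option Y)) :=
  FreeJordan.lift fun y =>
    y.elim ((0, FreeJordan.of none, 0) : DualExtension K (FreeJordan K (Option Y)))
    fun k => ((FreeJordan.of (some k), 0, if k = i then LinearMap.id else 0) :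
      DualExtension K (FreeJordan K (Option Y)))

theorem dualHom_word (i : Y) (w : FreeMagma (Option Y)) :
    (wordContent w none = 0 → base (dualHom K i (word K w)) = word K w ∧
      infinitesimal (dualHom K i (word K w)) = 0) ∧
    (wordContent w none ≠ 0 → base (dualHom K i (word K w)) = 0) ∧
    (wordContent w none = 1 → infinitesimal (dualHom K i (word K w)) = word K w) := by
  induction w with
  | ih1 y =>
    change (Finsupp.single y 1 none = 0 → base (dualHom K i (FreeJordan.of y)) = FreeJordan.of y ∧
      infinitesimal (dualHom K i (FreeJordan.of y)) = 0) ∧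
      (Finsupp.single y 1 none ≠ 0 → base (dualHom K i (FreeJordan.of y)) = 0) ∧
      (Finsupp.single y 1 none = 1 → infinitesimal (dualHom K i (FreeJordan.of y)) =
        FreeJordan.of y)
    rw [dualHom, FreeJordan.lift_of]
    rcases y with _ | y
    · simp only [Finsupp.single_eq_same]
      exact ⟨fun h => absurd h one_ne_zero, fun _ => rfl, fun _ => rfl⟩
    · have h : Finsupp.single (some y) 1 none = 0 := Finsupp.single_eq_of_ne (by simp)
      rw [h]
      exact ⟨fun _ => ⟨rfl, rfl⟩, fun h => absurd rfl h, fun h => absurd h zero_ne_one⟩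
  | ih2 a b ha hb =>
    change (wordContent a none + wordContent b none = 0 →
        base (dualHom K i (word K a * word K b)) = word K a * word K b ∧
        infinitesimal (dualHom K i (word K a * word K b)) = 0) ∧
      (wordContent a none + wordContent b none ≠ 0 →
        base (dualHom K i (word K a * word K b)) = 0) ∧
      (wordContent a none + wordContent b none = 1 →
        infinitesimal (dualHom K i (word K a * word K b)) = word K a * word K b)
    rw [map_mul, base_mul, infinitesimal_mul]
    refine ⟨fun h => ?_, fun h => ?_, fun h => ?_⟩
    · obtain ⟨a1, a2⟩ := ha.1 (by omega)
      obtain ⟨b1, b2⟩ := hb.1 (by omega)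
      rw [a1, a2, b1, b2, mul_zero, mul_zero, add_zero]
      exact ⟨rfl, rfl⟩
    · by_cases h0 : wordContent a none = 0
      · rw [hb.2.1 (by omega), mul_zero]
      · rw [ha.2.1 h0, zero_mul]
    · by_cases h0 : wordContent a none = 0
      · rw [(ha.1 h0).1, hb.2.2 (by omega), hb.2.1 (by omega), zero_mul, add_zero]
      · rw [(hb.1 (by omega)).1, ha.2.2 (by omega), ha.2.1 h0, zero_mul, zero_add, mul_comm]

variable (K) in
/-- The linear map on `ℬ` of the free Jordan algebra that reads off the coefficient `a` of
`{a ∧ xᵢ}`, where `a` has degree `1` in the distinguished variable. -/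
def degreeOneCoeff (i : Y) :
    TagB K (FreeJordan K (Option Y)) →ₗ[K] FreeJordan K (Option Y) :=
  let F : FreeJordan K (Option Y) →ₗ[K] DualExtension K (FreeJordan K (Option Y)) := dualHom K i
  let Θ : FreeJordan K (Option Y) →ₗ[K] Module.End K (FreeJordan K (Option Y)) := dual ∘ₗ F
  let ψ : FreeJordan K (Option Y) →ₗ[K] FreeJordan K (Option Y) →ₗ[K] FreeJordan K (Option Y) :=
    (Θ ∘ₗ LinearMap.id).flip ∘ₗ (infinitesimal ∘ₗ F)
  (tagRelations K (FreeJordan K (Option Y))).liftQ (TensorProduct.lift (ψ - ψ.flip)) (by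
    refine Submodule.span_le.2 ?_
    rintro _ (⟨a, rfl⟩ | ⟨a, rfl⟩)
    · change ψ a a - ψ a a = 0
      exact sub_self _
    · change dual (dualHom K i (a * a)) (infinitesimal (dualHom K i a)) -
        dual (dualHom K i a) (infinitesimal (dualHom K i (a * a))) = 0
      rw [map_mul, dual_mul, infinitesimal_mul, map_add, sub_self])

theorem degreeOneCoeff_wedge (i : Y) (a b : FreeJordan K (Option Y)) :
    degreeOneCoeff K i (tagWedge K a b) =
      dual (dualHom K i b) (infinitesimal (dualHom K i a)) -
        dual (dualHom K i a) (infinitesimal (dualHom K i b)) := rfl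

variable [Fintype Y]

theorem infinitesimal_dualHom_of_mem (i : Y) {m : Y →₀ ℕ} {a : FreeJordan K (Option Y)}
    (ha : a ∈ torusWeightSpace (jordanTorus K (Option Y)) (m.optionElim 1)) :
    infinitesimal (dualHom K i a) = a := by
  rw [isWeightFamily_word.weightSpace_eq] at ha
  induction ha using Submodule.span_induction with
  | zero => rw [map_zero, map_zero]
  | add x y _ _ hx hy => rw [map_add, map_add, hx, hy]
  | smul c x _ hx => rw [map_smul, map_smul, hx]
  | mem x hx =>
    obtain ⟨w, hw, rfl⟩ := hx
    have h0 : wordContent w = m.optionElim 1 := hw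
    exact (dualHom_word i w).2.2 (by rw [h0, Finsupp.optionElim_apply_none])

theorem degreeOneCoeff_wedge_of (i k : Y) {m : Y →₀ ℕ} {a : FreeJordan K (Option Y)}
    (ha : a ∈ torusWeightSpace (jordanTorus K (Option Y)) (m.optionElim 1)) :
    degreeOneCoeff K i (tagWedge K a (FreeJordan.of (some k))) = if k = i then a else 0 := by
  have h1 : dualHom K i (FreeJordan.of (some k)) =
      ((FreeJordan.of (some k), 0, if k = i then LinearMap.id else 0) :
        DualExtension K (FreeJordan K (Option Y))) := by
    rw [dualHom, FreeJordan.lift_of]; rfl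
  have h2 : infinitesimal (dualHom K i (FreeJordan.of (some k))) = 0 := by rw [h1]; rfl
  have h3 : dual (dualHom K i (FreeJordan.of (some k))) = if k = i then LinearMap.id else 0 := by
    rw [h1]; rfl
  rw [degreeOneCoeff_wedge, h2, map_zero, sub_zero, h3, infinitesimal_dualHom_of_mem i ha]
  split_ifs <;> rfl

variable (K) in
/-- The possible coefficients of `xᵢ` in an element of `ℬ` of degree `(1, m)`. -/
def coeffSpace (m : Y →₀ ℕ) (i : Y) : Submodule K (FreeJordan K (Option Y)) :=
  if Finsupp.single i 1 ≤ m then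
    torusWeightSpace (jordanTorus K (Option Y)) ((m - Finsupp.single i 1).optionElim 1)
  else ⊥

theorem coeffSpace_of_le {m : Y →₀ ℕ} {i : Y} (h : Finsupp.single i 1 ≤ m) : coeffSpace K m i =
    torusWeightSpace (jordanTorus K (Option Y)) ((m - Finsupp.single i 1).optionElim 1) := if_pos h

theorem coeffSpace_of_not_le {m : Y →₀ ℕ} {i : Y} (h : ¬ Finsupp.single i 1 ≤ m) :
    coeffSpace K m i = ⊥ := if_neg h

theorem exists_mem_of_mem_coeffSpace {m : Y →₀ ℕ} {i : Y} {a : FreeJordan K (Option Y)}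
    (ha : a ∈ coeffSpace K m i) :
    ∃ p : Y →₀ ℕ, a ∈ torusWeightSpace (jordanTorus K (Option Y)) (p.optionElim 1) ∧
      (a = 0 ∨ p + Finsupp.single i 1 = m) := by
  rw [coeffSpace] at ha
  split_ifs at ha with h
  · exact ⟨_, ha, Or.inr (tsub_add_cancel_of_le h)⟩
  · rw [Submodule.mem_bot] at ha
    exact ⟨0, by rw [ha]; exact zero_mem _, Or.inl ha⟩

variable (K) in
/-- The map `(aᵢ) ↦ ∑ {aᵢ ∧ xᵢ}`. -/
def wedgeGenerators (m : Y →₀ ℕ) :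
    (Π i, coeffSpace K m i) →ₗ[K] TagB K (FreeJordan K (Option Y)) :=
  ∑ i, (tagWedge K).flip (FreeJordan.of (some i)) ∘ₗ (coeffSpace K m i).subtype ∘ₗ LinearMap.proj i

theorem wedgeGenerators_apply (m : Y →₀ ℕ) (a : Π i, coeffSpace K m i) :
    wedgeGenerators K m a = ∑ i, tagWedge K (a i : FreeJordan K (Option Y))
      (FreeJordan.of (some i)) := by
  rw [wedgeGenerators, LinearMap.sum_apply]
  rfl

theorem wedgeGenerators_injective (m : Y →₀ ℕ) : Function.Injective (wedgeGenerators K m) := by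
  rw [← LinearMap.ker_eq_bot, eq_bot_iff]
  intro a ha
  rw [LinearMap.mem_ker, wedgeGenerators_apply] at ha
  rw [Submodule.mem_bot]
  funext i
  apply Subtype.ext
  have h := congrArg (degreeOneCoeff K i) ha
  rw [map_sum, map_zero, Finset.sum_eq_single i] at h
  · obtain ⟨p, hp, -⟩ := exists_mem_of_mem_coeffSpace (a i).2
    rw [degreeOneCoeff_wedge_of i i hp, if_pos rfl] at h
    exact h
  · intro k _ hk
    obtain ⟨p, hp, -⟩ := exists_mem_of_mem_coeffSpace (a k).2
    rw [degreeOneCoeff_wedge_of i k hp, if_neg hk]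
  · exact fun h => absurd (Finset.mem_univ i) h

theorem of_mem_torusWeightSpace (y : Option Y) :
    FreeJordan.of y ∈ torusWeightSpace (jordanTorus K (Option Y)) (Finsupp.single y 1) :=
  isWeightFamily_word.mem (FreeMagma.of y)

theorem optionElim_add_single (p : Y →₀ ℕ) (c : ℕ) (i : Y) :
    p.optionElim c + Finsupp.single (some i) 1 = (p + Finsupp.single i 1).optionElim c := by
  refine Finsupp.ext fun y => ?_
  rcases y with _ | y
  · simp
  · by_cases h : i = y
    · simp [h]
    · rw [Finsupp.add_apply, Finsupp.optionElim_apply_some, Finsupp.optionElim_apply_some,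
        Finsupp.add_apply, Finsupp.single_eq_of_ne (by simpa using Ne.symm h),
        Finsupp.single_eq_of_ne (Ne.symm h)]

theorem wedge_word_mem_range {m : Y →₀ ℕ} (w : FreeMagma (Option Y)) :
    ∀ {p : Option Y →₀ ℕ} {a : FreeJordan K (Option Y)},
      a ∈ torusWeightSpace (jordanTorus K (Option Y)) p → wordContent w none = 0 →
      p + wordContent w = m.optionElim 1 →
      tagWedge K a (word K w) ∈ LinearMap.range (wedgeGenerators K m) := by
  induction w with
  | ih1 y =>
    intro p a ha h0 hp
    change Finsupp.single y 1 none = 0 at h0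
    change p + Finsupp.single y 1 = m.optionElim 1 at hp
    change tagWedge K a (FreeJordan.of y) ∈ _
    rcases y with _ | i
    · simp at h0
    · have hpn : p none = 1 := by
        have := DFunLike.congr_fun hp none
        simpa using this
      have hp2 : p = p.some.optionElim 1 := by rw [← hpn, Finsupp.optionElim_some]
      have hm : p.some + Finsupp.single i 1 = m := by
        rw [hp2, optionElim_add_single] at hp
        have := congrArg Finsupp.some hp
        rwa [Finsupp.some_optionElim, Finsupp.some_optionElim] at this
      have hmem : a ∈ coeffSpace K m i := by
        rw [coeffSpace, if_pos (hm ▸ le_add_self), ← hm, add_tsub_cancel_right, ← hp2]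
        exact ha
      refine ⟨Pi.single i ⟨a, hmem⟩, ?_⟩
      rw [wedgeGenerators_apply, Finset.sum_eq_single i]
      · rw [Pi.single_eq_same]
      · intro k _ hk
        rw [Pi.single_eq_of_ne hk, Submodule.coe_zero, map_zero, LinearMap.zero_apply]
      · exact fun h => absurd (Finset.mem_univ i) h
  | ih2 c d hc hd =>
    intro p a ha h0 hp
    change wordContent c none + wordContent d none = 0 at h0
    change p + (wordContent c + wordContent d) = m.optionElim 1 at hp
    have h := tagWedge_cyclic K (word K c) (word K d) a
    have e : tagWedge K a (word K c * word K d) =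
        tagWedge K (a * word K d) (word K c) + tagWedge K (a * word K c) (word K d) := by
      rw [tagWedge_swap K a, mul_comm a, mul_comm a]
      rw [mul_comm a] at h
      linear_combination (norm := module) -h
    change tagWedge K a (word K c * word K d) ∈ _
    rw [e]
    refine add_mem (hc (mul_mem_torusWeightSpace ha (isWeightFamily_word.mem d)) (by omega) ?_)
      (hd (mul_mem_torusWeightSpace ha (isWeightFamily_word.mem c)) (by omega) ?_)
    · rw [← hp]; abel
    · rw [← hp]; abel

theorem range_wedgeGenerators (m : Y →₀ ℕ) : LinearMap.range (wedgeGenerators K m) =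
    torusWeightSpace (tagBTorus K (Option Y)) (m.optionElim 1) := by
  refine le_antisymm ?_ ?_
  · rintro _ ⟨a, rfl⟩
    rw [wedgeGenerators_apply]
    refine Submodule.sum_mem _ fun i _ => ?_
    obtain ⟨p, hp, h0 | hm⟩ := exists_mem_of_mem_coeffSpace (a i).2
    · rw [h0, map_zero]
      exact zero_mem _
    · have h := tagWedge_mem_torusWeightSpace hp (of_mem_torusWeightSpace (some i))
      rwa [optionElim_add_single, hm] at h
  · rw [isWeightFamily_tagWedge.weightSpace_eq]
    refine Submodule.span_le.2 ?_
    rintro _ ⟨⟨u, v⟩, h, rfl⟩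
    have h' : wordContent u + wordContent v = m.optionElim 1 := h
    have h1 := DFunLike.congr_fun h' none
    rw [Finsupp.add_apply, Finsupp.optionElim_apply_none] at h1
    by_cases hv : wordContent v none = 0
    · exact wedge_word_mem_range v (isWeightFamily_word.mem u) hv h'
    · have hu : wordContent u none = 0 := by omega
      change tagWedge K (word K u) (word K v) ∈ _
      rw [tagWedge_swap]
      exact neg_mem (wedge_word_mem_range u (isWeightFamily_word.mem v) hu
        ((add_comm _ _).trans h'))

/-- The part of `ℬ` of degree `1` in the distinguished variable. -/
theorem tagBDim_optionElim_one (m : Y →₀ ℕ) : tagBDim K (Option Y) (m.optionElim 1) =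
    ∑ i : Y, if Finsupp.single i 1 ≤ m then
      jordanDim K (Option Y) ((m - Finsupp.single i 1).optionElim 1) else 0 := by
  have hfin : ∀ i, FiniteDimensional K (coeffSpace K m i) := fun i => by
    by_cases hi : Finsupp.single i 1 ≤ m
    · rw [coeffSpace_of_le hi]
      exact isWeightFamily_word.finiteDimensional _
    · rw [coeffSpace_of_not_le hi]
      infer_instance
  have h := LinearMap.finrank_range_of_inj (wedgeGenerators_injective (K := K) m)
  rw [range_wedgeGenerators, Module.finrank_pi_fintype] at h
  rw [tagBDim, h]
  refine Finset.sum_congr rfl fun i _ => ?_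
  by_cases hi : Finsupp.single i 1 ≤ m
  · rw [coeffSpace_of_le hi, if_pos hi]
  · rw [coeffSpace_of_not_le hi, if_neg hi]
    exact finrank_bot K _

end DegreeOne

section Relabel

variable {K : Type*} [Field K] [CharZero K] {X X' X'' : Type*}

variable (K) in
/-- The map of free Jordan algebras induced by a map of the generators. -/
def relabel (f : X → X') : FreeJordan K X →ₙₐ[K] FreeJordan K X' :=
  FreeJordan.lift fun x => FreeJordan.of (f x)

theorem relabel_comp_relabel {f : X → X'} {g : X' → X} (h : ∀ x, g (f x) = x) :
    (relabel K g).comp (relabel K f) = NonUnitalAlgHom.id K (FreeJordan K X) := by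
  refine FreeJordan.hom_ext fun x => ?_
  rw [NonUnitalAlgHom.comp_apply, relabel, relabel, FreeJordan.lift_of, FreeJordan.lift_of, h]
  rfl

theorem InvariantsAcyclic.of_equiv (e : X ≃ X') (h : InvariantsAcyclic K (FreeJordan K X')) :
    InvariantsAcyclic K (FreeJordan K X) :=
  h.of_retract (relabel_comp_relabel e.symm_apply_apply)

theorem InvariantsAcyclic.of_option (h : InvariantsAcyclic K (FreeJordan K (Option X))) :
    InvariantsAcyclic K (FreeJordan K X) :=
  h.of_retract optionRetr_comp_optionIncl

variable [Fintype X] [Fintype X']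

theorem scaleHom_relabel (f : X → X') (t : X' → Kˣ) :
    (scaleHom K t).comp (relabel K f) = (relabel K f).comp (scaleHom K fun x => t (f x)) := by
  refine FreeJordan.hom_ext fun x => ?_
  simp only [NonUnitalAlgHom.comp_apply, relabel, scaleHom, FreeJordan.lift_of, map_smul]

theorem prod_embDomain (e : X ≃ X') (t : X' → Kˣ) (m : X →₀ ℕ) :
    ∏ i, (t (e i) : K) ^ m i = ∏ i, (t i : K) ^ (m.embDomain e.toEmbedding) i := by
  refine Fintype.prod_equiv e _ _ fun i => ?_
  rw [← Equiv.coe_toEmbedding, Finsupp.embDomain_apply_self]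

theorem prod_embDomain_symm (e : X ≃ X') (t : X → Kˣ) (m : X →₀ ℕ) :
    ∏ i, (t (e.symm i) : K) ^ (m.embDomain e.toEmbedding) i = ∏ i, (t i : K) ^ m i := by
  rw [← prod_embDomain e (fun i => t (e.symm i)) m]
  simp only [Equiv.symm_apply_apply]

theorem jordanDim_embDomain (e : X ≃ X') (m : X →₀ ℕ) :
    jordanDim K X' (m.embDomain e.toEmbedding) = jordanDim K X m := by
  refine finrank_eq_of_inverse (relabel K e.symm : FreeJordan K X' →ₗ[K] FreeJordan K X)
    (relabel K e : FreeJordan K X →ₗ[K] FreeJordan K X') (fun v hv => ?_)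
    (fun v hv => ?_) (fun v hv => DFunLike.congr_fun (relabel_comp_relabel e.apply_symm_apply) v)
    (fun v hv => DFunLike.congr_fun (relabel_comp_relabel e.symm_apply_apply) v)
  · exact map_mem_torusWeightSpace _ (fun t x => t (e.symm x))
      (fun t v => DFunLike.congr_fun (scaleHom_relabel e.symm t) v)
      (fun t => prod_embDomain_symm e t m) hv
  · exact map_mem_torusWeightSpace _ (fun t x => t (e x))
      (fun t v => DFunLike.congr_fun (scaleHom_relabel e t) v) (fun t => prod_embDomain e t m) hv

theorem tagBDim_embDomain (e : X ≃ X') (m : X →₀ ℕ) :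
    tagBDim K X' (m.embDomain e.toEmbedding) = tagBDim K X m := by
  refine finrank_eq_of_inverse (tagBMap (relabel K e.symm)) (tagBMap (relabel K e))
    (fun v hv => ?_) (fun v hv => ?_) (fun v hv => ?_) (fun v hv => ?_)
  · refine map_mem_torusWeightSpace _ (fun t x => t (e.symm x)) (fun t v => ?_)
      (fun t => prod_embDomain_symm e t m) hv
    change tagBMap _ _ = tagBMap _ (tagBMap _ _)
    rw [← tagBMap_comp, ← tagBMap_comp, scaleHom_relabel]
  · refine map_mem_torusWeightSpace _ (fun t x => t (e x)) (fun t v => ?_)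
      (fun t => prod_embDomain e t m) hv
    change tagBMap _ _ = tagBMap _ (tagBMap _ _)
    rw [← tagBMap_comp, ← tagBMap_comp, scaleHom_relabel]
  · rw [← tagBMap_comp, relabel_comp_relabel e.apply_symm_apply, tagBMap_id]
  · rw [← tagBMap_comp, relabel_comp_relabel e.symm_apply_apply, tagBMap_id]

end Relabel

section Classes

variable {K : Type*} [Field K] [CharZero K] {D : ℕ}

theorem mem_RAn {f : MvPowerSeries (Fin D) ℤ} (h : ∀ (σ : Equiv.Perm (Fin D)) (m : Fin D →₀ ℕ),
    MvPowerSeries.coeff (m.embDomain σ.toEmbedding) f = MvPowerSeries.coeff m f) : f ∈ RAn D := by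
  intro σ
  refine MvPowerSeries.ext fun n => ?_
  have hn : n = (n.embDomain σ.symm.toEmbedding).embDomain σ.toEmbedding := by
    refine Finsupp.ext fun i => ?_
    have h1 := Finsupp.embDomain_apply_self σ.toEmbedding
      (n.embDomain σ.symm.toEmbedding) (σ.symm i)
    have h2 := Finsupp.embDomain_apply_self σ.symm.toEmbedding n i
    rw [Equiv.coe_toEmbedding, Equiv.apply_symm_apply] at h1
    rw [Equiv.coe_toEmbedding] at h2
    rw [h1, h2]
  rw [hn, h]
  exact MvPowerSeries.coeff_embDomain_rename σ.toEmbedding f _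

theorem jordanRep_diagGL (t : Fin D → Kˣ) : jordanRep K D (diagGL t) = jordanTorus K (Fin D) t := by
  have h : jordanSubst K D (diagGL t).1 = scaleHom K t := by
    refine FreeJordan.hom_ext fun j => ?_
    rw [jordanSubst, scaleHom, FreeJordan.lift_of, FreeJordan.lift_of, Finset.sum_eq_single j]
    · congr 1
      exact Matrix.diagonal_apply_eq _ _
    · intro i _ hi
      have : (diagGL t).1 i j = 0 := Matrix.diagonal_apply_ne _ hi
      rw [this, zero_smul]
    · exact fun h => absurd (Finset.mem_univ j) h
  exact LinearMap.ext fun a => DFunLike.congr_fun h a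

theorem coeff_repClass_jordanRep (m : Fin D →₀ ℕ) :
    MvPowerSeries.coeff m (repClass (jordanRep K D)) = jordanDim K (Fin D) m := by
  have h : weightSpace (jordanRep K D) m = torusWeightSpace (jordanTorus K (Fin D)) m := by
    unfold weightSpace torusWeightSpace
    simp only [jordanRep_diagGL]
  change ((Module.finrank K (weightSpace (jordanRep K D) m) : ℕ) : ℤ) = _
  rw [h]

/-- The map `ℬJ → Inner J`. -/
def tagInner (K : Type*) [Field K] [CharZero K] (D : ℕ) :
    TagB K (FreeJordan K (Fin D)) →ₗ[K] innerDer K (FreeJordan K (Fin D)) :=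
  (tagPartial K (FreeJordan K (Fin D))).codRestrict _ fun w => by
    induction w using tagB_induction with
    | h0 => rw [map_zero]; exact zero_mem _
    | hadd x y hx hy => rw [map_add]; exact add_mem hx hy
    | hw a b => exact Submodule.subset_span ⟨a, b, rfl⟩

theorem tagInner_surjective : Function.Surjective (tagInner K D) := by
  rintro ⟨φ, hφ⟩
  suffices h : innerDer K (FreeJordan K (Fin D)) ≤
      LinearMap.range (tagPartial K (FreeJordan K (Fin D))) by
    obtain ⟨w, hw⟩ := h hφ
    exact ⟨w, Subtype.ext hw⟩
  refine Submodule.span_le.2 ?_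
  rintro _ ⟨a, b, rfl⟩
  exact ⟨tagWedge K a b, rfl⟩

theorem jordanRep_inv_apply (g : Matrix.GeneralLinearGroup (Fin D) K) (z : FreeJordan K (Fin D)) :
    jordanRep K D g (jordanRep K D g⁻¹ z) = z := by
  rw [← Module.End.mul_apply, ← map_mul, mul_inv_cancel, map_one, Module.End.one_apply]

theorem innerRep_tagInner (g : Matrix.GeneralLinearGroup (Fin D) K)
    (w : TagB K (FreeJordan K (Fin D))) :
    innerRep K D g (tagInner K D w) = tagInner K D (tagBMap (jordanSubst K D g.1) w) := by
  apply Subtype.ext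
  refine LinearMap.ext fun z => ?_
  change jordanRep K D g (tagPartial K _ w (jordanRep K D g⁻¹ z)) =
    tagPartial K _ (tagBMap (jordanSubst K D g.1) w) z
  conv_rhs => rw [← jordanRep_inv_apply g z]
  exact (tagPartial_map (jordanSubst K D g.1) w _).symm

theorem coeff_repClass_innerRep (hJ : InvariantsAcyclic K (FreeJordan K (Fin D)))
    (m : Fin D →₀ ℕ) :
    MvPowerSeries.coeff m (repClass (innerRep K D)) = tagBDim K (Fin D) m := by
  have hinj : Function.Injective (tagInner K D) := fun x y h =>
    tagPartial_injective hJ (congrArg Subtype.val h)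
  let e := LinearEquiv.ofBijective (tagInner K D) ⟨hinj, tagInner_surjective⟩
  have he : ∀ w, e w = tagInner K D w := fun w => rfl
  have hd : ∀ t : Fin D → Kˣ, jordanSubst K D (diagGL t).1 = scaleHom K t := fun t =>
    NonUnitalAlgHom.ext fun z => LinearMap.congr_fun (jordanRep_diagGL t) z
  have h2 : ∀ (t : Fin D → Kˣ) w, innerRep K D (diagGL t) (e w) = e (tagBTorus K (Fin D) t w) := by
    intro t w
    rw [he, he, innerRep_tagInner, hd]
    rfl
  have h : Module.finrank K (torusWeightSpace (fun t => innerRep K D (diagGL t)) m) =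
      tagBDim K (Fin D) m := by
    refine finrank_eq_of_inverse e.symm.toLinearMap e.toLinearMap (fun v hv => ?_) (fun v hv => ?_)
      (fun v _ => e.apply_symm_apply v) (fun v _ => e.symm_apply_apply v)
    · refine map_mem_torusWeightSpace _ id (fun t v => ?_) (fun t => rfl) hv
      apply e.injective
      rw [LinearEquiv.coe_coe, ← h2, e.apply_symm_apply, e.apply_symm_apply]
      rfl
    · exact map_mem_torusWeightSpace _ id (fun t v => h2 t v) (fun t => rfl) hv
  exact congrArg Nat.cast h

/-- The pair of the classes of the free Jordan algebra and of its inner derivations is a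
solution. -/
theorem isLambdaSolution_repClass (hJ : InvariantsAcyclic K (FreeJordan K (Option (Fin D)))) :
    IsLambdaSolution (repClass (jordanRep K D)) (repClass (innerRep K D)) := by
  have hJ' := hJ.of_option
  have hA := coeff_repClass_jordanRep (K := K) (D := D)
  have hB := coeff_repClass_innerRep hJ'
  let α : MvPowerSeries (Fin D) ℤ := fun m => (jordanDim K (Option (Fin D)) (m.optionElim 1) : ℤ)
  let β : MvPowerSeries (Fin D) ℤ := fun m => (tagBDim K (Option (Fin D)) (m.optionElim 1) : ℤ)
  have hα : ∀ m, MvPowerSeries.coeff m α = jordanDim K (Option (Fin D)) (m.optionElim 1) :=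
    fun m => rfl
  have hβ : ∀ m, MvPowerSeries.coeff m β = tagBDim K (Option (Fin D)) (m.optionElim 1) :=
    fun m => rfl
  have hαβ : β = (∑ i, MvPowerSeries.X i) * α := by
    classical
    refine MvPowerSeries.ext fun m => ?_
    rw [hβ, tagBDim_optionElim_one, Finset.sum_mul, map_sum]
    push_cast
    refine Finset.sum_congr rfl fun i _ => ?_
    rw [MvPowerSeries.X, MvPowerSeries.coeff_monomial_mul, one_mul]
    split_ifs
    · rw [hα]
    · rfl
  have hα0 : α ≠ 0 := by
    intro h
    have h1 := congrArg (MvPowerSeries.coeff 0) h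
    rw [hα, map_zero, Finsupp.optionElim_zero, Nat.cast_eq_zero] at h1
    have h2 : FreeJordan.of none ∈
        torusWeightSpace (jordanTorus K (Option (Fin D))) (Finsupp.single none 1) :=
      of_mem_torusWeightSpace none
    have := isWeightFamily_word.finiteDimensional (K := K)
      (T := jordanTorus K (Option (Fin D))) (Finsupp.single none 1)
    rw [Submodule.finrank_eq_zero.1 h1, Submodule.mem_bot] at h2
    have h3 := congrArg (FreeJordan.lift (K := K) (A := K) fun _ : Option (Fin D) => 1) h2
    rw [FreeJordan.lift_of, map_zero] at h3
    exact one_ne_zero h3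
  refine ⟨mem_RAn fun σ m => ?_, mem_RAn fun σ m => ?_, ?_, ?_, pslMult_lambdaOp_zero hJ' hA hB,
    pslMult_lambdaOp_one hJ' hJ hA hB jordanDim_optionElim_zero
      tagBDim_optionElim_zero hα hβ hαβ hα0⟩
  · rw [hA, hA, jordanDim_embDomain]
  · rw [hB, hB, tagBDim_embDomain]
  · rw [← MvPowerSeries.coeff_zero_eq_constantCoeff, hA, jordanDim_zero]; rfl
  · rw [← MvPowerSeries.coeff_zero_eq_constantCoeff, hB, tagBDim_zero]; rfl

end Classes

section PolynomialFunctions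

variable {K : Type*} [Field K] {D : ℕ} {V V' V'' : Type*} [AddCommGroup V] [Module K V]
  [AddCommGroup V'] [Module K V'] [AddCommGroup V''] [Module K V'']

variable (K D V) in
/-- The `V`-valued functions on `GL(D)` that are given by homogeneous polynomials of degree `n` in
the matrix entries. -/
def polynomialFunctions (n : ℕ) : Submodule K (Matrix.GeneralLinearGroup (Fin D) K → V) :=
  Submodule.span K {F | ∃ (P : MvPolynomial (Fin D × Fin D) K) (u : V), P.IsHomogeneous n ∧
    F = fun g => MvPolynomial.eval (fun p => g.1 p.1 p.2) P • u}

theorem map₂_mem_polynomialFunctions (β : V →ₗ[K] V' →ₗ[K] V'') {n n' : ℕ}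
    {F : Matrix.GeneralLinearGroup (Fin D) K → V} {F' : Matrix.GeneralLinearGroup (Fin D) K → V'}
    (hF : F ∈ polynomialFunctions K D V n) (hF' : F' ∈ polynomialFunctions K D V' n') :
    (fun g => β (F g) (F' g)) ∈ polynomialFunctions K D V'' (n + n') := by
  induction hF using Submodule.span_induction with
  | zero =>
    have : (fun g => β ((0 : Matrix.GeneralLinearGroup (Fin D) K → V) g) (F' g)) = 0 := by
      funext g; simp
    rw [this]; exact zero_mem _
  | add x y _ _ hx hy =>
    have : (fun g => β ((x + y) g) (F' g)) =
        (fun g => β (x g) (F' g)) + fun g => β (y g) (F' g) := by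
      funext g; simp
    rw [this]; exact add_mem hx hy
  | smul c x _ hx =>
    have : (fun g => β ((c • x) g) (F' g)) = c • fun g => β (x g) (F' g) := by
      funext g; simp
    rw [this]; exact Submodule.smul_mem _ _ hx
  | mem x hx =>
    obtain ⟨P, u, hP, rfl⟩ := hx
    induction hF' using Submodule.span_induction with
    | zero =>
      have : (fun g : Matrix.GeneralLinearGroup (Fin D) K =>
          β (MvPolynomial.eval (fun p => g.1 p.1 p.2) P • u)
          ((0 : Matrix.GeneralLinearGroup (Fin D) K → V') g)) = 0 := by
        funext g; simp
      rw [this]; exact zero_mem _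
    | add x y _ _ hx hy =>
      have : (fun g : Matrix.GeneralLinearGroup (Fin D) K =>
          β (MvPolynomial.eval (fun p => g.1 p.1 p.2) P • u) ((x + y) g)) =
          (fun g => β (MvPolynomial.eval (fun p => g.1 p.1 p.2) P • u) (x g)) +
            fun g => β (MvPolynomial.eval (fun p => g.1 p.1 p.2) P • u) (y g) := by
        funext g; simp
      rw [this]; exact add_mem hx hy
    | smul c x _ hx =>
      have : (fun g : Matrix.GeneralLinearGroup (Fin D) K =>
          β (MvPolynomial.eval (fun p => g.1 p.1 p.2) P • u) ((c • x) g)) =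
          c • fun g => β (MvPolynomial.eval (fun p => g.1 p.1 p.2) P • u) (x g) := by
        funext g; rw [Pi.smul_apply, Pi.smul_apply, map_smul]
      rw [this]; exact Submodule.smul_mem _ _ hx
    | mem x hx =>
      obtain ⟨P', u', hP', rfl⟩ := hx
      refine Submodule.subset_span ⟨P * P', β u u', hP.mul hP', ?_⟩
      funext g
      rw [map_mul, map_smul, map_smul, LinearMap.smul_apply, smul_smul, mul_comm]

theorem exists_polynomial_of_mem {n : ℕ} {F : Matrix.GeneralLinearGroup (Fin D) K → V}
    (hF : F ∈ polynomialFunctions K D V n) (f : Module.Dual K V) :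
    ∃ P : MvPolynomial (Fin D × Fin D) K, P.IsHomogeneous n ∧
      ∀ g, f (F g) = MvPolynomial.eval (fun p => g.1 p.1 p.2) P := by
  induction hF using Submodule.span_induction with
  | zero => exact ⟨0, MvPolynomial.isHomogeneous_zero _ _ _, fun g => by simp⟩
  | add x y _ _ hx hy =>
    obtain ⟨P, hP, h1⟩ := hx
    obtain ⟨Q, hQ, h2⟩ := hy
    exact ⟨P + Q, hP.add hQ, fun g => by rw [Pi.add_apply, map_add, map_add, h1, h2]⟩
  | smul c x _ hx =>
    obtain ⟨P, hP, h1⟩ := hx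
    refine ⟨MvPolynomial.C c * P, by simpa using (MvPolynomial.isHomogeneous_C _ c).mul hP,
      fun g => ?_⟩
    rw [Pi.smul_apply, map_smul, h1, map_mul, MvPolynomial.eval_C, smul_eq_mul]
  | mem x hx =>
    obtain ⟨P, u, hP, rfl⟩ := hx
    refine ⟨MvPolynomial.C (f u) * P, by simpa using (MvPolynomial.isHomogeneous_C _ (f u)).mul hP,
      fun g => ?_⟩
    rw [map_smul, map_mul, MvPolynomial.eval_C, smul_eq_mul, mul_comm]

theorem eval_smul_of_isHomogeneous {σ : Type*} {P : MvPolynomial σ K} {n : ℕ}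
    (hP : P.IsHomogeneous n) (c : K) (x : σ → K) :
    MvPolynomial.eval (fun i => c * x i) P = c ^ n * MvPolynomial.eval x P := by
  rw [MvPolynomial.eval_eq, MvPolynomial.eval_eq, Finset.mul_sum]
  refine Finset.sum_congr rfl fun d hd => ?_
  have hdeg := hP (MvPolynomial.mem_support_iff.1 hd)
  simp only [mul_pow, Finset.prod_mul_distrib]
  rw [Finset.prod_pow_eq_pow_sum]
  have : ∑ i ∈ d.support, d i = n :=
    (DFunLike.congr_fun Finsupp.degree_eq_weight_one d).trans hdeg
  rw [this]
  ring

theorem polynomialFunctions_scalar {n : ℕ} {F : Matrix.GeneralLinearGroup (Fin D) K → V}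
    (hF : F ∈ polynomialFunctions K D V n) (z : Kˣ) :
    F (diagGL fun _ => z) = (z : K) ^ n • F 1 := by
  induction hF using Submodule.span_induction with
  | zero => simp
  | add x y _ _ hx hy => rw [Pi.add_apply, Pi.add_apply, hx, hy, smul_add]
  | smul c x _ hx => rw [Pi.smul_apply, Pi.smul_apply, hx, smul_comm]
  | mem x hx =>
    obtain ⟨P, u, hP, rfl⟩ := hx
    dsimp only
    rw [smul_smul, ← eval_smul_of_isHomogeneous hP]
    congr 3
    funext p
    change Matrix.diagonal (fun _ => (z : K)) p.1 p.2 = z * (1 : Matrix (Fin D) (Fin D) K) p.1 p.2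
    rw [Matrix.diagonal_apply, Matrix.one_apply]
    split_ifs <;> simp

variable [CharZero K] (ρ : Representation K (Matrix.GeneralLinearGroup (Fin D) K) V)

theorem iSupIndep_degreeSpace : iSupIndep (degreeSpace ρ) := by
  let T : (Unit → Kˣ) → Module.End K V := fun t => ρ (diagGL fun _ => t ())
  have h : degreeSpace ρ = torusWeightSpace T ∘ fun n => Finsupp.single () n := by
    funext n
    refine Submodule.ext fun v => ?_
    rw [Function.comp_apply, mem_torusWeightSpace, degreeSpace, Submodule.mem_iInf]
    have key : ∀ z : Kˣ, v ∈ LinearMap.ker (ρ (diagGL fun _ => z) - ((z : K) ^ n) • LinearMap.id) ↔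
        ρ (diagGL fun _ => z) v = (z : K) ^ n • v := fun z => by
      rw [LinearMap.mem_ker, LinearMap.sub_apply, sub_eq_zero]; rfl
    simp only [key, T]
    constructor
    · intro hv t
      rw [hv]
      simp
    · intro hv z
      rw [hv fun _ => z]
      simp
  rw [h]
  exact (iSupIndep_torusWeightSpace T).comp (Finsupp.single_injective ())

/-- A criterion for a representation of `GL(D)` to be analytic. -/
theorem isAnalytic_of_span {ι : Type*} {v : ι → V} {c : ι → ℕ}
    (hv : ∀ i, (fun g => ρ g (v i)) ∈ polynomialFunctions K D V (c i))
    (hspan : Submodule.span K (Set.range v) = ⊤) (hfin : ∀ n, {i | c i = n}.Finite) :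
    IsAnalytic ρ := by
  have hmem : ∀ i, v i ∈ degreeSpace ρ (c i) := fun i => by
    refine (Submodule.mem_iInf _).2 fun z => ?_
    rw [LinearMap.mem_ker, LinearMap.sub_apply, sub_eq_zero]
    have h := polynomialFunctions_scalar (hv i) z
    rw [map_one] at h
    exact h
  have hdeg := le_span_of_iSupIndep (iSupIndep_degreeSpace ρ) hmem hspan
  refine ⟨isInternal_of_iSupIndep (iSupIndep_degreeSpace ρ) hmem hspan, fun n => ⟨?_, ?_⟩⟩
  · rw [hdeg]
    exact FiniteDimensional.span_of_finite K ((hfin n).image v)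
  · intro w hw f
    refine exists_polynomial_of_mem (F := fun g => ρ g w) ?_ f
    rw [hdeg] at hw
    induction hw using Submodule.span_induction with
    | zero =>
      have : (fun g => ρ g (0 : V)) = 0 := by funext g; simp
      rw [this]; exact zero_mem _
    | add x y _ _ hx hy =>
      have : (fun g => ρ g (x + y)) = (fun g => ρ g x) + fun g => ρ g y := by funext g; simp
      rw [this]; exact add_mem hx hy
    | smul a x _ hx =>
      have : (fun g => ρ g (a • x)) = a • fun g => ρ g x := by funext g; simp
      rw [this]; exact Submodule.smul_mem _ _ hx
    | mem x hx =>
      obtain ⟨i, rfl, rfl⟩ := hx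
      exact hv i

end PolynomialFunctions

section Analytic

variable {K : Type*} [Field K] [CharZero K] {D : ℕ}

theorem jordanRep_word_mem (w : FreeMagma (Fin D)) : (fun g => jordanRep K D g (word K w)) ∈
    polynomialFunctions K D (FreeJordan K (Fin D)) (wordContent w).degree := by
  induction w with
  | ih1 j =>
    have h : (fun g => jordanRep K D g (word K (FreeMagma.of j))) = ∑ i, fun g =>
        MvPolynomial.eval (fun p : Fin D × Fin D => g.1 p.1 p.2) (MvPolynomial.X (i, j)) •
          FreeJordan.of i := by
      funext g
      rw [Finset.sum_apply]
      simp only [MvPolynomial.eval_X]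
      exact FreeJordan.lift_of _ j
    have hd : (wordContent (FreeMagma.of j)).degree = 1 := Finsupp.degree_single j 1
    change (fun g => jordanRep K D g (word K (FreeMagma.of j))) ∈ _
    rw [h, hd]
    exact Submodule.sum_mem _ fun i _ =>
      Submodule.subset_span ⟨_, _, MvPolynomial.isHomogeneous_X K (i, j), rfl⟩
  | ih2 a b ha hb =>
    have hd : (wordContent (FreeMagma.mul a b)).degree =
        (wordContent a).degree + (wordContent b).degree := map_add Finsupp.degree _ _
    have h : (fun g => jordanRep K D g (word K (FreeMagma.mul a b))) = fun g =>
        LinearMap.mul K (FreeJordan K (Fin D)) (jordanRep K D g (word K a))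
          (jordanRep K D g (word K b)) :=
      funext fun g => jordanRep_mul K D g _ _
    change (fun g => jordanRep K D g (word K (FreeMagma.mul a b))) ∈
      polynomialFunctions K D _ (wordContent (FreeMagma.mul a b)).degree
    rw [h, hd]
    exact map₂_mem_polynomialFunctions _ ha hb

theorem finite_wordContent_degree_eq (n : ℕ) :
    {w : FreeMagma (Fin D) | (wordContent w).degree = n}.Finite := by
  refine ((Finsupp.finite_of_degree_eq (σ := Fin D) n).biUnion
    fun m _ => finite_wordContent_eq m).subset fun w hw => ?_
  simp only [Set.mem_iUnion]
  exact ⟨wordContent w, hw, rfl⟩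

theorem isAnalytic_jordanRep : IsAnalytic (jordanRep K D) :=
  isAnalytic_of_span _ jordanRep_word_mem span_word finite_wordContent_degree_eq

theorem isAnalytic_innerRep : IsAnalytic (innerRep K D) := by
  refine isAnalytic_of_span (innerRep K D)
    (v := fun p : FreeMagma (Fin D) × FreeMagma (Fin D) =>
      tagInner K D (tagWedge K (word K p.1) (word K p.2)))
    (c := fun p => (wordContent p.1).degree + (wordContent p.2).degree) (fun p => ?_) ?_ fun n => ?_
  · have h := map₂_mem_polynomialFunctions ((tagWedge K).compr₂ (tagInner K D))
      (jordanRep_word_mem p.1) (jordanRep_word_mem p.2)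
    have e : (fun g => innerRep K D g (tagInner K D (tagWedge K (word K p.1) (word K p.2)))) =
        fun g => ((tagWedge K).compr₂ (tagInner K D)) (jordanRep K D g (word K p.1))
          (jordanRep K D g (word K p.2)) :=
      funext fun g => by rw [innerRep_tagInner, tagBMap_wedge]; rfl
    rw [e]
    exact h
  · have h := congrArg (Submodule.map (tagInner K D))
      (isWeightFamily_tagWedge (K := K) (X := Fin D)).span
    rw [Submodule.map_span, Submodule.map_top, LinearMap.range_eq_top.2 tagInner_surjective,
      ← Set.range_comp] at h
    exact h
  · refine ((Finset.finite_toSet (Finset.HasAntidiagonal.antidiagonal n)).biUnion (t := fun q =>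
      {w : FreeMagma (Fin D) | (wordContent w).degree = q.1} ×ˢ
        {w : FreeMagma (Fin D) | (wordContent w).degree = q.2})
      (fun q _ => (finite_wordContent_degree_eq q.1).prod
        (finite_wordContent_degree_eq q.2))).subset ?_
    rintro ⟨u, v⟩ h
    simp only [Set.mem_iUnion]
    exact ⟨((wordContent u).degree, (wordContent v).degree),
      Finset.HasAntidiagonal.mem_antidiagonal.2 h, rfl, rfl⟩

end Analytic

end

end FreeJordanChar

open FreeJordanChar in
theorem theorem2 (K : Type*) [Field K] [CharZero K] (D : ℕ) (hD : 1 ≤ D)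
    (hvanish : ∀ k : ℕ, 1 ≤ k →
      lieHomologyInvariants (TAG.sl2Action K (FreeJordan K (Fin (1 + D)))) k = ⊥) :
    (IsAnalytic (jordanRep K D) ∧ IsAnalytic (innerRep K D)) ∧
      IsLambdaSolution (repClass (jordanRep K D)) (repClass (innerRep K D)) ∧
      ∀ A B : MvPowerSeries (Fin D) ℤ, IsLambdaSolution A B →
        repClass (jordanRep K D) = A ∧ repClass (innerRep K D) = B := by
  have h := invariantsAcyclic_of_vanishing hvanish
  have e : Option (Fin D) ≃ Fin (1 + D) := Fintype.equivOfCardEq (by simp [add_comm])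
  have hsol := isLambdaSolution_repClass (h.of_equiv e)
  exact ⟨⟨isAnalytic_jordanRep, isAnalytic_innerRep⟩, hsol, fun A B hAB => hsol.unique hAB⟩
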